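/- **Combinatorial data.** Let $\Gamma$ be a finite tree, $d$ a positive integer, and $b$, $(d_v)_{v\in V(\Gamma)}$ integers with $\sum_v d_v-|E(\Gamma)|\,2b=d$. Let $H_d=\{w\in\mathbb Z^{V(\Gamma)}:\sum_v w_v=d\}$. For $v\in V(\Gamma)$ of valence $\ell$, let $e_v\in\mathbb Z^{V(\Gamma)}$ be $-\ell$ at $v$, $1$ at each neighbour of $v$, and $0$ elsewhere; for $w,w'\in H_d$ let $d(w,w')$ be the minimal number of additions of vectors $e_v$ leading from $w$ to $w'$. Let $G$ be the directed graph whose vertices are the $w=(i_v)_v\in H_d$ with $i_v\equiv d_v \pmod 2$ for all $v$ and $|V(\Gamma')|\,2b-\sum_{v\in\Gamma'}(d_v-i_v)\ge 0$ for every connected component $\Gamma'$ of the complement of an edge of $\Gamma$, and which has an edge $\varepsilon$ from $w$ to $w'$, with associated vertex $v(\varepsilon)=v$, whenever $w'-w=2e_v$. For a directed path $P$ in $G$, let $v(P)$ be the multiset of the $v(\varepsilon)$, $\varepsilon$ an edge of $P$. **Prelinked bundles.** Let $S$ be a scheme, $s\in\Gamma(S,\mathcal O_S)$. An $s$-prelinked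 bundle $\mathscr E_\bullet$ of rank $t$ on $S$ consists of vector bundles $\mathscr E_w$ of rank $t$ ($w\in V(G)$) and morphisms $f_\varepsilon:\mathscr E_w\to\mathscr E_{w'}$ for each edge $\varepsilon$ from $w$ to $w'$ such that, writing $f_P$ for the composition along a path $P$, one has $f_{P'}=s^cf_P$ for all paths $P,P'$ with the same tail and head and with $P$ at most as long as $P'$, where $c$ is the number of times $V(\Gamma)$ appears in $v(P')$ minus the number of times it appears in $v(P)$. A prelinked bundle $E_\bullet$ of rank $r$ over a field is *simple* if there are $w_1,\dots,w_r\in V(G)$ and $v_i\in E_{w_i}$ such that for every $w\in V(G)$ there are paths $P_i$ from $w_i$ to $w$ with $f_{P_1}(v_1),\dots,f_{P_r}(v_r)$ a basis of $E_w$; it is *internally simple* relative to $m\in H_d$ if moreover one can take all $w_i$ with $2m-w_i\in V(G)$. **Forms.** Let $m\in H_d$. A *linked alternating form* of index $m$ on $\mathscr E_\bullet$ is a collection of bilinear pairings $\langle,\rangle_{w,w'}:\mathscr E_w\times\mathscr E_{w'}\to\mathcal O_S$ ($w,w'\in V(G)$) such that $\langle f_\varepsilon x,y\rangle_{w_1,w'}=s^{\delta}\langle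 x,y\rangle_{w,w'}$ for every edge $\varepsilon:w\to w_1$, where $\delta=1$ if $d(\frac{w+w'}2,m)<d(\frac{w_1+w'}2,m)$ and $\delta=0$ otherwise, such that the analogous condition holds in the second variable, and such that $\langle,\rangle_{w,w}$ is alternating and $\langle x,y\rangle_{w,w'}=-\langle y,x\rangle_{w',w}$ for $w\ne w'$. It is *internally symplectic* if $\langle,\rangle_{w,w'}$ is nondegenerate at every point of $S$ whenever $\frac{w+w'}2=m$. **Grassmannians.** A *linked subbundle* of rank $r$ of $\mathscr E_\bullet$ is a collection of subbundles $\mathscr F_w\subseteq\mathscr E_w$ of rank $r$ with $f_\varepsilon(\mathscr F_w)\subseteq\mathscr F_{w'}$ for each edge $\varepsilon:w\to w'$; it is *isotropic* if all $\langle,\rangle_{w,w'}$ vanish on it. For $r<t$ the *prelinked Grassmannian* $\operatorname{LG}(r,\mathscr E_\bullet)$ is the $S$-scheme representing the functor sending an $S$-scheme $T$ to the set of linked subbundles of rank $r$ of the pullback of $\mathscr E_\bullet$ to $T$, and the *prelinked alternating Grassmannian* $\operatorname{LAG}(r,\mathscr E_\bullet,\langle,\rangle_\bullet)$ is its closed subscheme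 parametrizing isotropic linked subbundles. A point of $\operatorname{LG}(r,\mathscr E_\bullet)$ is called simple (internally simple) if the induced prelinked bundle over its residue field is. **Theorem.** Let $\mathscr E_\bullet$ be $s$-prelinked of rank $t$ on $S$, $r<t$, $\langle,\rangle_\bullet$ a linked alternating form of index $m$ on $\mathscr E_\bullet$, and $z\in\operatorname{LAG}(r,\mathscr E_\bullet,\langle,\rangle_\bullet)$ a simple point of $\operatorname{LG}(r,\mathscr E_\bullet)$. Then, locally at $z$, $\operatorname{LAG}(r,\mathscr E_\bullet,\langle,\rangle_\bullet)$ is cut out by $\binom r2$ equations inside $\operatorname{LG}(r,\mathscr E_\bullet)$. If further $\langle,\rangle_\bullet$ is internally symplectic and $z$ is internally simple relative to $m$, then $\operatorname{LAG}(r,\mathscr E_\bullet,\langle,\rangle_\bullet)$ is smooth over $S$ at $z$, of codimension $\binom r2$ inside $\operatorname{LG}(r,\mathscr E_\bullet)$: near $z$ both schemes are smooth over $S$, and their relative dimensions differ by $\binom r2$. -/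

import Mathlib

open CategoryTheory CategoryTheory.Limits AlgebraicGeometry

universe u v

noncomputable section

namespace PrelinkedAG

/-! ### Combinatorics: the tree, the lattice `H_d` and the directed graph `G` -/

/-- The combinatorial data: a tree `Γ` on a finite vertex set, a positive integer `d`, and integers
`b` and `d_v` with `∑ d_v - |E(Γ)| 2b = d`. -/
structure TreeData (V : Type v) [Fintype V] where
  Γ : SimpleGraph V
  isTree : Γ.IsTree
  d : ℤ
  d_pos : 0 < d
  b : ℤ
  dv : V → ℤ
  sum_eq : ∑ x, dv x - (Γ.edgeSet.ncard : ℤ) * (2 * b) = d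

namespace TreeData

variable {V : Type v} [Fintype V] (A : TreeData V)

open Classical in
/-- The elementary operation at `x`: subtract the valence of `x` at `x`, and add `1` at each
vertex adjacent to `x`. -/
def move (x : V) : V → ℤ := fun y =>
  if y = x then -((A.Γ.neighborSet x).ncard : ℤ) else if A.Γ.Adj x y then 1 else 0

/-- The distance on `H_d`: the minimal number of elementary operations leading from `w` to `w'`. -/
def dist (w w' : V → ℤ) : ℕ :=
  sInf {n | ∃ l : List V, l.length = n ∧ w' = w + (l.map A.move).sum}

open Classical in
/-- Membership in the vertex set `V(G)`. The subtrees in the last condition are the connected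
components `c` of the graph obtained from `Γ` by deleting an edge `e`. -/
def IsVert (w : V → ℤ) : Prop :=
  ∑ x, w x = A.d ∧
  (∀ x, w x ≡ A.dv x [ZMOD 2]) ∧
  ∀ e ∈ A.Γ.edgeSet, ∀ c : (A.Γ.deleteEdges {e}).ConnectedComponent,
    0 ≤ (c.supp.toFinset.card : ℤ) * (2 * A.b) - ∑ x ∈ c.supp.toFinset, (A.dv x - w x)

/-- The vertex set `V(G)` of the directed graph `G`. -/
def Vert : Type v := {w : V → ℤ // A.IsVert w}

/-- The edges of `G`: an edge from `w` to `w'` is a vertex `x` of `Γ` such that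
`w' - w` is twice the elementary operation at `x`. -/
instance : Quiver.{v} A.Vert where
  Hom w w' := {x : V // w'.1 = w.1 + 2 • A.move x}

variable {A}

/-- The multiset `v(P)` of vertices of `Γ` associated to a directed path `P` in `G`. -/
def pathVerts {w : A.Vert} : {w' : A.Vert} → Quiver.Path w w' → Multiset V
  | _, .nil => 0
  | _, .cons P ε => ε.1 ::ₘ pathVerts P

open Classical in
/-- The number of times the whole set `V(Γ)` appears in `v(P)`. -/
def fullCount {w w' : A.Vert} (P : Quiver.Path w w') : ℕ :=
  ⨅ x : V, (pathVerts P).count x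

/-- The midpoint `(w + w') / 2`. The coordinates of `w` and `w'` are congruent modulo `2`, so that
the integer division is exact. -/
def mid (w w' : A.Vert) : V → ℤ := fun x => (w.1 x + w'.1 x) / 2

/-- The exponent which is `1` if `d(x, m) < d(y, m)` and `0` otherwise. -/
def delta (A : TreeData V) (m x y : V → ℤ) : ℕ := if A.dist x m < A.dist y m then 1 else 0

end TreeData

/-! ### Vector bundles and bilinear pairings -/

/-- `M` is a vector bundle of rank `n`: locally isomorphic to `𝒪ⁿ`. -/
def IsVectorBundle {X : Scheme.{u}} (M : X.Modules) (n : ℕ) : Prop :=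
  ∀ x : X, ∃ U : X.Opens, x ∈ U ∧
    Nonempty (M.restrict U.ι ≅
      (SheafOfModules.free (R := U.toScheme.ringCatSheaf) (ULift.{u} (Fin n)) :
        U.toScheme.Modules))

/-- The restriction of a global function to an open subset. -/
def resTop {X : Scheme.{u}} (s : Γ(X, ⊤)) (U : X.Opens) : Γ(X, U) :=
  (X.presheaf.map (homOfLE (le_top : U ≤ ⊤)).op).hom s

/-- An `𝒪`-bilinear pairing `M × N → 𝒪` of sheaves of modules. -/
structure Pairing {X : Scheme.{u}} (M N : X.Modules) where
  toFun (U : X.Opens) : Γ(M, U) →ₗ[Γ(X, U)] Γ(N, U) →ₗ[Γ(X, U)] Γ(X, U)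
  map_res {U U' : X.Opens} (h : U' ≤ U) (x : Γ(M, U)) (y : Γ(N, U)) :
    toFun U' ((M.presheaf.map (homOfLE h).op).hom x) ((N.presheaf.map (homOfLE h).op).hom y) =
      (X.presheaf.map (homOfLE h).op).hom (toFun U x y)

/-- The pull-back `g^* x ∈ Γ(g^* M, g⁻¹ U)` of a section `x ∈ Γ(M, U)`. -/
def pullSection {T X : Scheme.{u}} (g : T ⟶ X) {M : X.Modules} {U : X.Opens} (x : Γ(M, U)) :
    Γ((Scheme.Modules.pullback g).obj M, g ⁻¹ᵁ U) :=
  (((Scheme.Modules.pullbackPushforwardAdjunction g).unit.app M).app U).hom x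

/-- `C` is the pull-back of the pairing `B` along `g`, that is, the (unique) pairing of `g^* M` and
`g^* N` such that `C(g^* x, g^* y) = g^* B(x, y)`. -/
def Pairing.IsPullback {T X : Scheme.{u}} (g : T ⟶ X) {M N : X.Modules} (B : Pairing M N)
    (C : Pairing ((Scheme.Modules.pullback g).obj M) ((Scheme.Modules.pullback g).obj N)) : Prop :=
  ∀ (U : X.Opens) (x : Γ(M, U)) (y : Γ(N, U)),
    C.toFun (g ⁻¹ᵁ U) (pullSection g x) (pullSection g y) = (g.app U).hom (B.toFun U x y)

/-- A pairing is perfect if its pull-back to (the spectrum of the residue field of) every point is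
nondegenerate. -/
def Pairing.IsPerfect {X : Scheme.{u}} {M N : X.Modules} (B : Pairing M N) : Prop :=
  ∀ x : X, ∃ C, B.IsPullback (X.fromSpecResidueField x) C ∧ (C.toFun ⊤).Nondegenerate

/-! ### Prelinked bundles -/

variable {V : Type v} [Fintype V] {A : TreeData V}

/-- The data `ℰ_•`: a sheaf of modules for each vertex of `G` and a morphism for each edge of `G`. -/
abbrev LinkedData (A : TreeData V) (X : Scheme.{u}) := A.Vert ⥤q X.Modules

/-- The pull-back of `ℰ_•` along `g`. -/
def LinkedData.pullback {T X : Scheme.{u}} (E : LinkedData A X) (g : T ⟶ X) : LinkedData A T :=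
  E ⋙q (Scheme.Modules.pullback g).toPrefunctor

/-- The composition `f_P` of the morphisms along the directed path `P`. -/
def LinkedData.pathMap {X : Scheme.{u}} (E : LinkedData A X) {w w' : A.Vert}
    (P : Quiver.Path w w') : E.obj w ⟶ E.obj w' :=
  composePath (E.mapPath P)

/-- `ℰ_•` is an `s`-prelinked bundle of rank `t` on `X`. -/
structure IsPrelinked {X : Scheme.{u}} (E : LinkedData A X) (s : Γ(X, ⊤)) (t : ℕ) : Prop where
  isVectorBundle (w : A.Vert) : IsVectorBundle (E.obj w) t
  pathMap_eq {w w' : A.Vert} (P P' : Quiver.Path w w') (h : P.length ≤ P'.length)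
    (U : X.Opens) (x : Γ(E.obj w, U)) :
    ((E.pathMap P').app U).hom x =
      resTop s U ^ (TreeData.fullCount P' - TreeData.fullCount P) • ((E.pathMap P).app U).hom x

/-- Given vertices `w_i` of `G` and global sections `v_i` of `E_{w_i}`, for `i = 1, …, r`: for every
vertex `u` of `G` there are paths `P_i` from `w_i` to `u` such that the `f_{P_i}(v_i)` form a
basis of the global sections of `E_u`. -/
def LinkedData.Generates {X : Scheme.{u}} (E : LinkedData A X) {r : ℕ} (w : Fin r → A.Vert)
    (x : ∀ i, Γ(E.obj (w i), ⊤)) : Prop :=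
  ∀ u : A.Vert, ∃ P : ∀ i, Quiver.Path (w i) u,
    LinearIndependent Γ(X, ⊤) (fun i => ((E.pathMap (P i)).app ⊤).hom (x i)) ∧
    Submodule.span Γ(X, ⊤) (Set.range fun i => ((E.pathMap (P i)).app ⊤).hom (x i)) = ⊤

/-- Simplicity of a prelinked bundle of rank `r` at a point `x`: the prelinked bundle
which it induces on the spectrum of the residue field of `x` is simple. -/
def LinkedData.IsSimpleAt {X : Scheme.{u}} (E : LinkedData A X) (r : ℕ) (x : X) : Prop :=
  ∃ (w : Fin r → A.Vert)
    (y : ∀ i, Γ((E.pullback (X.fromSpecResidueField x)).obj (w i), ⊤)),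
    (E.pullback (X.fromSpecResidueField x)).Generates w y

/-- Internal simplicity, relative to `m`, of a prelinked bundle of rank `r` at a point `x`. -/
def LinkedData.IsInternallySimpleAt {X : Scheme.{u}} (E : LinkedData A X) (r : ℕ) (m : V → ℤ)
    (x : X) : Prop :=
  ∃ (w : Fin r → A.Vert)
    (y : ∀ i, Γ((E.pullback (X.fromSpecResidueField x)).obj (w i), ⊤)),
    (E.pullback (X.fromSpecResidueField x)).Generates w y ∧ ∀ i, A.IsVert (2 • m - (w i).1)

/-! ### Linked alternating forms -/

/-- A linked alternating form of index `m` on `ℰ_•`. -/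
structure LinkedAlternatingForm {X : Scheme.{u}} (E : LinkedData A X) (s : Γ(X, ⊤)) (m : V → ℤ)
    where
  form (w w' : A.Vert) : Pairing (E.obj w) (E.obj w')
  map_left {w w₁ : A.Vert} (ε : w ⟶ w₁) (w' : A.Vert) (U : X.Opens)
    (x : Γ(E.obj w, U)) (y : Γ(E.obj w', U)) :
    (form w₁ w').toFun U (((E.map ε).app U).hom x) y =
      resTop s U ^ A.delta m (TreeData.mid w w') (TreeData.mid w₁ w') * (form w w').toFun U x y
  map_right (w : A.Vert) {w' w₁ : A.Vert} (ε : w' ⟶ w₁) (U : X.Opens)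
    (x : Γ(E.obj w, U)) (y : Γ(E.obj w', U)) :
    (form w w₁).toFun U x (((E.map ε).app U).hom y) =
      resTop s U ^ A.delta m (TreeData.mid w w') (TreeData.mid w w₁) * (form w w').toFun U x y
  self_eq_zero (w : A.Vert) (U : X.Opens) (x : Γ(E.obj w, U)) : (form w w).toFun U x x = 0
  neg_swap {w w' : A.Vert} (h : w ≠ w') (U : X.Opens) (x : Γ(E.obj w, U)) (y : Γ(E.obj w', U)) :
    (form w w').toFun U x y = -(form w' w).toFun U y x

/-- A linked alternating form of index `m` is internally symplectic if the pairing of `E_w` and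
`E_{w'}` is perfect whenever `(w + w') / 2 = m`. -/
def LinkedAlternatingForm.IsInternallySymplectic {X : Scheme.{u}} {E : LinkedData A X}
    {s : Γ(X, ⊤)} {m : V → ℤ} (ω : LinkedAlternatingForm E s m) : Prop :=
  ∀ w w' : A.Vert, TreeData.mid w w' = m → (ω.form w w').IsPerfect

/-! ### Linked subbundles and prelinked Grassmannians -/

/-- A linked subbundle of rank `r` of `ℰ_•`, where `ℰ_•` has rank `t`. -/
structure LinkedSubbundle {X : Scheme.{u}} (E : LinkedData A X) (r t : ℕ) where
  sub (w : A.Vert) : Subobject (E.obj w)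
  isVectorBundle_sub (w : A.Vert) : IsVectorBundle (sub w : X.Modules) r
  isVectorBundle_quot (w : A.Vert) : IsVectorBundle (cokernel (sub w).arrow) (t - r)
  factors {w w' : A.Vert} (ε : w ⟶ w') : (sub w').Factors ((sub w).arrow ≫ E.map ε)

/-- The data `ℱ_•`, with the restrictions of the morphisms of `ℰ_•`. -/
def LinkedSubbundle.toLinkedData {X : Scheme.{u}} {E : LinkedData A X} {r t : ℕ}
    (F : LinkedSubbundle E r t) : LinkedData A X where
  obj w := (F.sub w : X.Modules)
  map {w w'} ε := (F.sub w').factorThru ((F.sub w).arrow ≫ E.map ε) (F.factors ε)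

/-- A linked subbundle of the pull-back of `ℰ_•` along `g` is isotropic if the pull-backs of the
pairings `⟨,⟩_{w,w'}` vanish identically on it. -/
def LinkedSubbundle.IsIsotropic {T S : Scheme.{u}} {E : LinkedData A S} {s : Γ(S, ⊤)} {m : V → ℤ}
    {g : T ⟶ S} {r t : ℕ} (F : LinkedSubbundle (E.pullback g) r t)
    (ω : LinkedAlternatingForm E s m) : Prop :=
  ∀ w w' : A.Vert, ∃ C : Pairing ((E.pullback g).obj w) ((E.pullback g).obj w'),
    (ω.form w w').IsPullback g C ∧
    ∀ (U : T.Opens) (x : Γ((F.sub w : T.Modules), U)) (y : Γ((F.sub w' : T.Modules), U)),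
      C.toFun U (((F.sub w).arrow.app U).hom x) (((F.sub w').arrow.app U).hom y) = 0

/-- `F'`, a linked subbundle of the pull-back of `ℰ_•` to the `S`-scheme `T`, is the pull-back along
the `S`-morphism `h : T ⟶ X` of `F`, a linked subbundle of the pull-back of `ℰ_•` to `X`. -/
def LinkedSubbundle.IsPullback {T X S : Scheme.{u}} {E : LinkedData A S} {r t : ℕ}
    {p : X ⟶ S} {g : T ⟶ S} (h : T ⟶ X) (F : LinkedSubbundle (E.pullback p) r t)
    (F' : LinkedSubbundle (E.pullback g) r t) : Prop :=
  ∃ hg : h ≫ p = g, ∀ w : A.Vert,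
    ∃ e : (Scheme.Modules.pullback h).obj (F.sub w : X.Modules) ≅ (F'.sub w : T.Modules),
      e.hom ≫ (F'.sub w).arrow =
        (Scheme.Modules.pullback h).map (F.sub w).arrow ≫
          (Scheme.Modules.pullbackComp h p).hom.app (E.obj w) ≫
          (Scheme.Modules.pullbackCongr hg).hom.app (E.obj w)

/-- The prelinked Grassmannian `LG(r, ℰ_•)`, for `ℰ_•` of rank `t`: an `S`-scheme with a universal
linked subbundle, representing the functor that sends an `S`-scheme `T` to the set of linked
subbundles of rank `r` of the pull-back of `ℰ_•` to `T`. -/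
structure PrelinkedGrassmannian {S : Scheme.{u}} (E : LinkedData A S) (r t : ℕ) where
  X : Scheme.{u}
  p : X ⟶ S
  univ : LinkedSubbundle (E.pullback p) r t
  existsUnique {T : Scheme.{u}} (g : T ⟶ S) (F : LinkedSubbundle (E.pullback g) r t) :
    ∃! h : T ⟶ X, LinkedSubbundle.IsPullback h univ F

/-- The prelinked alternating Grassmannian `LAG(r, ℰ_•, ⟨,⟩_•)`: the closed subscheme of `LG(r, ℰ_•)`
parametrizing the isotropic linked subbundles. -/
structure PrelinkedAlternatingGrassmannian {S : Scheme.{u}} {E : LinkedData A S} {r t : ℕ}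
    (LG : PrelinkedGrassmannian E r t) {s : Γ(S, ⊤)} {m : V → ℤ}
    (ω : LinkedAlternatingForm E s m) where
  Y : Scheme.{u}
  i : Y ⟶ LG.X
  isClosedImmersion : IsClosedImmersion i
  factors_iff {T : Scheme.{u}} (g : T ⟶ S) (F : LinkedSubbundle (E.pullback g) r t) (h : T ⟶ LG.X)
    (hF : LinkedSubbundle.IsPullback h LG.univ F) : (∃ k : T ⟶ Y, k ≫ i = h) ↔ F.IsIsotropic ω

/-! ### Local geometry of closed subschemes -/

/-- Locally at the point `z` of `Y`, the closed subscheme `i : Y ⟶ X` is cut out by `c` equations: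
on some affine open neighbourhood its ideal is generated by `c` functions. -/
def IsLocallyCutOutBy {X Y : Scheme.{u}} (i : Y ⟶ X) (z : Y) (c : ℕ) : Prop :=
  ∃ U : X.Opens, IsAffineOpen U ∧ i z ∈ U ∧ ∃ a : Fin c → Γ(X, U),
    RingHom.ker (i.app U).hom = Ideal.span (Set.range a)

/-- The closed subscheme `i : Y ⟶ X` of the `S`-scheme `p : X ⟶ S` is smooth over `S` at its point
`z`, of codimension `c` in `X`: near `z`, both `Y` and `X` are smooth over `S`, of
relative dimensions that differ by `c`. -/
def IsSmoothOfCodimAt {X Y S : Scheme.{u}} (i : Y ⟶ X) (p : X ⟶ S) (z : Y) (c : ℕ) : Prop :=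
  ∃ U : X.Opens, i z ∈ U ∧ ∃ n : ℕ,
    SmoothOfRelativeDimension (n + c) (U.ι ≫ p) ∧
    SmoothOfRelativeDimension n ((i ⁻¹ᵁ U).ι ≫ i ≫ p)

end PrelinkedAG

end

open PrelinkedAG

/-! Let `F` be the universal linked subbundle on LG. Near a simple point the generating vectors lift
to sections `v_i` of `F` at the vertices `w_i`, and at every vertex `u` their images along shortest
paths form a frame of `F_u`: this asks for one invertible minor of size `r` per vertex, an open
condition because `V(G)` is finite. The prelinked condition makes the image of `v_i` along any other
path a multiple of its image along a shortest one, so shortest paths suffice and the span of the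
images is automatically linked.

Equations. Moving a vector along an edge multiplies the form by a power of `s`, so the form on the
images of `v_i` and `v_j` at any two vertices is a multiple of its value on `v_i` and `v_j`
themselves (`exists_sum_rows_eq`). Hence `F` is isotropic exactly when these values vanish, and
alternation leaves the pairs `i < j` (`isIsotropic_iff`). Testing this on points with values in
quotient rings identifies the ideal of LAG (`ker_app_eq_span`).

Smoothness of LG. Tuples of `r` vectors with invertible minors form an open subset of an affine
space over the base, and each tuple spans a linked subbundle. The coordinates of the `v_i` give a
section of the resulting map to LG near the point, so LG is locally a retract of a smooth scheme
(`smooth_of_retract`, `exists_smooth_localizationAway`).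

Codimension. Deforming the tuple to first order in all coordinate directions gives a point of LG
over dual numbers. The derivative of the value on `v_i` and `v_j` in the direction of `v_i` is the
functional of pairing with `v_j`, so it suffices that, for fixed `i`, these functionals on `E_{w_i}`
are independent for varying `j` (`linearIndependent_valueDeriv`). Internal simplicity makes `u = 2m
- w_i` a vertex. There `E_{w_i}` and `E_u` are in perfect duality and the images of the `v_j` are
independent; pairing with such an image is a multiple of pairing with `v_j`, which gives the
independence (`linearIndependent_mulVec_gram`). A Jacobian criterion
(`exists_isStandardSmoothOfRelativeDimension_quotient`) then makes the equations part of a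
coordinate system, étale over affine space. -/

noncomputable section

namespace PrelinkedAG

section

/-! ### Sections of sheaves of modules -/

section Sections

variable {X : Scheme.{u}} {M N : X.Modules}

/-- The restriction of a section of a sheaf of modules to a smaller open subset. -/
def secRes {U V : X.Opens} (h : V ≤ U) (x : Γ(M, U)) : Γ(M, V) :=
  (M.presheaf.map (homOfLE h).op).hom x

/-- The restriction of functions to a smaller open subset. -/
def funRes {U V : X.Opens} (h : V ≤ U) : Γ(X, U) →+* Γ(X, V) :=
  (X.presheaf.map (homOfLE h).op).hom

@[simp]
lemma secRes_add {U V : X.Opens} (h : V ≤ U) (x y : Γ(M, U)) :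
    secRes h (x + y) = secRes h x + secRes h y := map_add _ _ _

@[simp]
lemma secRes_sum {ι : Type*} {U V : X.Opens} (h : V ≤ U) (t : Finset ι) (x : ι → Γ(M, U)) :
    secRes h (∑ i ∈ t, x i) = ∑ i ∈ t, secRes h (x i) := map_sum _ _ _

@[simp]
lemma secRes_smul {U V : X.Opens} (h : V ≤ U) (a : Γ(X, U)) (x : Γ(M, U)) :
    secRes h (a • x) = funRes h a • secRes h x := Scheme.Modules.map_smul M (homOfLE h) a x

@[simp]
lemma secRes_secRes {U V W : X.Opens} (h : V ≤ U) (h' : W ≤ V) (x : Γ(M, U)) :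
    secRes h' (secRes h x) = secRes (h'.trans h) x := by
  simp only [secRes, ← AddCommGrpCat.comp_apply, ← Functor.map_comp]
  rfl

@[simp]
lemma secRes_self {U : X.Opens} (h : U ≤ U) (x : Γ(M, U)) : secRes h x = x := by
  simp [secRes]

@[simp]
lemma funRes_funRes {U V W : X.Opens} (h : V ≤ U) (h' : W ≤ V) (x : Γ(X, U)) :
    funRes h' (funRes h x) = funRes (h'.trans h) x := by
  simp only [funRes, ← CommRingCat.comp_apply, ← Functor.map_comp]
  rfl

@[simp]
lemma funRes_self {U : X.Opens} (h : U ≤ U) (x : Γ(X, U)) : funRes h x = x := by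
  simp [funRes]

/-- The action of a morphism of sheaves of modules on sections, as a linear map. -/
def secMap (φ : M ⟶ N) (U : X.Opens) : Γ(M, U) →ₗ[Γ(X, U)] Γ(N, U) where
  toFun x := (φ.app U).hom x
  map_add' := map_add _
  map_smul' := Scheme.Modules.Hom.app_smul φ

lemma secMap_secRes (φ : M ⟶ N) {U V : X.Opens} (h : V ≤ U) (x : Γ(M, U)) :
    secMap φ V (secRes h x) = secRes h (secMap φ U x) :=
  ConcreteCategory.congr_hom (φ.mapPresheaf.naturality (homOfLE h).op) x

@[simp]
lemma secMap_comp {K : X.Modules} (φ : M ⟶ N) (ψ : N ⟶ K) (U : X.Opens) (x : Γ(M, U)) :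
    secMap (φ ≫ ψ) U x = secMap ψ U (secMap φ U x) := rfl

@[simp]
lemma secMap_id (U : X.Opens) (x : Γ(M, U)) : secMap (𝟙 M) U x = x := rfl

lemma hom_ext_sections {φ ψ : M ⟶ N} (h : ∀ U x, secMap φ U x = secMap ψ U x) : φ = ψ := by
  ext U x
  exact h U x

lemma isIso_of_bijective (φ : M ⟶ N) (h : ∀ U, Function.Bijective (secMap φ U)) : IsIso φ := by
  rw [Scheme.Modules.Hom.isIso_iff_isIso_app]
  intro U
  exact (ConcreteCategory.isIso_iff_bijective _).mpr (h U)

end Sections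

/-! ### Pull-backs of sections, and the comparison isomorphisms between iterated pull-backs -/

section PullSec

variable {T X : Scheme.{u}} (g : T ⟶ X) {M N : X.Modules}

/-- The pull-back of a section, restricted to an open subset of the preimage. -/
def pullSec {U : X.Opens} {V : T.Opens} (h : V ≤ g ⁻¹ᵁ U) (x : Γ(M, U)) :
    Γ((Scheme.Modules.pullback g).obj M, V) :=
  secRes h (pullSection g x)

lemma pullSection_eq {U : X.Opens} (x : Γ(M, U)) :
    pullSection g x = pullSec g le_rfl x := by simp [pullSec]

lemma pullSec_add {U : X.Opens} {V : T.Opens} (h : V ≤ g ⁻¹ᵁ U) (x y : Γ(M, U)) :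
    pullSec g h (x + y) = pullSec g h x + pullSec g h y := by
  simp only [pullSec, ← secRes_add]
  congr 1
  exact map_add _ _ _

lemma pullSec_smul {U : X.Opens} {V : T.Opens} (h : V ≤ g ⁻¹ᵁ U) (a : Γ(X, U)) (x : Γ(M, U)) :
    pullSec g h (a • x) = (g.appLE U V h).hom a • pullSec g h x := by
  have : pullSection g (a • x) = (g.app U).hom a • pullSection g x :=
    Scheme.Modules.Hom.app_smul ((Scheme.Modules.pullbackPushforwardAdjunction g).unit.app M) a x
  simp only [pullSec, this, secRes_smul]
  rfl

lemma pullSec_secRes {U U' : X.Opens} {V : T.Opens} (h' : U' ≤ U) (h : V ≤ g ⁻¹ᵁ U')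
    (x : Γ(M, U)) :
    pullSec g h (secRes h' x) = pullSec g (h.trans (g.preimage_mono h')) x := by
  have : pullSection g (secRes h' x) = secRes (g.preimage_mono h') (pullSection g x) :=
    secMap_secRes ((Scheme.Modules.pullbackPushforwardAdjunction g).unit.app M) h' x
  simp [pullSec, this]

lemma secRes_pullSec {U : X.Opens} {V V' : T.Opens} (h : V ≤ g ⁻¹ᵁ U) (h' : V' ≤ V)
    (x : Γ(M, U)) :
    secRes h' (pullSec g h x) = pullSec g (h'.trans h) x := by
  simp [pullSec]

lemma pullSec_sum {ι : Type*} {U : X.Opens} {V : T.Opens} (h : V ≤ g ⁻¹ᵁ U) (t : Finset ι)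
    (x : ι → Γ(M, U)) :
    pullSec g h (∑ i ∈ t, x i) = ∑ i ∈ t, pullSec g h (x i) :=
  map_sum (AddMonoidHom.mk' (pullSec g h) (pullSec_add g h)) x t

lemma secMap_pullback_map (φ : M ⟶ N) {U : X.Opens} {V : T.Opens} (h : V ≤ g ⁻¹ᵁ U)
    (x : Γ(M, U)) :
    secMap ((Scheme.Modules.pullback g).map φ) V (pullSec g h x) = pullSec g h (secMap φ U x) := by
  have h1 := (Scheme.Modules.pullbackPushforwardAdjunction g).unit.naturality φ
  have h2 := congrArg (fun f => secMap f U x) h1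
  simp only [pullSec, secMap_secRes]
  congr 1
  exact h2.symm

/-- By adjunction a morphism out of `g^* M` is a morphism out of `M`, hence is known on the
pulled-back sections, although these are not all the sections of `g^* M`. -/
lemma pullback_hom_ext {K : T.Modules} {φ ψ : (Scheme.Modules.pullback g).obj M ⟶ K}
    (h : ∀ (U : X.Opens) (x : Γ(M, U)),
      secMap φ (g ⁻¹ᵁ U) (pullSec g le_rfl x) = secMap ψ (g ⁻¹ᵁ U) (pullSec g le_rfl x)) :
    φ = ψ := by
  apply ((Scheme.Modules.pullbackPushforwardAdjunction g).homEquiv _ _).injective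
  apply hom_ext_sections
  intro U x
  have := h U x
  simp only [← pullSection_eq] at this
  simpa [Adjunction.homEquiv_unit] using! this

/-- The comparison isomorphism is the conjugate of the one for push-forwards, hence compatible with
the units of the adjunctions; pulled-back sections are values of these units. -/
lemma secMap_pullbackComp_inv {Y : Scheme.{u}} (h : Y ⟶ T) {U : X.Opens} (x : Γ(M, U)) :
    secMap ((Scheme.Modules.pullbackComp h g).inv.app M) ((h ≫ g) ⁻¹ᵁ U)
      (pullSection (h ≫ g) x) = pullSection h (pullSection g x) := by
  have h1 := unit_conjugateEquiv
    ((Scheme.Modules.pullbackPushforwardAdjunction g).comp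
      (Scheme.Modules.pullbackPushforwardAdjunction h))
    (Scheme.Modules.pullbackPushforwardAdjunction (h ≫ g))
    (Scheme.Modules.pullbackComp h g).inv M
  rw [Scheme.Modules.conjugateEquiv_pullbackComp_inv] at h1
  have h2 := congrArg (fun f => secMap f U x) h1
  rw [Adjunction.comp_unit_app] at h2
  exact h2.symm

lemma secMap_pullbackComp {Y : Scheme.{u}} (h : Y ⟶ T) {U : X.Opens} {V : T.Opens} {W : Y.Opens}
    (hV : V ≤ g ⁻¹ᵁ U) (hW : W ≤ h ⁻¹ᵁ V) (x : Γ(M, U)) :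
    secMap ((Scheme.Modules.pullbackComp h g).hom.app M) W (pullSec h hW (pullSec g hV x)) =
      pullSec (h ≫ g) (hW.trans (h.preimage_mono hV)) x := by
  have h2 : pullSec h hW (pullSec g hV x) =
      secMap ((Scheme.Modules.pullbackComp h g).inv.app M) W
        (pullSec (h ≫ g) (hW.trans (h.preimage_mono hV)) x) :=
    (pullSec_secRes h hV hW (pullSection g x)).trans <|
      (congrArg (secRes (hW.trans (h.preimage_mono hV))) (secMap_pullbackComp_inv g h x)).symm.trans
        (secMap_secRes _ _ _).symm
  refine (congrArg (secMap ((Scheme.Modules.pullbackComp h g).hom.app M) W) h2).trans ?_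
  rw [← secMap_comp, Iso.inv_hom_id_app, secMap_id]

lemma secMap_pullbackCongr {g g' : T ⟶ X} (e : g = g') {U : X.Opens} {V : T.Opens}
    (h : V ≤ g ⁻¹ᵁ U) (x : Γ(M, U)) :
    secMap ((Scheme.Modules.pullbackCongr e).hom.app M) V (pullSec g h x) =
      pullSec g' (e ▸ h) x := by
  subst e
  rfl

end PullSec

end

section

/-! ### Frames -/

section Frames

variable {X : Scheme.{u}} {M N : X.Modules} {ι : Type*} [Fintype ι]

/-- The sections `b i` of `M` over `U` form a frame: over each smaller open subset, every section
is in a unique way a linear combination of them. -/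
def IsFrame {U : X.Opens} (b : ι → Γ(M, U)) : Prop :=
  ∀ (V : X.Opens) (h : V ≤ U),
    Function.Bijective fun c : ι → Γ(X, V) => ∑ i, c i • secRes h (b i)

lemma IsFrame.secRes {U V : X.Opens} {b : ι → Γ(M, U)} (hb : IsFrame b) (h : V ≤ U) :
    IsFrame fun i => secRes h (b i) := by
  intro W hW
  simpa using hb W (hW.trans h)

/-- The coordinates of sections with respect to a frame. -/
def IsFrame.coord {U V : X.Opens} {b : ι → Γ(M, U)} (hb : IsFrame b) (h : V ≤ U) :
    Γ(M, V) ≃ₗ[Γ(X, V)] (ι → Γ(X, V)) :=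
  (LinearEquiv.ofBijective (Fintype.linearCombination Γ(X, V) fun i => PrelinkedAG.secRes h (b i))
    (hb V h)).symm

lemma IsFrame.sum_coord {U V : X.Opens} {b : ι → Γ(M, U)} (hb : IsFrame b) (h : V ≤ U)
    (x : Γ(M, V)) : ∑ i, hb.coord h x i • PrelinkedAG.secRes h (b i) = x :=
  (LinearEquiv.ofBijective (Fintype.linearCombination Γ(X, V)
    fun i => PrelinkedAG.secRes h (b i)) (hb V h)).apply_symm_apply x

lemma IsFrame.coord_sum {U V : X.Opens} {b : ι → Γ(M, U)} (hb : IsFrame b) (h : V ≤ U)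
    (c : ι → Γ(X, V)) : hb.coord h (∑ i, c i • PrelinkedAG.secRes h (b i)) = c :=
  (LinearEquiv.ofBijective (Fintype.linearCombination Γ(X, V)
    fun i => PrelinkedAG.secRes h (b i)) (hb V h)).symm_apply_apply c

lemma IsFrame.coord_secRes {U V W : X.Opens} {b : ι → Γ(M, U)} (hb : IsFrame b) (h : V ≤ U)
    (h' : W ≤ V) (x : Γ(M, V)) :
    hb.coord (h'.trans h) (PrelinkedAG.secRes h' x) = fun i => funRes h' (hb.coord h x i) := by
  conv_lhs => rw [← hb.sum_coord h x]
  simp only [secRes_sum, secRes_smul, secRes_secRes]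
  exact hb.coord_sum (h'.trans h) _

lemma IsFrame.coord_self [DecidableEq ι] {U V : X.Opens} {b : ι → Γ(M, U)} (hb : IsFrame b)
    (h : V ≤ U) (i : ι) : hb.coord h (PrelinkedAG.secRes h (b i)) = Pi.single i 1 := by
  rw [← hb.coord_sum h (Pi.single i 1)]
  simp [Pi.single_apply]

/-- A morphism of sheaves of modules, given by its action on sections. -/
def homOfSecMap (f : ∀ U : X.Opens, Γ(M, U) →ₗ[Γ(X, U)] Γ(N, U))
    (hf : ∀ {U V : X.Opens} (h : V ≤ U) (x : Γ(M, U)), f V (secRes h x) = secRes h (f U x)) :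
    M ⟶ N where
  val :=
    { app := fun U => ModuleCat.ofHom (f U.unop)
      naturality := by
        intro U V h
        ext x
        exact hf (leOfHom h.unop) x }

lemma secMap_homOfSecMap (f : ∀ U : X.Opens, Γ(M, U) →ₗ[Γ(X, U)] Γ(N, U))
    (hf : ∀ {U V : X.Opens} (h : V ≤ U) (x : Γ(M, U)), f V (secRes h x) = secRes h (f U x))
    (U : X.Opens) (x : Γ(M, U)) : secMap (homOfSecMap f hf) U x = f U x := rfl

lemma IsFrame.exists_hom {b : ι → Γ(M, ⊤)} (hb : IsFrame b) (n : ι → Γ(N, ⊤)) :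
    ∃ φ : M ⟶ N, ∀ i, secMap φ ⊤ (b i) = n i := by
  classical
  refine ⟨homOfSecMap (fun U => (Fintype.linearCombination Γ(X, U)
    fun i => PrelinkedAG.secRes le_top (n i)) ∘ₗ (hb.coord le_top).toLinearMap) ?_, fun i => ?_⟩
  · intro U V h x
    simp only [LinearMap.comp_apply, LinearEquiv.coe_coe, Fintype.linearCombination_apply]
    rw [hb.coord_secRes le_top h]
    simp
  · rw [secMap_homOfSecMap]
    have := hb.coord_self le_rfl i
    rw [secRes_self] at this
    simp only [LinearMap.comp_apply, LinearEquiv.coe_coe, this]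
    simp [Fintype.linearCombination_apply, Pi.single_apply]

lemma IsFrame.hom_ext {b : ι → Γ(M, ⊤)} (hb : IsFrame b) {φ ψ : M ⟶ N}
    (h : ∀ i, secMap φ ⊤ (b i) = secMap ψ ⊤ (b i)) : φ = ψ := by
  refine hom_ext_sections fun U x => ?_
  rw [← hb.sum_coord le_top x]
  simp [secMap_secRes, h]

lemma isIso_of_isFrame {b : ι → Γ(M, ⊤)} {n : ι → Γ(N, ⊤)} (hb : IsFrame b) (hn : IsFrame n)
    (φ : M ⟶ N) (h : ∀ i, secMap φ ⊤ (b i) = n i) : IsIso φ := by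
  refine isIso_of_bijective φ fun U => ?_
  have h1 : (secMap φ U : Γ(M, U) → Γ(N, U)) ∘
      (fun c : ι → Γ(X, U) => ∑ i, c i • PrelinkedAG.secRes le_top (b i)) =
      fun c : ι → Γ(X, U) => ∑ i, c i • PrelinkedAG.secRes le_top (n i) := by
    funext c
    simp [secMap_secRes, h]
  have h2 := hn U le_top
  rw [← h1] at h2
  exact (Function.Bijective.of_comp_iff _ (hb U le_top)).mp h2

lemma IsFrame.map_iso {U : X.Opens} {b : ι → Γ(M, U)} (hb : IsFrame b) (φ : M ⟶ N) [IsIso φ] :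
    IsFrame fun i => secMap φ U (b i) := by
  intro V h
  have h1 : (secMap φ V : Γ(M, V) → Γ(N, V)) ∘
      (fun c : ι → Γ(X, V) => ∑ i, c i • PrelinkedAG.secRes h (b i)) =
      fun c : ι → Γ(X, V) => ∑ i, c i • PrelinkedAG.secRes h (secMap φ U (b i)) := by
    funext c
    simp [secMap_secRes]
  rw [← h1]
  refine Function.Bijective.comp ?_ (hb V h)
  have : IsIso (φ.app V) := inferInstance
  exact (ConcreteCategory.isIso_iff_bijective _).mp this

lemma IsFrame.reindex {κ : Type*} [Fintype κ] {U : X.Opens} {b : ι → Γ(M, U)} (hb : IsFrame b)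
    (e : κ ≃ ι) : IsFrame fun k => b (e k) := by
  intro V h
  convert (hb V h).comp (Equiv.arrowCongr e (Equiv.refl Γ(X, V))).bijective using 1
  funext c
  simp only [Function.comp_apply]
  rw [← Equiv.sum_comp e]
  simp

/-- A change of frame, given by an invertible matrix. -/
lemma IsFrame.of_isUnit_det [DecidableEq ι] {U : X.Opens} {b b' : ι → Γ(M, U)} (hb : IsFrame b)
    (C : Matrix ι ι Γ(X, U)) (hC : IsUnit C.det) (h : ∀ i, b' i = ∑ j, C i j • b j) :
    IsFrame b' := by
  intro V hV
  have h1 : (fun c : ι → Γ(X, V) => ∑ i, c i • PrelinkedAG.secRes hV (b' i)) =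
      (fun c : ι → Γ(X, V) => ∑ i, c i • PrelinkedAG.secRes hV (b i)) ∘
        fun c => Matrix.vecMul c (C.map (funRes hV)) := by
    funext c
    simp only [h, secRes_sum, secRes_smul, Finset.smul_sum, Function.comp_apply, Matrix.vecMul,
      dotProduct, Finset.sum_smul, smul_smul, Matrix.map_apply]
    exact Finset.sum_comm
  rw [h1]
  refine (hb V hV).comp ?_
  have h2 : IsUnit (C.map (funRes hV)) := by
    rw [Matrix.isUnit_iff_isUnit_det, ← RingHom.mapMatrix_apply, ← RingHom.map_det]
    exact hC.map _
  exact ⟨Matrix.vecMul_injective_of_isUnit h2, Matrix.vecMul_surjective_iff_isUnit.mpr h2⟩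

/-- The structure sheaf as a sheaf of modules. -/
abbrev structureModule (X : Scheme.{u}) : X.Modules := SheafOfModules.unit X.ringCatSheaf

/-- The section `1` of the structure sheaf. -/
def oneSection (X : Scheme.{u}) : Γ(structureModule X, ⊤) := (1 : Γ(X, ⊤))

lemma secRes_oneSection (V : X.Opens) :
    secRes (le_top : V ≤ ⊤) (oneSection X) = (1 : Γ(X, V)) :=
  map_one (X.presheaf.map (homOfLE (le_top : V ≤ ⊤)).op).hom

lemma smul_secRes_oneSection {V : X.Opens} (c : Γ(X, V)) :
    (c • secRes (le_top : V ≤ ⊤) (oneSection X) : Γ(structureModule X, V)) = c := by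
  rw [secRes_oneSection]
  exact mul_one c

lemma isFrame_oneSection (X : Scheme.{u}) : IsFrame fun _ : Unit => oneSection X := by
  intro V h
  have : (fun c : Unit → Γ(X, V) => ∑ i, c i • secRes h (oneSection X)) = fun c => c () := by
    funext c
    rw [Fintype.sum_unique]
    exact smul_secRes_oneSection (c ())
  rw [this]
  exact (Equiv.funUnique Unit Γ(X, V)).bijective

end Frames

end

section

/-! ### Frames as direct sum decompositions, and pull-back of global frames -/

section FrameConstructions

variable {X : Scheme.{u}} {M N L : X.Modules} {ι : Type*} [Fintype ι] [DecidableEq ι]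

lemma secMap_sum {κ : Type*} (t : Finset κ) (f : κ → (M ⟶ N)) (U : X.Opens) (x : Γ(M, U)) :
    secMap (∑ k ∈ t, f k) U x = ∑ k ∈ t, secMap (f k) U x := by
  classical
  induction t using Finset.induction_on with
  | empty => simp only [Finset.sum_empty]; rfl
  | insert a t ha ih => rw [Finset.sum_insert ha, Finset.sum_insert ha, ← ih]; rfl

/-- A decomposition of `M` as a direct sum of copies of a module with a frame consisting of one
section provides a frame of `M`. -/
lemma isFrame_of_decomposition {e : Γ(L, ⊤)} (he : IsFrame fun _ : Unit => e)
    (β : ι → (L ⟶ M)) (π : ι → (M ⟶ L))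
    (h₁ : ∀ i j, β i ≫ π j = if i = j then 𝟙 L else 0) (h₂ : ∑ i, π i ≫ β i = 𝟙 M) :
    IsFrame fun i => secMap (β i) ⊤ e := by
  intro V h
  have key (c : ι → Γ(X, V)) (j : ι) :
      secMap (π j) V (∑ i, c i • secRes h (secMap (β i) ⊤ e)) = c j • secRes h e := by
    have (i : ι) : secMap (π j) V (secMap (β i) V (secRes h e)) =
        if i = j then secRes h e else 0 := by
      rw [← secMap_comp, h₁]
      split_ifs <;> rfl
    simp [← secMap_secRes, this]
  constructor
  · intro c c' hcc
    funext j
    have h3 := congrArg (secMap (π j) V) hcc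
    simp only [key] at h3
    have := (he V h).1 (a₁ := fun _ => c j) (a₂ := fun _ => c' j) (by simpa using h3)
    exact congrFun this ()
  · intro x
    have h4 (i : ι) : ∃ c : Γ(X, V), c • secRes h e = secMap (π i) V x := by
      obtain ⟨c, hc⟩ := (he V h).2 (secMap (π i) V x)
      exact ⟨c (), by simpa using hc⟩
    choose c hc using h4
    refine ⟨c, ?_⟩
    have h5 := congrArg (fun f => secMap f V x) h₂
    simp only [secMap_sum, secMap_comp, secMap_id] at h5
    rw [← h5]
    refine Finset.sum_congr rfl fun i _ => ?_
    rw [← hc i, map_smul, secMap_secRes]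

/-- A frame of `M` provides a decomposition of `M` as a direct sum of copies of the structure
sheaf. -/
lemma IsFrame.exists_decomposition {b : ι → Γ(M, ⊤)} (hb : IsFrame b) :
    ∃ (β : ι → (structureModule X ⟶ M)) (π : ι → (M ⟶ structureModule X)),
      (∀ i, secMap (β i) ⊤ (oneSection X) = b i) ∧
      (∀ i j, β i ≫ π j = if i = j then 𝟙 _ else 0) ∧ ∑ i, π i ≫ β i = 𝟙 M := by
  choose β hβ using fun i => (isFrame_oneSection X).exists_hom fun _ => b i
  choose π hπ using fun j => hb.exists_hom (N := structureModule X)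
    fun i => if i = j then oneSection X else 0
  replace hβ (i) := hβ i ()
  refine ⟨β, π, hβ, fun i j => (isFrame_oneSection X).hom_ext fun _ => ?_,
    hb.hom_ext fun i => ?_⟩
  · rw [secMap_comp, hβ, hπ]
    split_ifs <;> rfl
  · simp only [secMap_sum, secMap_comp, hπ, secMap_id]
    rw [Finset.sum_eq_single i (fun j _ hj => by simp [hj.symm]) (by simp)]
    simp [hβ]

/-- The free sheaf of modules on a type. -/
def freeModule (X : Scheme.{u}) (I : Type u) : X.Modules :=
  SheafOfModules.free (R := X.ringCatSheaf) I

/-- The inclusion of a summand in a free sheaf of modules. -/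
def freeInclusion (X : Scheme.{u}) {I : Type u} (i : I) : structureModule X ⟶ freeModule X I :=
  SheafOfModules.ιFree (R := X.ringCatSheaf) i

lemma exists_hom_freeModule {I : Type u} (f : I → (structureModule X ⟶ M)) :
    ∃ φ : freeModule X I ⟶ M, ∀ i, freeInclusion X i ≫ φ = f i :=
  ⟨Cofan.IsColimit.desc (SheafOfModules.isColimitFreeCofan (R := X.ringCatSheaf) I) f,
    fun i => Cofan.IsColimit.fac (SheafOfModules.isColimitFreeCofan (R := X.ringCatSheaf) I) _ i⟩

lemma freeModule_hom_ext {I : Type u} {φ ψ : freeModule X I ⟶ M}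
    (h : ∀ i, freeInclusion X i ≫ φ = freeInclusion X i ≫ ψ) : φ = ψ :=
  Cofan.IsColimit.hom_ext (SheafOfModules.isColimitFreeCofan (R := X.ringCatSheaf) I) _ _ h

/-- The standard frame of a free sheaf of modules. -/
lemma exists_isFrame_freeModule (X : Scheme.{u}) (I : Type u) [Fintype I] :
    ∃ b : I → Γ(freeModule X I, ⊤), IsFrame b := by
  classical
  choose π hπ using fun j : I => exists_hom_freeModule (X := X)
    (fun i : I => if i = j then 𝟙 (structureModule X) else 0)
  refine ⟨_, isFrame_of_decomposition (isFrame_oneSection X) (freeInclusion X) π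
    (fun i j => hπ j i) (freeModule_hom_ext fun i => ?_)⟩
  rw [Preadditive.comp_sum]
  simp only [← Category.assoc, hπ]
  rw [Finset.sum_eq_single i (fun j _ hj => by simp [hj.symm]) (by simp)]
  simp

variable {T : Scheme.{u}} (g : T ⟶ X)

/-- The whole space `⊤` is terminal in every comma category involved. Finality is what makes the
pull-back of the structure sheaf the structure sheaf. -/
instance (f : T ⟶ X) : (TopologicalSpace.Opens.map f.base).Final where
  out V := by
    have : IsTerminal (StructuredArrow.mk (Y := (⊤ : X.Opens)) (homOfLE le_top) :
        StructuredArrow V (TopologicalSpace.Opens.map f.base)) :=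
      IsTerminal.ofUniqueHom (fun Y => StructuredArrow.homMk (homOfLE le_top) rfl)
        (fun Y m => by ext; exact Subsingleton.elim _ _)
    exact isConnected_of_isTerminal _ this

lemma isFrame_pullback_oneSection : IsFrame fun _ : Unit =>
    pullSec g (V := ⊤) (U := ⊤) le_top (oneSection X) := by
  have : (SheafOfModules.pushforward.{u} g.toRingCatSheafHom).IsRightAdjoint :=
    inferInstanceAs (Scheme.Modules.pushforward g).IsRightAdjoint
  let φ : (Scheme.Modules.pullback g).obj (structureModule X) ⟶ structureModule T :=
    SheafOfModules.pullbackObjUnitToUnit g.toRingCatSheafHom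
  have hφ : IsIso φ :=
    SheafOfModules.instIsIsoPullbackObjUnitToUnitOfFinal g.toRingCatSheafHom
  have h1 : secMap φ ⊤ (pullSec g (V := ⊤) (U := ⊤) le_top (oneSection X)) = oneSection T := by
    have h2 := SheafOfModules.pullbackPushforwardAdjunction_homEquiv_pullbackObjUnitToUnit
      g.toRingCatSheafHom
    have h3 := (Adjunction.homEquiv_unit _ _ _ _).symm.trans h2
    have h4 : secMap φ (g ⁻¹ᵁ ⊤) (pullSection g (oneSection X)) = oneSection T :=
      (congrArg (fun f => secMap (M := structureModule X)
        (N := (Scheme.Modules.pushforward g).obj (structureModule T)) f ⊤ (oneSection X)) h3).trans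
        (map_one (g.app ⊤).hom)
    have h5 := secMap_secRes φ (le_top : ⊤ ≤ g ⁻¹ᵁ ⊤) (pullSection g (oneSection X))
    exact h5.trans ((congrArg (secRes _) h4).trans (secRes_self _ _))
  have h2 := (isFrame_oneSection T).map_iso (inv φ)
  convert h2 using 2
  rw [← h1, ← secMap_comp, IsIso.hom_inv_id, secMap_id]

/-- A frame amounts to inclusions and projections satisfying the identities of a direct sum. An
additive functor preserves them, which leaves only the pull-back of the structure sheaf. -/
lemma IsFrame.pullback_top {b : ι → Γ(M, ⊤)} (hb : IsFrame b) :
    IsFrame fun i => pullSec g (V := ⊤) le_top (b i) := by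
  obtain ⟨β, π, h₁, h₂, h₃⟩ := hb.exists_decomposition
  have := isFrame_of_decomposition (isFrame_pullback_oneSection g)
    (fun i => (Scheme.Modules.pullback g).map (β i))
    (fun i => (Scheme.Modules.pullback g).map (π i)) (fun i j => ?_) ?_
  · convert this using 2 with i
    rw [← h₁ i]
    exact (secMap_pullback_map g (β i) le_top (oneSection X)).symm
  · rw [← Functor.map_comp, h₂]
    split_ifs
    · simp
    · exact Functor.map_zero _ _ _
  · simp only [← Functor.map_comp]
    rw [← Functor.map_sum, h₃, CategoryTheory.Functor.map_id]

/-- The isomorphism between the restriction of `M` to an open subset and its pull-back. -/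
lemma secMap_restrictFunctorIsoPullback (U : X.Opens) {W : X.Opens} {V : U.toScheme.Opens}
    (h : V ≤ U.ι ⁻¹ᵁ W) (x : Γ(M, W)) (h' : U.ι ''ᵁ V ≤ W) :
    secMap ((Scheme.Modules.restrictFunctorIsoPullback U.ι).hom.app M) V
      (secRes h' x : Γ(M, U.ι ''ᵁ V)) = pullSec U.ι h x := by
  have h1 := Adjunction.unit_leftAdjointUniq_hom_app (Scheme.Modules.restrictAdjunction U.ι)
    (Scheme.Modules.pullbackPushforwardAdjunction U.ι) M
  have h2 := congrArg (fun f => secMap f W x) h1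
  have h3 : pullSec U.ι h x = secRes h (pullSection U.ι x) := rfl
  rw [h3]
  refine Eq.trans ?_ (congrArg (secRes h) h2)
  refine Eq.trans ?_ (secMap_secRes
    ((Scheme.Modules.restrictFunctorIsoPullback U.ι).hom.app M) h _)
  exact congrArg (secMap ((Scheme.Modules.restrictFunctorIsoPullback U.ι).hom.app M) V)
    (secRes_secRes (U.ι.image_preimage_le W) (U.ι.image_mono h) x).symm

end FrameConstructions

end

section

/-! ### Frames over open subsets, their pull-backs, and vector bundles -/

section FramePullback

variable {X : Scheme.{u}} {M N : X.Modules} {ι : Type*} [Fintype ι]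

/-- A section over `U`, as a global section of the restriction to `U`. -/
def restrictSection (U : X.Opens) (x : Γ(M, U)) : Γ(M.restrict U.ι, ⊤) :=
  (secRes (U.ι_image_top.le) x : Γ(M, U.ι ''ᵁ ⊤))

/-- A function on an open subset `V` of the open subscheme `U`, as a function on the image of `V`. -/
def functionOfOpen {U : X.Opens} {V : U.toScheme.Opens} (a : Γ(U, V)) : Γ(X, U.ι ''ᵁ V) := a

lemma sum_smul_restrictSection {U : X.Opens} (b : ι → Γ(M, U)) (V : U.toScheme.Opens)
    (c : ι → Γ(U, V)) :
    (∑ i, c i • secRes le_top (restrictSection U (b i)) : Γ(M.restrict U.ι, V)) =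
      (∑ i, functionOfOpen (c i) • secRes ((U.ι.image_mono le_top).trans U.ι_image_top.le) (b i) :
        Γ(M, U.ι ''ᵁ V)) := by
  have h (i : ι) : (secRes le_top (restrictSection U (b i)) : Γ(M.restrict U.ι, V)) =
      secRes ((U.ι.image_mono le_top).trans U.ι_image_top.le) (b i) :=
    secRes_secRes U.ι_image_top.le (U.ι.image_mono (le_top : V ≤ ⊤)) (b i)
  refine Finset.sum_congr rfl fun i _ => ?_
  rw [h]
  refine congrArg (fun a : Γ(X, U.ι ''ᵁ V) => a • (secRes
    ((U.ι.image_mono le_top).trans U.ι_image_top.le) (b i) : Γ(M, U.ι ''ᵁ V))) ?_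
  have h2 : (U.ι.appIso V).inv.hom (c i) = functionOfOpen (c i) := by
    rw [U.ι_appIso]
    rfl
  exact h2

lemma isFrame_restrictSection_iff {U : X.Opens} (b : ι → Γ(M, U)) :
    IsFrame (fun i => restrictSection U (b i)) ↔ IsFrame b := by
  constructor
  · intro hb W hW
    obtain ⟨V, rfl⟩ : ∃ V : U.toScheme.Opens, W = U.ι ''ᵁ V :=
      ⟨U.ι ⁻¹ᵁ W, by simp [Scheme.Hom.image_preimage_eq_opensRange_inf, hW]⟩
    have h := hb V le_top
    simp only [sum_smul_restrictSection] at h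
    exact h
  · intro hb V hV
    simp only [sum_smul_restrictSection]
    exact hb (U.ι ''ᵁ V) ((U.ι.image_mono le_top).trans U.ι_image_top.le)

lemma isFrame_iff_of_isIso {U : X.Opens} (b : ι → Γ(M, U)) (φ : M ⟶ N) [IsIso φ] :
    IsFrame (fun i => secMap φ U (b i)) ↔ IsFrame b := by
  refine ⟨fun h => ?_, fun h => h.map_iso φ⟩
  have := h.map_iso (inv φ)
  simpa only [← secMap_comp, IsIso.hom_inv_id, secMap_id] using this

lemma isFrame_pullSec_ι_iff {U : X.Opens} (b : ι → Γ(M, U)) (h : ⊤ ≤ U.ι ⁻¹ᵁ U) :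
    IsFrame (fun i => pullSec U.ι h (b i)) ↔ IsFrame b := by
  rw [← isFrame_restrictSection_iff b,
    ← isFrame_iff_of_isIso _ ((Scheme.Modules.restrictFunctorIsoPullback U.ι).hom.app M)]
  refine iff_of_eq (congrArg _ (funext fun i => ?_))
  exact (secMap_restrictFunctorIsoPullback U h (b i) _).symm

variable {T : Scheme.{u}} (g : T ⟶ X)

lemma isFrame_pullSec_comp_iff {Y : Scheme.{u}} (h : Y ⟶ T) {U : X.Opens} {V : T.Opens}
    {W : Y.Opens} (hV : V ≤ g ⁻¹ᵁ U) (hW : W ≤ h ⁻¹ᵁ V) (b : ι → Γ(M, U)) :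
    IsFrame (fun i => pullSec (h ≫ g) (hW.trans (h.preimage_mono hV)) (b i)) ↔
      IsFrame fun i => pullSec h hW (pullSec g hV (b i)) := by
  rw [← isFrame_iff_of_isIso _ ((Scheme.Modules.pullbackComp h g).hom.app M)]
  refine iff_of_eq (congrArg _ (funext fun i => ?_))
  exact (secMap_pullbackComp g h hV hW (b i)).symm

lemma isFrame_pullSec_congr {g g' : T ⟶ X} (e : g = g') {U : X.Opens} {V : T.Opens}
    (hV : V ≤ g ⁻¹ᵁ U) (b : ι → Γ(M, U)) :
    IsFrame (fun i => pullSec g hV (b i)) ↔ IsFrame fun i => pullSec g' (e ▸ hV) (b i) := by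
  subst e
  rfl

/-- Restricting to `U` and to its preimage turns a frame over `U` into a global one, to be pulled
back along `g ∣_ U`; the two composites to `X` agree by `morphismRestrict_ι`. -/
lemma IsFrame.pullSec [DecidableEq ι] {U : X.Opens} {V : T.Opens} (h : V ≤ g ⁻¹ᵁ U)
    {b : ι → Γ(M, U)} (hb : IsFrame b) : IsFrame fun i => pullSec g h (b i) := by
  have hU : ⊤ ≤ U.ι ⁻¹ᵁ U := by simp
  have hU' : ⊤ ≤ (g ⁻¹ᵁ U).ι ⁻¹ᵁ (g ⁻¹ᵁ U) := by simp
  have h1 := ((isFrame_pullSec_ι_iff b hU).mpr hb).pullback_top (g ∣_ U)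
  have h2 := (isFrame_pullSec_comp_iff U.ι (g ∣_ U) hU (W := ⊤) le_top b).mpr h1
  rw [isFrame_pullSec_congr (morphismRestrict_ι g U),
    isFrame_pullSec_comp_iff g (g ⁻¹ᵁ U).ι le_rfl hU', isFrame_pullSec_ι_iff] at h2
  simpa only [secRes_pullSec] using h2.secRes h

lemma IsVectorBundle.exists_isFrame {n : ℕ} (hM : IsVectorBundle M n) (x : X) :
    ∃ (U : X.Opens) (b : Fin n → Γ(M, U)), x ∈ U ∧ IsFrame b := by
  obtain ⟨U, hx, ⟨e⟩⟩ := hM x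
  obtain ⟨b, hb⟩ := exists_isFrame_freeModule U.toScheme (ULift.{u} (Fin n))
  let e' : M.restrict U.ι ≅ freeModule U.toScheme (ULift.{u} (Fin n)) := e
  have h1 := (hb.map_iso e'.inv).reindex Equiv.ulift.symm
  let b' : Fin n → Γ(M, U) := fun i =>
    secRes (U.ι_image_top.ge) ((secMap e'.inv ⊤ (b (Equiv.ulift.symm i)) :
      Γ(M, U.ι ''ᵁ ⊤)))
  refine ⟨U, b', hx, ?_⟩
  rw [← isFrame_restrictSection_iff b']
  convert h1 using 2 with i
  exact (secRes_secRes U.ι_image_top.ge U.ι_image_top.le _).trans (secRes_self _ _)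

lemma IsVectorBundle.of_isFrame {n : ℕ} {b : Fin n → Γ(M, ⊤)} (hb : IsFrame b) :
    IsVectorBundle M n := by
  intro x
  refine ⟨⊤, trivial, ?_⟩
  obtain ⟨b', hb'⟩ := exists_isFrame_freeModule (⊤ : X.Opens).toScheme (ULift.{u} (Fin n))
  have h1 := ((isFrame_restrictSection_iff b).mpr hb).reindex Equiv.ulift.{u}
  obtain ⟨φ, hφ⟩ := h1.exists_hom b'
  have := isIso_of_isFrame h1 hb' φ hφ
  exact ⟨(asIso φ : M.restrict _ ≅ freeModule _ _)⟩

end FramePullback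

end

section

/-! ### Subobjects and cokernels in the presence of adapted frames -/

section Subobjects

variable {X : Scheme.{u}} {M N F : X.Modules} {ι κ : Type*} [Fintype ι] [Fintype κ]

/-- Projection to the coordinates in `κ` descends to the cokernel; its inverse sends the standard
frame of a free module to the classes of the remaining frame sections. -/
lemma isFrame_cokernel {f : F ⟶ M} {b : ι ⊕ κ → Γ(M, ⊤)} (hb : IsFrame b)
    {a : ι → Γ(F, ⊤)} (ha : IsFrame a) (hf : ∀ i, secMap f ⊤ (a i) = b (Sum.inl i)) :
    IsFrame fun k => secMap (cokernel.π f) ⊤ (b (Sum.inr k)) := by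
  obtain ⟨e, he⟩ := exists_isFrame_freeModule X (ULift.{u} (Fin (Fintype.card κ)))
  replace he := he.reindex ((Fintype.equivFin κ).trans Equiv.ulift.symm)
  generalize freeModule X (ULift.{u} (Fin (Fintype.card κ))) = L at e he
  obtain ⟨p, hp⟩ := hb.exists_hom
    (Sum.elim (fun _ => 0) fun k => e (((Fintype.equivFin κ).trans Equiv.ulift.symm) k))
  obtain ⟨q, hq⟩ := he.exists_hom fun k => secMap (cokernel.π f) ⊤ (b (Sum.inr k))
  have hfp : f ≫ p = 0 := ha.hom_ext fun i => by
    rw [secMap_comp, hf, hp]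
    rfl
  let d : cokernel f ⟶ L := cokernel.desc f p hfp
  have hd : cokernel.π f ≫ d = p := cokernel.π_desc f p hfp
  have h1 : q ≫ d = 𝟙 L := he.hom_ext fun k => by
    rw [secMap_comp, hq, ← secMap_comp, hd, hp]
    rfl
  have h2 : d ≫ q = 𝟙 _ := by
    rw [← cancel_epi (cokernel.π f), reassoc_of% hd, Category.comp_id]
    refine hb.hom_ext fun j => ?_
    rcases j with i | k
    · rw [secMap_comp, hp, ← hf, ← secMap_comp, cokernel.condition]
      exact map_zero _
    · rw [secMap_comp, hp]
      exact hq k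
  have : IsIso q := ⟨d, h1, h2⟩
  simpa only [hq] using he.map_iso q

/-- Projection to the coordinates in `ι` is a retraction of `f`. -/
lemma mono_of_isFrame {f : F ⟶ M} {b : ι ⊕ κ → Γ(M, ⊤)} (hb : IsFrame b)
    {a : ι → Γ(F, ⊤)} (ha : IsFrame a) (hf : ∀ i, secMap f ⊤ (a i) = b (Sum.inl i)) :
    Mono f := by
  obtain ⟨p, hp⟩ := hb.exists_hom (Sum.elim a fun _ => 0)
  have : f ≫ p = 𝟙 F := ha.hom_ext fun i => by
    rw [secMap_comp, hf, hp]
    rfl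
  have : IsSplitMono f := ⟨⟨p, this⟩⟩
  infer_instance

/-- The subobject generated by a part of a frame. -/
lemma exists_subobject_of_isFrame {r : ℕ} {b : Fin r ⊕ κ → Γ(M, ⊤)} (hb : IsFrame b) :
    ∃ (P : Subobject M) (a : Fin r → Γ((P : X.Modules), ⊤)),
      IsFrame a ∧ ∀ i, secMap P.arrow ⊤ (a i) = b (Sum.inl i) := by
  obtain ⟨e, he⟩ := exists_isFrame_freeModule X (ULift.{u} (Fin r))
  replace he := he.reindex Equiv.ulift.{u}.symm
  obtain ⟨f, hf⟩ := he.exists_hom fun i => b (Sum.inl i)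
  have := mono_of_isFrame hb he hf
  refine ⟨Subobject.mk f, fun i => secMap (Subobject.underlyingIso f).inv ⊤ (e _),
    he.map_iso _, fun i => ?_⟩
  rw [← secMap_comp, Subobject.underlyingIso_arrow, hf]

lemma subobject_factors_of_isFrame {P : Subobject N} {r : ℕ} {a : ι → Γ(F, ⊤)} (ha : IsFrame a)
    {a' : Fin r → Γ((P : X.Modules), ⊤)} {f : F ⟶ N} (C : ι → Fin r → Γ(X, ⊤))
    (h : ∀ i, secMap f ⊤ (a i) = ∑ j, C i j • secMap P.arrow ⊤ (a' j)) : P.Factors f := by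
  obtain ⟨q, hq⟩ := ha.exists_hom fun i => ∑ j, C i j • a' j
  have : f = q ≫ P.arrow := ha.hom_ext fun i => by
    rw [secMap_comp, hq, h]
    simp
  rw [this]
  exact Subobject.factors_comp_arrow q

end Subobjects

/-! ### Right exactness in terms of matrices -/

section CokernelRank

variable {X : Scheme.{u}} {M F Q : X.Modules} {ι κ ν : Type*} [Fintype ι] [Fintype κ] [Fintype ν]

/-- If `F ⟶ M ⟶ Q ⟶ 0` is exact and the three sheaves have frames, then the vectors
annihilated by the matrix of `F ⟶ M` are combinations of the columns of the matrix of
`M ⟶ Q`. -/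
lemma exists_matrix_of_isFrame_quotient {f : F ⟶ M} {π : M ⟶ Q}
    (hπ : ∀ φ : M ⟶ structureModule X, f ≫ φ = 0 → ∃ ψ, π ≫ ψ = φ)
    {b : κ → Γ(M, ⊤)} (hb : IsFrame b) {a : ι → Γ(F, ⊤)} (ha : IsFrame a)
    (D : Matrix ι κ Γ(X, ⊤)) (hf : ∀ i, secMap f ⊤ (a i) = ∑ k, D i k • b k)
    {q : ν → Γ(Q, ⊤)} (hq : IsFrame q) :
    ∃ P : Matrix κ ν Γ(X, ⊤), ∀ l, D.mulVec l = 0 → ∃ c, P.mulVec c = l := by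
  refine ⟨fun k => hq.coord le_rfl (secMap π ⊤ (b k)), fun l hl => ?_⟩
  -- A vector `l` is a functional on `M`; being annihilated by `D` means vanishing on `F`, so the
  -- functional comes from `Q`.
  obtain ⟨φ, hφ⟩ := hb.exists_hom (N := structureModule X) l
  obtain ⟨ψ, hψ⟩ := hπ φ <| ha.hom_ext fun i => by
    rw [secMap_comp, hf, map_sum]
    simp only [map_smul, hφ]
    exact congrFun hl i
  refine ⟨fun n => secMap ψ ⊤ (q n), funext fun k => ?_⟩
  rw [← hφ k, ← hψ, secMap_comp]
  conv_rhs => rw [← hq.sum_coord le_rfl (secMap π ⊤ (b k))]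
  simp only [secRes_self, map_sum, map_smul]
  rfl

/-- Pull-back is a left adjoint, hence right exact. Only the existence of factorizations is needed
for the rank count in fibres. -/
lemma exists_desc_pullback {T : Scheme.{u}} (g : T ⟶ X) (f : F ⟶ M) {Z : T.Modules}
    (φ : (Scheme.Modules.pullback g).obj M ⟶ Z)
    (h : (Scheme.Modules.pullback g).map f ≫ φ = 0) :
    ∃ ψ, (Scheme.Modules.pullback g).map (cokernel.π f) ≫ ψ = φ := by
  let adj := Scheme.Modules.pullbackPushforwardAdjunction g
  have h1 : f ≫ adj.homEquiv _ _ φ = 0 := by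
    rw [← adj.homEquiv_naturality_left, h, adj.homEquiv_unit, Functor.map_zero, comp_zero]
  refine ⟨(adj.homEquiv _ _).symm (cokernel.desc f _ h1), ?_⟩
  rw [← adj.homEquiv_naturality_left_symm, cokernel.π_desc, Equiv.symm_apply_apply]

end CokernelRank

section Restriction

variable {X T : Scheme.{u}} (g : T ⟶ X)

lemma appLE_funRes {U U' : X.Opens} {V : T.Opens} (h' : U' ≤ U) (h : V ≤ g ⁻¹ᵁ U') (a : Γ(X, U)) :
    (g.appLE U' V h).hom (funRes h' a) = (g.appLE U V (h.trans (g.preimage_mono h'))).hom a :=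
  ConcreteCategory.congr_hom (g.map_appLE h (homOfLE h').op) a

lemma funRes_appLE {U : X.Opens} {V V' : T.Opens} (h : V ≤ g ⁻¹ᵁ U) (h' : V' ≤ V) (a : Γ(X, U)) :
    funRes h' ((g.appLE U V h).hom a) = (g.appLE U V' (h'.trans h)).hom a :=
  ConcreteCategory.congr_hom (g.appLE_map h (homOfLE h').op) a

lemma app_eq_appLE' {U : X.Opens} (a : Γ(X, U)) :
    (g.app U).hom a = (g.appLE U (g ⁻¹ᵁ U) le_rfl).hom a := by
  rw [Scheme.Hom.appLE_eq_app]

end Restriction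

/-! ### Pairings and their pull-backs in terms of frames -/

section Pairings

variable {X T : Scheme.{u}} {M N : X.Modules} {ι κ : Type*} [Fintype ι] [Fintype κ]

lemma Pairing.secRes_toFun (B : Pairing M N) {U V : X.Opens} (h : V ≤ U) (x : Γ(M, U))
    (y : Γ(N, U)) : B.toFun V (secRes h x) (secRes h y) = funRes h (B.toFun U x y) :=
  B.map_res h x y

/-- There is a pairing with prescribed values on frames. -/
lemma exists_pairing {b : ι → Γ(M, ⊤)} (hb : IsFrame b) {c : κ → Γ(N, ⊤)} (hc : IsFrame c)
    (G : Matrix ι κ Γ(X, ⊤)) : ∃ B : Pairing M N, ∀ i j, B.toFun ⊤ (b i) (c j) = G i j := by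
  classical
  refine ⟨{ toFun := fun U => (Matrix.toLinearMap₂' Γ(X, U) (G.map (funRes le_top))).compl₁₂
              (hb.coord le_top).toLinearMap (hc.coord le_top).toLinearMap
            map_res := fun {U V} h x y => ?_ }, fun i j => ?_⟩
  · change Matrix.toLinearMap₂' Γ(X, V) (G.map (funRes le_top))
      (hb.coord le_top (secRes h x)) (hc.coord le_top (secRes h y)) =
        funRes h (Matrix.toLinearMap₂' Γ(X, U) (G.map (funRes le_top))
      (hb.coord le_top x) (hc.coord le_top y))
    rw [hb.coord_secRes le_top h, hc.coord_secRes le_top h]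
    simp [Matrix.toLinearMap₂'_apply]
  · change Matrix.toLinearMap₂' Γ(X, ⊤) (G.map (funRes le_top))
      (hb.coord le_top (b i)) (hc.coord le_top (c j)) = _
    have h1 := hb.coord_self le_rfl i
    have h2 := hc.coord_self le_rfl j
    rw [secRes_self] at h1 h2
    rw [h1, h2]
    simp [Matrix.toLinearMap₂'_apply, Pi.single_apply]

/-- The value of a pairing in terms of its matrix. -/
lemma Pairing.toFun_sum (B : Pairing M N) {U : X.Opens} (b : ι → Γ(M, U)) (c : κ → Γ(N, U))
    (x : ι → Γ(X, U)) (y : κ → Γ(X, U)) :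
    B.toFun U (∑ i, x i • b i) (∑ j, y j • c j) =
      ∑ i, ∑ j, x i * y j * B.toFun U (b i) (c j) := by
  simp only [map_sum, LinearMap.sum_apply, map_smul, LinearMap.smul_apply, smul_eq_mul,
    Finset.mul_sum]
  rw [Finset.sum_comm]
  simp only [mul_assoc, mul_left_comm]

variable (g : T ⟶ X)

lemma Pairing.IsPullback.toFun_pullSec {B : Pairing M N}
    {C : Pairing ((Scheme.Modules.pullback g).obj M) ((Scheme.Modules.pullback g).obj N)}
    (h : B.IsPullback g C) {U : X.Opens} {V : T.Opens} (hV : V ≤ g ⁻¹ᵁ U) (x : Γ(M, U))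
    (y : Γ(N, U)) :
    C.toFun V (pullSec g hV x) (pullSec g hV y) = (g.appLE U V hV).hom (B.toFun U x y) := by
  rw [pullSec, pullSec, C.secRes_toFun, h]
  rfl

/-- The pull-back of a pairing exists if both sheaves have frames over an open subset whose
preimage is everything. -/
lemma Pairing.exists_isPullback [DecidableEq ι] [DecidableEq κ] (B : Pairing M N) {U : X.Opens}
    (hU : ⊤ ≤ g ⁻¹ᵁ U) {b : ι → Γ(M, U)} (hb : IsFrame b) {c : κ → Γ(N, U)} (hc : IsFrame c) :
    ∃ C, B.IsPullback g C := by
  obtain ⟨C, hC⟩ := exists_pairing (hb.pullSec g hU) (hc.pullSec g hU)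
    (Matrix.of fun i j => (g.appLE U ⊤ hU).hom (B.toFun U (b i) (c j)))
  refine ⟨C, fun W x y => ?_⟩
  -- The preimage of `U` is everything, so nothing is lost by replacing `W` with `W ⊓ U`, where the
  -- frames are available.
  have hV : g ⁻¹ᵁ W ≤ g ⁻¹ᵁ (W ⊓ U) := fun t ht => ⟨ht, hU trivial⟩
  have hx := hb.sum_coord inf_le_right (secRes (inf_le_left : W ⊓ U ≤ W) x)
  have hy := hc.sum_coord inf_le_right (secRes (inf_le_left : W ⊓ U ≤ W) y)
  have e1 : pullSection g x = pullSec g hV (secRes inf_le_left x) := by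
    rw [pullSec_secRes, pullSection_eq]
  have e2 : pullSection g y = pullSec g hV (secRes inf_le_left y) := by
    rw [pullSec_secRes, pullSection_eq]
  have e3 : (g.app W).hom (B.toFun W x y) = (g.appLE (W ⊓ U) _ hV).hom
      (B.toFun _ (secRes inf_le_left x) (secRes inf_le_left y)) := by
    rw [B.secRes_toFun, appLE_funRes, app_eq_appLE']
  rw [e1, e2, e3, ← hx, ← hy]
  simp only [pullSec_sum, pullSec_smul]
  rw [C.toFun_sum, B.toFun_sum]
  simp only [map_sum, map_mul]
  refine Finset.sum_congr rfl fun i _ => Finset.sum_congr rfl fun j _ => ?_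
  congr 1
  have h3 := C.secRes_toFun (le_top : g ⁻¹ᵁ W ≤ ⊤) (pullSec g hU (b i)) (pullSec g hU (c j))
  simp only [secRes_pullSec, hC, Matrix.of_apply] at h3
  rw [pullSec_secRes, pullSec_secRes, h3, B.secRes_toFun,
    funRes_appLE, appLE_funRes]

end Pairings

end

section

/-! ### Finiteness of `V(G)` -/

section Finiteness

/-- With `ρ` as root and `p` the parent of `x`: if `y` were no farther than `x`, shortest walks from
`ρ` to `y` and to `p` would both avoid `x`, so that `p` and `x` would stay connected without their
edge, which is a bridge. -/
lemma dist_lt_of_reachable_deleteEdges {V : Type v} {Γ : SimpleGraph V} (hΓ : Γ.IsTree)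
    {ρ x p y : V} (hpx : Γ.Adj p x) (hp : Γ.dist ρ p < Γ.dist ρ x)
    (hy : (Γ.deleteEdges {s(p, x)}).Reachable x y) (hyx : y ≠ x) :
    Γ.dist ρ x < Γ.dist ρ y := by
  classical
  have key (z : V) (q : Γ.Walk ρ z) (hq : x ∉ q.support) :
      (Γ.deleteEdges {s(p, x)}).Reachable ρ z := by
    refine ⟨q.toDeleteEdges _ fun e he he' => ?_⟩
    rw [Set.mem_singleton_iff] at he'
    subst he'
    exact hq (q.snd_mem_support_of_mem_edges he)
  have hlen (z : V) (q : Γ.Walk ρ z) (hq : q.length = Γ.dist ρ z) (hx : x ∈ q.support) :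
      Γ.dist ρ x + Γ.dist x z ≤ Γ.dist ρ z := by
    rw [← hq, ← q.take_spec hx, SimpleGraph.Walk.length_append]
    exact add_le_add (SimpleGraph.dist_le _) (SimpleGraph.dist_le _)
  by_contra hlt
  obtain ⟨q, hq⟩ := (hΓ.connected.preconnected ρ y).exists_walk_length_eq_dist
  obtain ⟨q', hq'⟩ := (hΓ.connected.preconnected ρ p).exists_walk_length_eq_dist
  have h1 : x ∉ q.support := fun hx => by
    have := hlen y q hq hx
    have : 0 < Γ.dist x y := (hΓ.connected.preconnected x y).pos_dist_of_ne hyx.symm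
    omega
  have h2 : x ∉ q'.support := fun hx => by
    have := hlen p q' hq' hx
    omega
  have h3 : (Γ.deleteEdges {s(p, x)}).Reachable p x :=
    (key p q' h2).symm.trans ((key y q h1).trans hy.symm)
  exact SimpleGraph.isAcyclic_iff_forall_adj_isBridge.mp hΓ.isAcyclic hpx h3

variable {V : Type v} [Fintype V]

-- In the support of `f` take a vertex `x` as far as possible from a root. The branch cut off by the
-- edge from `x` to its parent meets the support only in `x`, so its sum is `f x`; if `x` is the
-- root, the total sum plays this role.
open Classical in
lemma eq_zero_of_sum_component_eq_zero {Γ : SimpleGraph V} (hΓ : Γ.IsTree) (f : V → ℤ)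
    (hf : ∑ x, f x = 0)
    (hc : ∀ e ∈ Γ.edgeSet, ∀ c : (Γ.deleteEdges {e}).ConnectedComponent,
      ∑ x ∈ c.supp.toFinset, f x = 0) : f = 0 := by
  by_contra hne
  obtain ⟨ρ⟩ := hΓ.connected.nonempty
  have hs : (Finset.univ.filter fun x => f x ≠ 0).Nonempty := by
    obtain ⟨x, hx⟩ := Function.ne_iff.mp hne
    exact ⟨x, by simpa using hx⟩
  obtain ⟨x, hx, hmax⟩ := Finset.exists_max_image _ (fun x => Γ.dist ρ x) hs
  have hx0 : f x ≠ 0 := by simpa using hx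
  have hmax' (y : V) (hy : Γ.dist ρ x < Γ.dist ρ y) : f y = 0 := by
    by_contra h
    have := hmax y (by simpa using h)
    omega
  by_cases hxρ : x = ρ
  · subst hxρ
    refine hx0 ?_
    rw [← hf]
    refine (Finset.sum_eq_single x (fun y _ hy => hmax' y ?_) (by simp)).symm
    rw [SimpleGraph.dist_self]
    exact (hΓ.connected.preconnected x y).pos_dist_of_ne hy.symm
  · obtain ⟨q, hq⟩ := (hΓ.connected.preconnected x ρ).exists_walk_length_eq_dist
    cases q with
    | nil => exact hxρ rfl
    | @cons _ p _ h q' =>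
      have hp : Γ.dist ρ p < Γ.dist ρ x := by
        rw [SimpleGraph.dist_comm, SimpleGraph.dist_comm (u := ρ), ← hq,
          SimpleGraph.Walk.length_cons]
        exact Nat.lt_succ_of_le (SimpleGraph.dist_le _)
      have := hc s(p, x) h.symm ((Γ.deleteEdges {s(p, x)}).connectedComponentMk x)
      rw [Finset.sum_eq_single x] at this
      · exact hx0 this
      · intro y hy hyx
        refine hmax' y (dist_lt_of_reachable_deleteEdges hΓ h.symm hp ?_ hyx)
        rw [Set.mem_toFinset, SimpleGraph.ConnectedComponent.mem_supp_iff] at hy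
        exact (SimpleGraph.ConnectedComponent.exact hy).symm
      · intro h
        exact absurd (by simp) h

-- The sums of `w` over the components are bounded below by the definition of `V(G)`, hence also
-- above, since for a given edge they add up to `d`; and they determine `w`. Finiteness is what
-- allows products of minors and intersections of neighbourhoods over all vertices.
open Classical in
instance (A : TreeData V) : Finite A.Vert := by
  let I := Σ e : A.Γ.edgeSet, (A.Γ.deleteEdges {e.1}).ConnectedComponent
  let lo (i : I) : ℤ := ∑ x ∈ i.2.supp.toFinset, A.dv x - (i.2.supp.toFinset.card : ℤ) * (2 * A.b)
  let val (w : A.Vert) (i : I) : ℤ := ∑ x ∈ i.2.supp.toFinset, w.1 x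
  have hlo (w : A.Vert) (i : I) : lo i ≤ val w i := by
    have := w.2.2.2 i.1.1 i.1.2 i.2
    rw [Finset.sum_sub_distrib] at this
    simp only [lo, val]
    linarith
  have hsum (w : A.Vert) (e : A.Γ.edgeSet) : ∑ c, val w ⟨e, c⟩ = A.d := by
    rw [← w.2.1, ← Finset.sum_fiberwise Finset.univ
      (fun x => (A.Γ.deleteEdges {e.1}).connectedComponentMk x)]
    refine Finset.sum_congr rfl fun c _ => Finset.sum_congr ?_ fun _ _ => rfl
    ext x
    simp
  let hi (i : I) : ℤ := A.d - ∑ c ∈ Finset.univ.erase i.2, lo ⟨i.1, c⟩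
  have hhi (w : A.Vert) (i : I) : val w i ≤ hi i := by
    have h1 := hsum w i.1
    rw [← Finset.add_sum_erase _ _ (Finset.mem_univ i.2)] at h1
    have h2 : ∑ c ∈ Finset.univ.erase i.2, lo ⟨i.1, c⟩ ≤
        ∑ c ∈ Finset.univ.erase i.2, val w ⟨i.1, c⟩ :=
      Finset.sum_le_sum fun c _ => hlo w ⟨i.1, c⟩
    change val w ⟨i.1, i.2⟩ ≤ A.d - _
    linarith
  let F (w : A.Vert) (i : I) : Set.Icc (lo i) (hi i) := ⟨val w i, hlo w i, hhi w i⟩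
  refine Finite.of_injective F fun w w' h => Subtype.ext ?_
  rw [← sub_eq_zero]
  refine eq_zero_of_sum_component_eq_zero A.isTree _ ?_ fun e he c => ?_
  · simp only [Pi.sub_apply, Finset.sum_sub_distrib, w.2.1, w'.2.1, sub_self]
  · have := congrArg Subtype.val (congrFun h ⟨⟨e, he⟩, c⟩)
    simp only [Pi.sub_apply, Finset.sum_sub_distrib]
    exact sub_eq_zero.mpr this

end Finiteness

end

section

/-! ### Transitivity of the pull-back of linked subbundles -/

section Transitivity

variable {Y T X S : Scheme.{u}} (k : Y ⟶ T) (h : T ⟶ X) (p : X ⟶ S)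

lemma pullback_pullback_hom_ext {M : X.Modules} {K : Y.Modules}
    {φ ψ : (Scheme.Modules.pullback k).obj ((Scheme.Modules.pullback h).obj M) ⟶ K}
    (H : ∀ (U : X.Opens) (x : Γ(M, U)),
      secMap φ (k ⁻¹ᵁ h ⁻¹ᵁ U) (pullSec k le_rfl (pullSec h le_rfl x)) =
        secMap ψ (k ⁻¹ᵁ h ⁻¹ᵁ U) (pullSec k le_rfl (pullSec h le_rfl x))) :
    φ = ψ := by
  let adj := Scheme.Modules.pullbackPushforwardAdjunction k
  apply (adj.homEquiv _ _).injective
  refine pullback_hom_ext h fun U x => ?_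
  have h1 (φ : (Scheme.Modules.pullback k).obj ((Scheme.Modules.pullback h).obj M) ⟶ K) :
      secMap (adj.homEquiv _ _ φ) (h ⁻¹ᵁ U) (pullSec h le_rfl x) =
        secMap φ (k ⁻¹ᵁ h ⁻¹ᵁ U) (pullSec k le_rfl (pullSec h le_rfl x)) := by
    rw [← pullSection_eq k, adj.homEquiv_unit]
    rfl
  rw [h1, h1]
  exact H U x

lemma pullback_pullback_pullback_hom_ext {M : S.Modules} {K : Y.Modules}
    {φ ψ : (Scheme.Modules.pullback k).obj ((Scheme.Modules.pullback h).obj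
      ((Scheme.Modules.pullback p).obj M)) ⟶ K}
    (H : ∀ (U : S.Opens) (x : Γ(M, U)),
      secMap φ (k ⁻¹ᵁ h ⁻¹ᵁ p ⁻¹ᵁ U) (pullSec k le_rfl (pullSec h le_rfl (pullSec p le_rfl x))) =
        secMap ψ (k ⁻¹ᵁ h ⁻¹ᵁ p ⁻¹ᵁ U)
          (pullSec k le_rfl (pullSec h le_rfl (pullSec p le_rfl x)))) :
    φ = ψ := by
  let adj := Scheme.Modules.pullbackPushforwardAdjunction k
  apply (adj.homEquiv _ _).injective
  refine pullback_pullback_hom_ext h p fun U x => ?_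
  have h1 (φ : (Scheme.Modules.pullback k).obj ((Scheme.Modules.pullback h).obj
      ((Scheme.Modules.pullback p).obj M)) ⟶ K) :
      secMap (adj.homEquiv _ _ φ) (h ⁻¹ᵁ p ⁻¹ᵁ U) (pullSec h le_rfl (pullSec p le_rfl x)) =
        secMap φ (k ⁻¹ᵁ h ⁻¹ᵁ p ⁻¹ᵁ U)
          (pullSec k le_rfl (pullSec h le_rfl (pullSec p le_rfl x))) := by
    rw [← pullSection_eq k, adj.homEquiv_unit]
    rfl
  rw [h1, h1]
  exact H U x

/-- The isomorphism between iterated pull-backs along `h ≫ p = g`. -/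
def pullbackCompCongr {g : T ⟶ S} (hg : h ≫ p = g) (M : S.Modules) :
    (Scheme.Modules.pullback h).obj ((Scheme.Modules.pullback p).obj M) ⟶
      (Scheme.Modules.pullback g).obj M :=
  (Scheme.Modules.pullbackComp h p).hom.app M ≫ (Scheme.Modules.pullbackCongr hg).hom.app M

lemma secMap_pullbackCompCongr {g : T ⟶ S} (hg : h ≫ p = g) {M : S.Modules} {U : S.Opens}
    {V : X.Opens} {W : T.Opens} (hV : V ≤ p ⁻¹ᵁ U) (hW : W ≤ h ⁻¹ᵁ V) (hW' : W ≤ g ⁻¹ᵁ U)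
    (x : Γ(M, U)) :
    secMap (pullbackCompCongr h p hg M) W (pullSec h hW (pullSec p hV x)) = pullSec g hW' x := by
  subst hg
  exact (congrArg (secMap _ W) (secMap_pullbackComp p h hV hW x)).trans
    (secMap_pullbackCongr rfl _ x)

/-- Both sides send a section pulled back three times to its pull-back along the composite, and such
sections detect equality. -/
lemma pullbackCompCongr_assoc {g : T ⟶ S} {g' : Y ⟶ S} (hg : h ≫ p = g) (hg' : k ≫ g = g')
    (hh : (k ≫ h) ≫ p = g') (M : S.Modules) :
    (Scheme.Modules.pullback k).map (pullbackCompCongr h p hg M) ≫ pullbackCompCongr k g hg' M =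
    (Scheme.Modules.pullbackComp k h).hom.app ((Scheme.Modules.pullback p).obj M) ≫
      pullbackCompCongr (k ≫ h) p hh M := by
  refine pullback_pullback_pullback_hom_ext k h p fun U x => ?_
  have e0 : p ⁻¹ᵁ U ≤ p ⁻¹ᵁ U := le_rfl
  have e1 : h ⁻¹ᵁ p ⁻¹ᵁ U ≤ g ⁻¹ᵁ U := by subst hg; exact le_rfl
  have e2 : k ⁻¹ᵁ h ⁻¹ᵁ p ⁻¹ᵁ U ≤ g' ⁻¹ᵁ U := by subst hg hg'; exact le_rfl
  have e3 : k ⁻¹ᵁ h ⁻¹ᵁ p ⁻¹ᵁ U ≤ k ⁻¹ᵁ g ⁻¹ᵁ U := by subst hg; exact le_rfl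
  have e4 : k ⁻¹ᵁ h ⁻¹ᵁ p ⁻¹ᵁ U ≤ (k ≫ h) ⁻¹ᵁ p ⁻¹ᵁ U := le_rfl
  have a1 := secMap_pullback_map k (pullbackCompCongr h p hg M)
    (le_refl (k ⁻¹ᵁ h ⁻¹ᵁ p ⁻¹ᵁ U)) (pullSec h (le_refl (h ⁻¹ᵁ p ⁻¹ᵁ U)) (pullSec p e0 x))
  have a2 := secMap_pullbackCompCongr h p hg e0 (le_refl (h ⁻¹ᵁ p ⁻¹ᵁ U)) e1 x
  have a3 := secMap_pullbackCompCongr k g hg' e1 (le_refl (k ⁻¹ᵁ h ⁻¹ᵁ p ⁻¹ᵁ U)) e2 x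
  have a4 := secMap_pullbackComp h k (le_refl (h ⁻¹ᵁ p ⁻¹ᵁ U)) (le_refl (k ⁻¹ᵁ h ⁻¹ᵁ p ⁻¹ᵁ U))
    (pullSec p e0 x)
  have a5 := secMap_pullbackCompCongr (k ≫ h) p hh e0 e4 e2 x
  rw [a2] at a1
  rw [secMap_comp, secMap_comp, a1, a3, a4]
  exact a5.symm

lemma pullback_subobject_trans {g : T ⟶ S} {g' : Y ⟶ S} (hg : h ≫ p = g) (hg' : k ≫ g = g')
    (hh : (k ≫ h) ≫ p = g') {M : S.Modules} {F : X.Modules} {F' : T.Modules} {F'' : Y.Modules}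
    (a : F ⟶ (Scheme.Modules.pullback p).obj M) (a' : F' ⟶ (Scheme.Modules.pullback g).obj M)
    (a'' : F'' ⟶ (Scheme.Modules.pullback g').obj M)
    (e : (Scheme.Modules.pullback h).obj F ≅ F') (e' : (Scheme.Modules.pullback k).obj F' ≅ F'')
    (he : e.hom ≫ a' = (Scheme.Modules.pullback h).map a ≫ pullbackCompCongr h p hg M)
    (he' : e'.hom ≫ a'' = (Scheme.Modules.pullback k).map a' ≫ pullbackCompCongr k g hg' M) :
    ∃ f : (Scheme.Modules.pullback (k ≫ h)).obj F ≅ F'',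
      f.hom ≫ a'' = (Scheme.Modules.pullback (k ≫ h)).map a ≫ pullbackCompCongr (k ≫ h) p hh M := by
  refine ⟨((Scheme.Modules.pullbackComp k h).app _).symm ≪≫
    (Scheme.Modules.pullback k).mapIso e ≪≫ e', ?_⟩
  have h1 := pullbackCompCongr_assoc k h p hg hg' hh M
  have h2 := (Scheme.Modules.pullbackComp k h).inv.naturality a
  simp only [Iso.trans_hom, Iso.symm_hom, Iso.app_inv, Functor.mapIso_hom, Category.assoc, he']
  rw [← Functor.map_comp_assoc, he, Functor.map_comp_assoc, h1]
  have h3 := congrArg (fun f => f ≫ (Scheme.Modules.pullbackComp k h).hom.app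
    ((Scheme.Modules.pullback p).obj M) ≫ pullbackCompCongr (k ≫ h) p hh M) h2
  simp only [Category.assoc, Iso.inv_hom_id_app_assoc] at h3
  exact h3.symm

variable {V : Type v} [Fintype V] {A : TreeData V} {E : LinkedData A S} {r t : ℕ}

lemma LinkedSubbundle.IsPullback.trans {k : Y ⟶ T} {h : T ⟶ X} {p : X ⟶ S} {g : T ⟶ S}
    {g' : Y ⟶ S} {F : LinkedSubbundle (E.pullback p) r t} {F' : LinkedSubbundle (E.pullback g) r t}
    {F'' : LinkedSubbundle (E.pullback g') r t} (H : LinkedSubbundle.IsPullback h F F')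
    (H' : LinkedSubbundle.IsPullback k F' F'') : LinkedSubbundle.IsPullback (k ≫ h) F F'' := by
  obtain ⟨hg, H⟩ := H
  obtain ⟨hg', H'⟩ := H'
  have hh : (k ≫ h) ≫ p = g' := by rw [Category.assoc, hg, hg']
  refine ⟨hh, fun w => ?_⟩
  obtain ⟨e, he⟩ := H w
  obtain ⟨e', he'⟩ := H' w
  exact pullback_subobject_trans k h p hg hg' hh (M := E.obj w) (F.sub w).arrow (F'.sub w).arrow
    (F''.sub w).arrow e e' he he'

end Transitivity

/-! ### Compositions along paths, for pull-backs and for linked subbundles -/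

section PathMaps

variable {V : Type v} [Fintype V] {A : TreeData V} {X : Scheme.{u}} (E : LinkedData A X)

lemma LinkedData.pathMap_nil (w : A.Vert) :
    E.pathMap (Quiver.Path.nil : Quiver.Path w w) = 𝟙 (E.obj w) := rfl

lemma LinkedData.pathMap_cons {w w' w'' : A.Vert} (P : Quiver.Path w w') (ε : w' ⟶ w'') :
    E.pathMap (P.cons ε) = E.pathMap P ≫ E.map ε := rfl

lemma LinkedData.pullback_pathMap {T : Scheme.{u}} (g : T ⟶ X) {w w' : A.Vert}
    (P : Quiver.Path w w') :
    (E.pullback g).pathMap P = (Scheme.Modules.pullback g).map (E.pathMap P) := by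
  induction P with
  | nil => exact ((Scheme.Modules.pullback g).map_id _).symm
  | cons P ε ih =>
    rw [LinkedData.pathMap_cons, LinkedData.pathMap_cons, Functor.map_comp, ih]
    rfl

lemma LinkedSubbundle.pathMap_arrow {r t : ℕ} {E : LinkedData A X}
    (F : LinkedSubbundle E r t) {w w' : A.Vert} (P : Quiver.Path w w') :
    (F.toLinkedData.pathMap P : (F.sub w : X.Modules) ⟶ F.sub w') ≫ (F.sub w').arrow =
      (F.sub w).arrow ≫ E.pathMap P := by
  induction P with
  | nil =>
    rw [LinkedData.pathMap_nil]
    exact (Category.id_comp _).trans (Category.comp_id _).symm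
  | @cons w' w'' P ε ih =>
    have h1 : (F.toLinkedData.map ε : (F.sub w' : X.Modules) ⟶ F.sub w'') ≫ (F.sub w'').arrow =
      (F.sub w').arrow ≫ E.map ε := Subobject.factorThru_arrow _ _ (F.factors ε)
    refine (Category.assoc (F.toLinkedData.pathMap P : (F.sub w : X.Modules) ⟶ F.sub w')
      (F.toLinkedData.map ε : (F.sub w' : X.Modules) ⟶ F.sub w'') (F.sub w'').arrow).trans ?_
    rw [h1]
    refine (Category.assoc (F.toLinkedData.pathMap P : (F.sub w : X.Modules) ⟶ F.sub w')
      (F.sub w').arrow (E.map ε)).symm.trans ?_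
    rw [ih]
    exact Category.assoc _ _ _

end PathMaps

end

section

/-! ### Linked subbundles with prescribed generators -/

variable {V : Type v} [Fintype V] {A : TreeData V} {S : Scheme.{u}}

instance : Fintype A.Vert := Fintype.ofFinite _

/-- Frames of the bundles `E_w` over an open subset of the base, vertices `w_i` and shortest
paths from `w_i` to all the vertices, and, for each vertex, a splitting of the set of the frame
sections in two parts. -/
structure FramedChart (E : LinkedData A S) (r t : ℕ) where
  base : S.Opens
  frame (u : A.Vert) : Fin t → Γ(E.obj u, base)
  isFrame (u : A.Vert) : IsFrame (frame u)
  w : Fin r → A.Vert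
  path (i : Fin r) (u : A.Vert) : Quiver.Path (w i) u
  length_path_le (i : Fin r) (u : A.Vert) (P : Quiver.Path (w i) u) : (path i u).length ≤ P.length
  split (u : A.Vert) : Fin r ⊕ Fin (t - r) ≃ Fin t

namespace FramedChart

variable {E : LinkedData A S} {r t : ℕ} (D : FramedChart E r t)

lemma path_self (i : Fin r) : D.path i (D.w i) = Quiver.Path.nil :=
  Quiver.Path.eq_nil_of_length_zero _ (Nat.le_zero.mp (D.length_path_le i _ Quiver.Path.nil))

/-- The matrix of `f_P`. -/
def pathMatrix {u u' : A.Vert} (P : Quiver.Path u u') : Matrix (Fin t) (Fin t) Γ(S, D.base) :=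
  Matrix.of fun k => (D.isFrame u').coord le_rfl (secMap (E.pathMap P) D.base (D.frame u k))

lemma secMap_pathMap_frame {u u' : A.Vert} (P : Quiver.Path u u') (k : Fin t) :
    secMap (E.pathMap P) D.base (D.frame u k) = ∑ l, D.pathMatrix P k l • D.frame u' l := by
  simpa [pathMatrix] using ((D.isFrame u').sum_coord le_rfl (secMap (E.pathMap P) D.base (D.frame u k))).symm

lemma pathMatrix_nil (u : A.Vert) :
    D.pathMatrix (Quiver.Path.nil : Quiver.Path u u) = 1 := by
  ext k l
  have := congrFun ((D.isFrame u).coord_self le_rfl k) l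
  rw [secRes_self] at this
  rw [pathMatrix, LinkedData.pathMap_nil, Matrix.of_apply, secMap_id, this, Matrix.one_apply]
  simp [Pi.single_apply, eq_comm]

lemma exists_pathMatrix_eq {s : Γ(S, ⊤)} (hE : IsPrelinked E s t) {u u' : A.Vert}
    {P P' : Quiver.Path u u'} (h : P.length ≤ P'.length) :
    ∃ c : Γ(S, D.base), D.pathMatrix P' = c • D.pathMatrix P := by
  refine ⟨resTop s D.base ^ (TreeData.fullCount P' - TreeData.fullCount P), ?_⟩
  ext k l
  have h1 : secMap (E.pathMap P') D.base (D.frame u k) =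
      resTop s D.base ^ (TreeData.fullCount P' - TreeData.fullCount P) •
        secMap (E.pathMap P) D.base (D.frame u k) := hE.pathMap_eq P P' h _ _
  simp only [pathMatrix, Matrix.of_apply, h1, map_smul, Pi.smul_apply, Matrix.smul_apply]

section Rows

variable {R R' : Type*} [CommRing R] [CommRing R'] (φ : Γ(S, D.base) →+* R)
  (x : Fin r × Fin t → R)

/-- The coordinates of the images at the vertex `u` of the sections with coordinates `x` at the
vertices `w_i`. -/
def rows (u : A.Vert) : Matrix (Fin r) (Fin t) R :=
  Matrix.of fun i => Matrix.vecMul (fun k => x (i, k)) ((D.pathMatrix (D.path i u)).map φ)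

lemma rows_self (i : Fin r) (l : Fin t) : D.rows φ x (D.w i) i l = x (i, l) := by
  rw [rows, Matrix.of_apply, path_self, pathMatrix_nil, Matrix.map_one φ (map_zero φ) (map_one φ),
    Matrix.vecMul_one]

lemma rows_map (ψ : R →+* R') (u : A.Vert) :
    D.rows (ψ.comp φ) (ψ ∘ x) u = (D.rows φ x u).map ψ := by
  ext i l
  simp [rows, Matrix.vecMul, dotProduct]

/-- The product of the chosen minors. -/
def minor : R :=
  ∏ u, ((D.rows φ x u).submatrix id fun i => D.split u (Sum.inl i)).det

lemma minor_map (ψ : R →+* R') : D.minor (ψ.comp φ) (ψ ∘ x) = ψ (D.minor φ x) := by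
  rw [minor, minor, map_prod]
  refine Finset.prod_congr rfl fun u _ => ?_
  rw [rows_map, RingHom.map_det]
  rfl

end Rows

variable {T : Scheme.{u}} (g : T ⟶ S)

/-- The linked subbundle `F` of the pull-back of `E` has over `W` at each vertex `u` the frame
given by the rows of the matrix `rows`. -/
def Represents {g : T ⟶ S} (F : LinkedSubbundle (E.pullback g) r t) {W : T.Opens}
    (hW : W ≤ g ⁻¹ᵁ D.base) (x : Fin r × Fin t → Γ(T, W)) : Prop :=
  ∀ u, ∃ a : Fin r → Γ((F.sub u : T.Modules), W), IsFrame a ∧ ∀ i, secMap (F.sub u).arrow W (a i) =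
    (∑ l, D.rows (g.appLE D.base W hW).hom x u i l • pullSec g hW (D.frame u l) :
      Γ((Scheme.Modules.pullback g).obj (E.obj u), W))

/-- The pulled-back frame of `F` and the frame of `F'` have the same coordinates in the bundles
`E_u`, so matching them gives an isomorphism compatible with the inclusions. -/
lemma isPullback_of_represents {T' : Scheme.{u}} {g' : T' ⟶ S} (h : T' ⟶ T) {g : T ⟶ S}
    (hg : h ≫ g = g')
    {F : LinkedSubbundle (E.pullback g) r t} {W : T.Opens}
    {hW : W ≤ g ⁻¹ᵁ D.base} {x : Fin r × Fin t → Γ(T, W)} (hF : D.Represents F hW x)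
    {F' : LinkedSubbundle (E.pullback g') r t} {hg' : ⊤ ≤ g' ⁻¹ᵁ D.base} (hWh : ⊤ ≤ h ⁻¹ᵁ W)
    (hF' : D.Represents F' hg' fun ij => (h.appLE W ⊤ hWh).hom (x ij)) :
    LinkedSubbundle.IsPullback h F F' := by
  refine ⟨hg, fun u => ?_⟩
  obtain ⟨a, ha, hae⟩ := hF u
  obtain ⟨a', ha', hae'⟩ := hF' u
  have hb := ha.pullSec h hWh
  obtain ⟨φ, hφ⟩ := hb.exists_hom a'
  have := isIso_of_isFrame hb ha' φ hφ
  refine ⟨asIso φ, hb.hom_ext fun i => ?_⟩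
  have h1 : secMap (φ ≫ (F'.sub u).arrow) ⊤ (pullSec h hWh (a i)) =
      (∑ l, D.rows (g'.appLE D.base ⊤ hg').hom (fun ij => (h.appLE W ⊤ hWh).hom (x ij)) u i l •
        pullSec g' hg' (D.frame u l) : Γ((Scheme.Modules.pullback g').obj (E.obj u), ⊤)) := by
    rw [secMap_comp, hφ]
    exact hae' i
  refine h1.trans (Eq.symm ?_)
  have h2 : secMap ((Scheme.Modules.pullback h).map (F.sub u).arrow) ⊤ (pullSec h hWh (a i)) =
      (∑ l, (h.appLE W ⊤ hWh).hom (D.rows (g.appLE D.base W hW).hom x u i l) •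
        pullSec h hWh (pullSec g hW (D.frame u l)) : Γ((Scheme.Modules.pullback h).obj
          ((Scheme.Modules.pullback g).obj (E.obj u)), ⊤)) := by
    rw [secMap_pullback_map h, hae]
    refine (pullSec_sum h hWh _ _).trans (Finset.sum_congr rfl fun l _ => ?_)
    exact pullSec_smul h hWh _ _
  have h3 : secMap (pullbackCompCongr h g hg (E.obj u)) ⊤
      (secMap ((Scheme.Modules.pullback h).map (F.sub u).arrow) ⊤ (pullSec h hWh (a i))) =
      (∑ l, D.rows (g'.appLE D.base ⊤ hg').hom (fun ij => (h.appLE W ⊤ hWh).hom (x ij)) u i l •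
        pullSec g' hg' (D.frame u l) : Γ((Scheme.Modules.pullback g').obj (E.obj u), ⊤)) := by
    rw [h2, map_sum]
    refine Finset.sum_congr rfl fun l _ => ?_
    rw [map_smul, secMap_pullbackCompCongr h g hg hW hWh hg']
    congr 1
    have h4 : (g'.appLE D.base ⊤ hg').hom =
        (h.appLE W ⊤ hWh).hom.comp (g.appLE D.base W hW).hom := by
      subst hg
      rw [← CommRingCat.hom_comp, Scheme.Hom.appLE_comp_appLE]
    rw [h4]
    exact (congrFun (congrFun (D.rows_map (g.appLE D.base W hW).hom x (h.appLE W ⊤ hWh).hom u) i) l).symm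
  exact h3

end FramedChart

end

/-! ### Linked subbundles spanned by rows of matrices, and the form on them -/

section

variable {V : Type v} [Fintype V] {A : TreeData V} {S : Scheme.{u}}

lemma Pairing.toFun_eq_zero_of_isFrame {X : Scheme.{u}} {M N F F' : X.Modules} {ι κ : Type*}
    [Fintype ι] [Fintype κ] (B : Pairing M N) (f : F ⟶ M) (f' : F' ⟶ N) {a : ι → Γ(F, ⊤)}
    (ha : IsFrame a) {a' : κ → Γ(F', ⊤)} (ha' : IsFrame a')
    (h : ∀ i j, B.toFun ⊤ (secMap f ⊤ (a i)) (secMap f' ⊤ (a' j)) = 0) (U : X.Opens)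
    (x : Γ(F, U)) (y : Γ(F', U)) : B.toFun U ((f.app U).hom x) ((f'.app U).hom y) = 0 := by
  change B.toFun U (secMap f U x) (secMap f' U y) = 0
  rw [← ha.sum_coord le_top x, ← ha'.sum_coord le_top y, map_sum (secMap f U),
    map_sum (secMap f' U)]
  simp only [map_smul (secMap f U), map_smul (secMap f' U), secMap_secRes]
  rw [B.toFun_sum]
  simp [B.secRes_toFun, h]

namespace FramedChart

variable {E : LinkedData A S} {r t : ℕ} (D : FramedChart E r t)

section Existence

variable {T : Scheme.{u}} {g : T ⟶ S}

/-- The section of `g^* E_u` with given coordinates. -/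
def combination {W : T.Opens} (hW : W ≤ g ⁻¹ᵁ D.base) (u : A.Vert) (c : Fin t → Γ(T, W)) :
    Γ((Scheme.Modules.pullback g).obj (E.obj u), W) :=
  ∑ l, c l • pullSec g hW (D.frame u l)

lemma combination_smul {W : T.Opens} (hW : W ≤ g ⁻¹ᵁ D.base) (u : A.Vert) (a : Γ(T, W))
    (c : Fin t → Γ(T, W)) : D.combination hW u (a • c) = a • D.combination hW u c := by
  simp only [combination, Finset.smul_sum, smul_smul]
  rfl

lemma secMap_pathMap_combination {W : T.Opens} (hW : W ≤ g ⁻¹ᵁ D.base) {u u' : A.Vert}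
    (P : Quiver.Path u u') (c : Fin t → Γ(T, W)) :
    secMap ((Scheme.Modules.pullback g).map (E.pathMap P)) W (D.combination hW u c) =
      D.combination hW u' (Matrix.vecMul c ((D.pathMatrix P).map (g.appLE D.base W hW).hom)) := by
  have h (k : Fin t) : secMap ((Scheme.Modules.pullback g).map (E.pathMap P)) W
      (pullSec g hW (D.frame u k)) =
      ∑ l, (g.appLE D.base W hW).hom (D.pathMatrix P k l) • pullSec g hW (D.frame u' l) := by
    rw [secMap_pullback_map, secMap_pathMap_frame, pullSec_sum]
    exact Finset.sum_congr rfl fun l _ => pullSec_smul _ _ _ _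
  simp only [combination, map_sum, map_smul, h, Finset.smul_sum, smul_smul, Matrix.vecMul,
    dotProduct, Finset.sum_smul, Matrix.map_apply]
  exact Finset.sum_comm

/-- The frame consisting of the combinations with coordinates the rows of `M`, where the first
minor of `M` is invertible, and of a part of the given frame. -/
lemma isFrame_sumElim_combination (hg : ⊤ ≤ g ⁻¹ᵁ D.base) (u : A.Vert)
    (M : Matrix (Fin r) (Fin t) Γ(T, ⊤))
    (hM : IsUnit (M.submatrix id fun i => D.split u (Sum.inl i)).det) :
    IsFrame (Sum.elim (fun i => D.combination hg u (M i))
      fun k => pullSec g hg (D.frame u (D.split u (Sum.inr k)))) := by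
  have h1 := ((D.isFrame u).pullSec g hg).reindex (D.split u)
  refine h1.of_isUnit_det (Matrix.fromBlocks (M.submatrix id fun i => D.split u (Sum.inl i))
    (M.submatrix id fun i => D.split u (Sum.inr i)) 0 1) ?_ ?_
  · rwa [Matrix.det_fromBlocks_zero₂₁, Matrix.det_one, mul_one]
  · rintro (i | k)
    · simp only [Sum.elim_inl, combination]
      rw [← Equiv.sum_comp (D.split u)]
      simp
    · simp [Matrix.one_apply]

/-- The chosen path is a shortest one, so by the prelinked condition `f_P` is a power of `s` times
the map along it. -/
lemma exists_vecMul_path_cons {s : Γ(S, ⊤)} (hE : IsPrelinked E s t) {R : Type*} [CommRing R]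
    (φ : Γ(S, D.base) →+* R) (x : Fin r × Fin t → R) (i : Fin r) {u : A.Vert}
    (P : Quiver.Path (D.w i) u) :
    ∃ c : R, Matrix.vecMul (fun k => x (i, k)) ((D.pathMatrix P).map φ) = c • D.rows φ x u i := by
  obtain ⟨c, hc⟩ := D.exists_pathMatrix_eq hE (D.length_path_le i u P)
  refine ⟨φ c, ?_⟩
  have : (D.pathMatrix P).map φ = φ c • (D.pathMatrix (D.path i u)).map φ := by
    rw [hc]
    ext
    simp
  rw [this, Matrix.vecMul_smul]
  rfl

/-- The invertible minor at each vertex extends the rows to a frame of the pull-back of `E_u`, so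
they span a subbundle. Linkage holds row by row: following the path to `u` by an edge to `u'` gives
a multiple of the corresponding row at `u'`. -/
lemma exists_represents {s : Γ(S, ⊤)} (hE : IsPrelinked E s t) (hg : ⊤ ≤ g ⁻¹ᵁ D.base)
    (x : Fin r × Fin t → Γ(T, ⊤)) (hx : IsUnit (D.minor (g.appLE D.base ⊤ hg).hom x)) :
    ∃ F : LinkedSubbundle (E.pullback g) r t, D.Represents F hg x := by
  have hM (u : A.Vert) : IsUnit ((D.rows (g.appLE D.base ⊤ hg).hom x u).submatrix id
      fun i => D.split u (Sum.inl i)).det :=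
    isUnit_of_dvd_unit (Finset.dvd_prod_of_mem (fun u => ((D.rows (g.appLE D.base ⊤ hg).hom
      x u).submatrix id fun i => D.split u (Sum.inl i)).det) (Finset.mem_univ u)) hx
  have hb (u : A.Vert) := D.isFrame_sumElim_combination hg u _ (hM u)
  choose P a ha hP using fun u => exists_subobject_of_isFrame (hb u)
  refine ⟨⟨P, fun u => IsVectorBundle.of_isFrame (ha u),
    fun u => IsVectorBundle.of_isFrame (isFrame_cokernel (hb u) (ha u) (hP u)), ?_⟩,
    fun u => ⟨a u, ha u, hP u⟩⟩
  intro u u' ε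
  choose c hc using fun i => D.exists_vecMul_path_cons hE (g.appLE D.base ⊤ hg).hom x i
    ((D.path i u).cons ε)
  change (P u').Factors ((P u).arrow ≫ (Scheme.Modules.pullback g).map (E.map ε))
  refine subobject_factors_of_isFrame (ha u) (Matrix.diagonal c) (a' := a u') fun i => ?_
  have h1 : secMap ((P u).arrow ≫ (Scheme.Modules.pullback g).map (E.map ε)) ⊤ (a u i) =
      D.combination hg u' (c i • D.rows (g.appLE D.base ⊤ hg).hom x u' i) := by
    rw [← hc i, ← D.secMap_pathMap_combination hg, secMap_comp, hP]
    have h2 : D.combination hg u (D.rows (g.appLE D.base ⊤ hg).hom x u i) =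
        secMap ((Scheme.Modules.pullback g).map (E.pathMap (D.path i u))) ⊤
          (D.combination hg (D.w i) fun k => x (i, k)) :=
      (D.secMap_pathMap_combination hg _ _).symm
    simp only [Sum.elim_inl]
    rw [h2, LinkedData.pathMap_cons, Functor.map_comp, secMap_comp]
  rw [h1, combination_smul, Finset.sum_eq_single i]
  · rw [hP, Matrix.diagonal_apply_eq]
    rfl
  · intro j _ hj
    rw [Matrix.diagonal_apply_ne _ hj.symm, zero_smul]
  · simp

end Existence

section Forms

variable {s : Γ(S, ⊤)} {m : V → ℤ} (ω : LinkedAlternatingForm E s m)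

/-- The Gram matrix of the form. -/
def gram (u u' : A.Vert) : Matrix (Fin t) (Fin t) Γ(S, D.base) :=
  Matrix.of fun k l => (ω.form u u').toFun D.base (D.frame u k) (D.frame u' l)

lemma gram_diag (u : A.Vert) (k : Fin t) : D.gram ω u u k k = 0 := ω.self_eq_zero u _ _

lemma gram_swap (u u' : A.Vert) (k l : Fin t) : D.gram ω u u' k l = -D.gram ω u' u l k := by
  by_cases h : u = u'
  · subst h
    have h1 := ω.self_eq_zero u D.base (D.frame u k + D.frame u l)
    simp only [map_add, LinearMap.add_apply, ω.self_eq_zero, zero_add, add_zero] at h1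
    exact eq_neg_of_add_eq_zero_right h1
  · exact ω.neg_swap h _ _ _

/-- The value of the exponent depends on the path through the distances to `m`, but only its
existence matters in the sequel. -/
lemma _root_.PrelinkedAG.LinkedAlternatingForm.exists_pathMap_left (ω : LinkedAlternatingForm E s m)
    {u u' : A.Vert} (P : Quiver.Path u u') (v : A.Vert) (U : S.Opens) :
    ∃ N : ℕ, ∀ x y, (ω.form u' v).toFun U (secMap (E.pathMap P) U x) y =
      resTop s U ^ N * (ω.form u v).toFun U x y := by
  induction P with
  | nil => exact ⟨0, fun x y => by rw [pow_zero, one_mul]; rfl⟩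
  | @cons u' u'' P ε ih =>
    obtain ⟨N, hN⟩ := ih
    refine ⟨A.delta m (TreeData.mid u' v) (TreeData.mid u'' v) + N, fun x y => ?_⟩
    rw [pow_add, mul_assoc, ← hN]
    exact ω.map_left ε v U (secMap (E.pathMap P) U x) y

lemma _root_.PrelinkedAG.LinkedAlternatingForm.exists_pathMap_right
    (ω : LinkedAlternatingForm E s m)
    {u u' : A.Vert} (P : Quiver.Path u u') (v : A.Vert) (U : S.Opens) :
    ∃ N : ℕ, ∀ x y, (ω.form v u').toFun U x (secMap (E.pathMap P) U y) =
      resTop s U ^ N * (ω.form v u).toFun U x y := by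
  induction P with
  | nil => exact ⟨0, fun x y => by rw [pow_zero, one_mul]; rfl⟩
  | @cons u' u'' P ε ih =>
    obtain ⟨N, hN⟩ := ih
    refine ⟨A.delta m (TreeData.mid v u') (TreeData.mid v u'') + N, fun x y => ?_⟩
    rw [pow_add, mul_assoc, ← hN]
    exact ω.map_right v ε U x (secMap (E.pathMap P) U y)

lemma exists_gram_eq {u u' v v' : A.Vert} (P : Quiver.Path u u') (Q : Quiver.Path v v') :
    ∃ c : Γ(S, D.base), D.pathMatrix P * D.gram ω u' v' * (D.pathMatrix Q).transpose = c • D.gram ω u v := by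
  obtain ⟨N, hN⟩ := ω.exists_pathMap_left P v' D.base
  obtain ⟨N', hN'⟩ := ω.exists_pathMap_right Q u D.base
  refine ⟨resTop s D.base ^ N * resTop s D.base ^ N', ?_⟩
  ext k l
  have h1 := (hN (D.frame u k) (secMap (E.pathMap Q) D.base (D.frame v l))).trans
    (congrArg _ (hN' (D.frame u k) (D.frame v l)))
  rw [← mul_assoc, secMap_pathMap_frame, secMap_pathMap_frame, Pairing.toFun_sum] at h1
  refine Eq.trans ?_ h1
  simp only [Matrix.mul_apply, Matrix.transpose_apply, Finset.sum_mul]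
  rw [Finset.sum_comm]
  refine Finset.sum_congr rfl fun a _ => Finset.sum_congr rfl fun b _ => ?_
  simp only [gram, Matrix.of_apply]
  ring

section Values

variable {R R' : Type*} [CommRing R] [CommRing R'] (φ : Γ(S, D.base) →+* R)
  (x : Fin r × Fin t → R)

/-- The value of the form at the sections with coordinates `x` at the vertices `w_i` and `w_j`. -/
def formValue (i j : Fin r) : R :=
  ∑ k, ∑ l, x (i, k) * x (j, l) * φ (D.gram ω (D.w i) (D.w j) k l)

lemma formValue_map (ψ : R →+* R') (i j : Fin r) :
    D.formValue ω (ψ.comp φ) (ψ ∘ x) i j = ψ (D.formValue ω φ x i j) := by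
  simp [formValue]

lemma formValue_swap (i j : Fin r) : D.formValue ω φ x i j = -D.formValue ω φ x j i := by
  rw [formValue, formValue, Finset.sum_comm, ← Finset.sum_neg_distrib]
  refine Finset.sum_congr rfl fun l _ => ?_
  rw [← Finset.sum_neg_distrib]
  refine Finset.sum_congr rfl fun k _ => ?_
  rw [gram_swap, map_neg]
  ring

/-- The terms at `(k, l)` and `(l, k)` cancel and the diagonal terms vanish; no division by `2` is
involved, so characteristic `2` is covered. -/
lemma formValue_self (i : Fin r) : D.formValue ω φ x i i = 0 := by
  rw [formValue, ← Finset.sum_product', Finset.univ_product_univ]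
  refine Finset.sum_involution (fun a _ => a.swap) ?_ ?_ (fun _ _ => Finset.mem_univ _)
    (fun a _ => Prod.swap_swap a)
  · rintro ⟨k, l⟩ -
    simp only [Prod.swap]
    rw [D.gram_swap ω _ _ k l, map_neg]
    ring
  · rintro ⟨k, l⟩ - h heq
    obtain rfl : l = k := congrArg Prod.fst heq
    simp [gram_diag] at h

lemma formValue_eq_zero (h : ∀ i j, i < j → D.formValue ω φ x i j = 0) (i j : Fin r) :
    D.formValue ω φ x i j = 0 := by
  rcases lt_trichotomy i j with hij | rfl | hij
  · exact h i j hij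
  · exact D.formValue_self ω φ x i
  · rw [formValue_swap, h j i hij, neg_zero]

/-- The rows are images of the vectors at `w_i` and `w_j`, and moving both arguments along paths
multiplies the form by powers of `s`. This is why the equations at the `w_i` control all pairs of
vertices. -/
lemma exists_sum_rows_eq (u v : A.Vert) (i j : Fin r) :
    ∃ c, ∑ k, ∑ l, D.rows φ x u i k * D.rows φ x v j l * φ (D.gram ω u v k l) =
      c * D.formValue ω φ x i j := by
  obtain ⟨c, hc⟩ := D.exists_gram_eq ω (D.path i u) (D.path j v)
  refine ⟨φ c, ?_⟩
  have key (a b : Fin t → R) (M : Matrix (Fin t) (Fin t) R) :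
      ∑ k, ∑ l, a k * b l * M k l = dotProduct a (M.mulVec b) := by
    simp only [dotProduct, Matrix.mulVec, Finset.mul_sum]
    exact Finset.sum_congr rfl fun k _ => Finset.sum_congr rfl fun l _ => by ring
  have h := congrArg (fun M : Matrix (Fin t) (Fin t) Γ(S, D.base) => M.map φ) hc
  simp only [Matrix.map_mul, Matrix.transpose_map] at h
  have h' : (c • D.gram ω (D.w i) (D.w j)).map φ = φ c • (D.gram ω (D.w i) (D.w j)).map φ := by
    ext
    simp
  have e1 := key (D.rows φ x u i) (D.rows φ x v j) ((D.gram ω u v).map φ)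
  have e2 := key (fun k => x (i, k)) (fun l => x (j, l)) ((D.gram ω (D.w i) (D.w j)).map φ)
  simp only [Matrix.map_apply] at e1 e2
  rw [formValue, e1, e2]
  have r1 : D.rows φ x u i =
    Matrix.vecMul (fun k => x (i, k)) ((D.pathMatrix (D.path i u)).map φ) := rfl
  have r2 : D.rows φ x v j =
    Matrix.vecMul (fun k => x (j, k)) ((D.pathMatrix (D.path j v)).map φ) := rfl
  rw [r1, r2, ← Matrix.dotProduct_mulVec, ← Matrix.mulVec_transpose, Matrix.mulVec_mulVec,
    Matrix.mulVec_mulVec, h, h', Matrix.smul_mulVec, dotProduct_smul, smul_eq_mul]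

end Values

section Isotropy

variable {T : Scheme.{u}} {g : T ⟶ S}

lemma toFun_combination {u v : A.Vert} {C : Pairing ((Scheme.Modules.pullback g).obj (E.obj u))
      ((Scheme.Modules.pullback g).obj (E.obj v))} (hC : (ω.form u v).IsPullback g C)
    {W : T.Opens} (hW : W ≤ g ⁻¹ᵁ D.base) (a b : Fin t → Γ(T, W)) :
    C.toFun W (D.combination hW u a) (D.combination hW v b) =
      ∑ k, ∑ l, a k * b l * (g.appLE D.base W hW).hom (D.gram ω u v k l) := by
  rw [combination, combination, Pairing.toFun_sum]
  refine Finset.sum_congr rfl fun k _ => Finset.sum_congr rfl fun l _ => ?_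
  rw [hC.toFun_pullSec]
  rfl

/-- At the vertices `w_i` and `w_j` the relevant rows are the vectors themselves, which gives
necessity. Conversely every value on the frames at `u` and `v` is a multiple of some `formValue`. -/
lemma isIsotropic_iff (hg : ⊤ ≤ g ⁻¹ᵁ D.base) {x : Fin r × Fin t → Γ(T, ⊤)}
    {F : LinkedSubbundle (E.pullback g) r t} (hF : D.Represents F hg x) :
    F.IsIsotropic ω ↔
      ∀ i j, i < j → D.formValue ω (g.appLE D.base ⊤ hg).hom x i j = 0 := by
  choose a ha hF using hF
  constructor
  · intro H i j _
    obtain ⟨C, hC, h0⟩ := H (D.w i) (D.w j)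
    have h1 := h0 ⊤ (a _ i) (a _ j)
    have h2 := D.toFun_combination ω hC hg
      (D.rows (g.appLE D.base ⊤ hg).hom x (D.w i) i) (D.rows (g.appLE D.base ⊤ hg).hom x (D.w j) j)
    simp only [rows_self] at h2
    refine h2.symm.trans (Eq.trans ?_ h1)
    exact (congrArg₂ (fun y z => C.toFun ⊤ y z) (hF _ i) (hF _ j)).symm
  · intro H u v
    obtain ⟨C, hC⟩ := (ω.form u v).exists_isPullback g hg (D.isFrame u) (D.isFrame v)
    refine ⟨C, hC, C.toFun_eq_zero_of_isFrame (F.sub u).arrow (F.sub v).arrow (ha u) (ha v)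
      fun i j => ?_⟩
    obtain ⟨c, hc⟩ := D.exists_sum_rows_eq ω (g.appLE D.base ⊤ hg).hom x u v i j
    have h2 := (D.toFun_combination ω hC hg _ _).trans hc
    rw [D.formValue_eq_zero ω _ x H, mul_zero] at h2
    exact (congrArg₂ (fun y z => C.toFun ⊤ y z) (hF _ i) (hF _ j)).trans h2

end Isotropy

end Forms

end FramedChart

end

section

/-! ### Morphisms from spectra to affine open subsets -/

section AffineOpens

variable {X Y : Scheme.{u}} {U : X.Opens} (hU : IsAffineOpen U)

/-- The morphism from the spectrum of `C` to an affine open subset of `X` given by a ring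
homomorphism. -/
def _root_.AlgebraicGeometry.IsAffineOpen.specMap {C : CommRingCat.{u}} (φ : Γ(X, U) →+* C) : Spec C ⟶ X :=
  Spec.map (CommRingCat.ofHom φ) ≫ hU.fromSpec

lemma _root_.AlgebraicGeometry.IsAffineOpen.top_le_specMap {C : CommRingCat.{u}} (φ : Γ(X, U) →+* C) : ⊤ ≤ hU.specMap φ ⁻¹ᵁ U := by
  rw [IsAffineOpen.specMap, Scheme.Hom.comp_preimage, hU.fromSpec_preimage_self]
  exact le_rfl

lemma _root_.AlgebraicGeometry.IsAffineOpen.specMap_appLE {C : CommRingCat.{u}} (φ : Γ(X, U) →+* C) :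
    ((hU.specMap φ).appLE U ⊤ (hU.top_le_specMap φ)).hom =
      (Scheme.ΓSpecIso C).inv.hom.comp φ := by
  have h0 : ⊤ ≤ (Spec.map (CommRingCat.ofHom φ) ≫ hU.fromSpec) ⁻¹ᵁ U := hU.top_le_specMap φ
  have : (Spec.map (CommRingCat.ofHom φ) ≫ hU.fromSpec).appLE U ⊤ h0 =
      CommRingCat.ofHom φ ≫ (Scheme.ΓSpecIso C).inv := by
    have h1 : ⊤ ≤ hU.fromSpec ⁻¹ᵁ U := hU.fromSpec_preimage_self.ge
    refine Eq.trans ?_ (Scheme.ΓSpecIso_inv_naturality (CommRingCat.ofHom φ)).symm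
    rw [← Scheme.Hom.appLE_comp_appLE (U := U) (V := ⊤) (W := ⊤)
      (Spec.map (CommRingCat.ofHom φ)) hU.fromSpec h1 le_top]
    have h2 : hU.fromSpec.appLE U ⊤ h1 = (Scheme.ΓSpecIso Γ(X, U)).inv := by
      rw [Scheme.Hom.appLE, hU.fromSpec_app_self, Category.assoc, ← Functor.map_comp]
      exact (congrArg _ ((Spec Γ(X, U)).presheaf.map_id _)).trans (Category.comp_id _)
    rw [h2]
    congr 1
  exact congrArg CommRingCat.Hom.hom this

lemma _root_.AlgebraicGeometry.IsAffineOpen.specMap_comp {C C' : CommRingCat.{u}} (φ : Γ(X, U) →+* C) (ψ : C →+* C') :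
    Spec.map (CommRingCat.ofHom ψ) ≫ hU.specMap φ = hU.specMap (ψ.comp φ) := by
  rw [IsAffineOpen.specMap, IsAffineOpen.specMap, CommRingCat.ofHom_comp, Spec.map_comp,
    Category.assoc]

lemma _root_.AlgebraicGeometry.IsAffineOpen.specMap_injective {C : CommRingCat.{u}} {φ ψ : Γ(X, U) →+* C}
    (h : hU.specMap φ = hU.specMap ψ) : φ = ψ := by
  have := (cancel_mono hU.fromSpec).mp h
  exact congrArg CommRingCat.Hom.hom (Spec.map_injective this)

lemma _root_.AlgebraicGeometry.IsAffineOpen.eq_specMap {C : CommRingCat.{u}} (h : Spec C ⟶ X) (hh : ⊤ ≤ h ⁻¹ᵁ U) :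
    h = hU.specMap ((h.appLE U ⊤ hh) ≫ (Scheme.ΓSpecIso C).hom).hom := by
  have h1 := hU.SpecMap_appLE_fromSpec h (isAffineOpen_top (Spec C)) hh
  rw [IsAffineOpen.specMap, CommRingCat.ofHom_hom, Spec.map_comp, Category.assoc, h1]
  simp [IsAffineOpen.fromSpec_top, Scheme.isoSpec_Spec]

variable {S : Scheme.{u}} {V : S.Opens} (hV : IsAffineOpen V)

lemma _root_.AlgebraicGeometry.IsAffineOpen.specMap_comp_right (p : X ⟶ S) (h : U ≤ p ⁻¹ᵁ V) {C : CommRingCat.{u}} (φ : Γ(X, U) →+* C) :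
    hU.specMap φ ≫ p = hV.specMap (φ.comp (p.appLE V U h).hom) := by
  rw [IsAffineOpen.specMap, Category.assoc, ← hV.SpecMap_appLE_fromSpec p hU h,
    IsAffineOpen.specMap, CommRingCat.ofHom_comp, Spec.map_comp, Category.assoc]
  rfl

/-- A morphism to an affine open subset factors through a closed subscheme if and only if the
functions on this open subset which vanish on the closed subscheme pull back to zero. -/
lemma exists_comp_eq_specMap_iff (i : Y ⟶ X) [IsClosedImmersion i] {C : CommRingCat.{u}}
    (φ : Γ(X, U) →+* C) :
    (∃ k : Spec C ⟶ Y, k ≫ i = hU.specMap φ) ↔ RingHom.ker (i.app U).hom ≤ RingHom.ker φ := by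
  have hUY : IsAffineOpen (i ⁻¹ᵁ U) := hU.preimage i
  constructor
  · rintro ⟨k, hk⟩
    have h1 : ⊤ ≤ k ⁻¹ᵁ (i ⁻¹ᵁ U) := by
      rw [← Scheme.Hom.comp_preimage, hk]
      exact hU.top_le_specMap φ
    rw [hUY.eq_specMap k h1, hUY.specMap_comp_right hU i le_rfl] at hk
    rw [← hU.specMap_injective hk, Scheme.Hom.appLE_eq_app]
    intro a ha
    rw [RingHom.mem_ker] at ha ⊢
    rw [RingHom.comp_apply, ha, map_zero]
  · intro h
    have hs : Function.Surjective (i.app U).hom := i.app_surjective U hU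
    let χ : Γ(Y, i ⁻¹ᵁ U) →+* C := RingHom.liftOfSurjective (i.app U).hom hs ⟨φ, h⟩
    refine ⟨hUY.specMap χ, ?_⟩
    rw [hUY.specMap_comp_right hU i le_rfl, Scheme.Hom.appLE_eq_app]
    congr 1
    exact RingHom.liftOfRightInverse_comp _ _ _ _

end AffineOpens

variable {V : Type v} [Fintype V] {A : TreeData V} {S : Scheme.{u}}

/-! ### Ring-valued points of the Grassmannian given by coordinates -/

namespace FramedChart

variable {E : LinkedData A S} {r t : ℕ} (D : FramedChart E r t) {s : Γ(S, ⊤)}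
  (hE : IsPrelinked E s t) (LG : PrelinkedGrassmannian E r t)

section Grassmannian

variable {D} in
lemma Represents.congr {T : Scheme.{u}} {g : T ⟶ S} {F : LinkedSubbundle (E.pullback g) r t}
    {W : T.Opens} {hW : W ≤ g ⁻¹ᵁ D.base} {x x' : Fin r × Fin t → Γ(T, W)}
    (h : D.Represents F hW x) (hx : ∀ ij, x' ij = x ij) : D.Represents F hW x' := by
  obtain rfl : x' = x := funext hx
  exact h

/-- Equal coordinates make `F'` the pull-back of `F` along the identity, so both morphisms classify
`F'`. -/
lemma eq_of_represents {T : Scheme.{u}} {g : T ⟶ S} {x : Fin r × Fin t → Γ(T, ⊤)}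
    {hg : ⊤ ≤ g ⁻¹ᵁ D.base} {F F' : LinkedSubbundle (E.pullback g) r t}
    (hF : D.Represents F hg x) (hF' : D.Represents F' hg x) {h h' : T ⟶ LG.X}
    (H : LinkedSubbundle.IsPullback h LG.univ F) (H' : LinkedSubbundle.IsPullback h' LG.univ F') :
    h = h' := by
  have h1 : LinkedSubbundle.IsPullback (𝟙 T) F F' :=
    D.isPullback_of_represents (𝟙 T) (Category.id_comp g) hF (le_of_eq rfl) (by
      convert hF' using 2
      exact funRes_self le_top _)
  have h2 := H.trans h1
  rw [Category.id_comp] at h2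
  exact (LG.existsUnique g F').unique h2 H'

variable (hS : IsAffineOpen D.base) {C : CommRingCat.{u}} (φ : Γ(S, D.base) →+* C)
  (x : Fin r × Fin t → C)

/-- The morphism `h` to the Grassmannian corresponds to the linked subbundle generated by the
sections with coordinates `x`. -/
def IsClassifying (h : Spec C ⟶ LG.X) : Prop :=
  ∃ F : LinkedSubbundle (E.pullback (hS.specMap φ)) r t,
    D.Represents F (hS.top_le_specMap φ) (fun ij => (Scheme.ΓSpecIso C).inv.hom (x ij)) ∧
      LinkedSubbundle.IsPullback h LG.univ F

variable {D LG hS φ x}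

lemma IsClassifying.comp_p {h : Spec C ⟶ LG.X} (H : D.IsClassifying LG hS φ x h) :
    h ≫ LG.p = hS.specMap φ := H.choose_spec.2.1

lemma IsClassifying.unique {h h' : Spec C ⟶ LG.X} (H : D.IsClassifying LG hS φ x h)
    (H' : D.IsClassifying LG hS φ x h') : h = h' := by
  obtain ⟨F, hF, H⟩ := H
  obtain ⟨F', hF', H'⟩ := H'
  exact D.eq_of_represents LG hF hF' H H'

include hE in
lemma exists_isClassifying (hx : IsUnit (D.minor φ x)) : ∃ h, D.IsClassifying LG hS φ x h := by
  have h1 : IsUnit (D.minor ((hS.specMap φ).appLE D.base ⊤ (hS.top_le_specMap φ)).hom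
      ((Scheme.ΓSpecIso C).inv.hom ∘ x)) := by
    rw [hS.specMap_appLE, D.minor_map]
    exact hx.map _
  obtain ⟨F, hF⟩ := D.exists_represents hE (hS.top_le_specMap φ) _ h1
  obtain ⟨h, hh, -⟩ := LG.existsUnique _ F
  exact ⟨h, F, hF, hh⟩

-- The coordinates of a base change are the images of the coordinates. The subbundle they span over
-- `C'` is constructed first and then recognized as a pull-back.
include hE in
lemma IsClassifying.comp {C' : CommRingCat.{u}} (ψ : C →+* C') {h : Spec C ⟶ LG.X}
    (hx : IsUnit (D.minor φ x))
    (H : D.IsClassifying LG hS φ x h) :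
    D.IsClassifying LG hS (ψ.comp φ) (ψ ∘ x) (Spec.map (CommRingCat.ofHom ψ) ≫ h) := by
  obtain ⟨F, hF, H⟩ := H
  have hx' : IsUnit (D.minor (ψ.comp φ) (ψ ∘ x)) := by
    rw [D.minor_map]
    exact hx.map _
  obtain ⟨h', F', hF', -⟩ := exists_isClassifying hE (LG := LG) (hS := hS) hx'
  refine ⟨F', hF', H.trans (D.isPullback_of_represents _ (hS.specMap_comp φ ψ) hF
    (hg' := hS.top_le_specMap _) (le_of_eq rfl) ?_)⟩
  refine hF'.congr fun ij => ?_
  have h1 : (Scheme.ΓSpecIso C').inv.hom (ψ (x ij)) =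
      (Spec.map (CommRingCat.ofHom ψ)).appTop.hom ((Scheme.ΓSpecIso C).inv.hom (x ij)) :=
    ConcreteCategory.congr_hom (Scheme.ΓSpecIso_inv_naturality (CommRingCat.ofHom ψ)) (x ij)
  exact (funRes_self le_top _).trans h1.symm

include hE in
/-- The linked subbundle corresponding to a morphism to an affine open subset on which the
universal linked subbundle is generated by the sections with coordinates `v`. -/
lemma isClassifying_specMap {W : LG.X.Opens} (hW : IsAffineOpen W) (hWS : W ≤ LG.p ⁻¹ᵁ D.base)
    {y : Fin r × Fin t → Γ(LG.X, W)} (hy : D.Represents LG.univ hWS y)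
    (hy' : IsUnit (D.minor (LG.p.appLE D.base W hWS).hom y)) (ψ : Γ(LG.X, W) →+* C) :
    D.IsClassifying LG hS (ψ.comp (LG.p.appLE D.base W hWS).hom) (ψ ∘ y) (hW.specMap ψ) := by
  have hx' : IsUnit (D.minor (ψ.comp (LG.p.appLE D.base W hWS).hom) (ψ ∘ y)) := by
    rw [D.minor_map]
    exact hy'.map _
  obtain ⟨h', F', hF', -⟩ := exists_isClassifying hE (LG := LG) (hS := hS) hx'
  refine ⟨F', hF', D.isPullback_of_represents _ (hW.specMap_comp_right hS LG.p hWS ψ) hy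
    (hg' := hS.top_le_specMap _) (hW.top_le_specMap ψ) ?_⟩
  refine hF'.congr fun ij => ?_
  rw [hW.specMap_appLE]
  rfl

lemma IsClassifying.exists_comp_eq_iff {m : V → ℤ} {ω : LinkedAlternatingForm E s m}
    (LAG : PrelinkedAlternatingGrassmannian LG ω) {h : Spec C ⟶ LG.X}
    (H : D.IsClassifying LG hS φ x h) :
    (∃ k : Spec C ⟶ LAG.Y, k ≫ LAG.i = h) ↔ ∀ i j, i < j → D.formValue ω φ x i j = 0 := by
  obtain ⟨F, hF, H⟩ := H
  rw [LAG.factors_iff _ F h H, D.isIsotropic_iff ω _ hF, hS.specMap_appLE]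
  refine forall₃_congr fun i j _ => ?_
  have h1 := D.formValue_map ω φ x (Scheme.ΓSpecIso C).inv.hom i j
  have h2 : Function.Injective (Scheme.ΓSpecIso C).inv.hom :=
    (ConcreteCategory.bijective_of_isIso (Scheme.ΓSpecIso C).inv).1
  exact (iff_of_eq (congrArg (· = 0) h1)).trans (map_eq_zero_iff _ h2)

end Grassmannian

end FramedChart

end

section

/-! ### Ranks and minors over a field -/

section LinearAlgebra

variable {K : Type*} [CommRing K] {r t : ℕ}

/-- The kernel lies in the image of a space of dimension `t - r`, so by rank-nullity the rank of `N`
is at least `r`. The hypothesis `IsField` suits global functions on the spectrum of a residue field,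
which form a field only up to isomorphism. -/
lemma vecMul_injective_of_ker_le (hK : IsField K) (hrt : r ≤ t) (N : Matrix (Fin r) (Fin t) K)
    (P : Matrix (Fin t) (Fin (t - r)) K) (h : ∀ l, N.mulVec l = 0 → ∃ c, P.mulVec c = l) :
    Function.Injective fun y => Matrix.vecMul y N := by
  let := hK.toField
  have h1 : LinearMap.ker N.mulVecLin ≤ LinearMap.range P.mulVecLin := fun l hl => h l hl
  have h2 := LinearMap.finrank_range_add_finrank_ker N.mulVecLin
  have h3 := Submodule.finrank_mono h1
  have h4 := LinearMap.finrank_range_le P.mulVecLin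
  simp only [Module.finrank_fin_fun] at h2 h4
  have h5 : N.rank = r := le_antisymm (by simpa using N.rank_le_height) (by
    rw [Matrix.rank]
    omega)
  have h6 : LinearIndependent K N.row := by
    rw [linearIndependent_iff_card_eq_finrank_span, Set.finrank, ← Matrix.rank_eq_finrank_span_row,
      h5, Fintype.card_fin]
  exact Matrix.vecMul_injective_iff.mpr h6

/-- The columns span the whole space, hence contain a basis; `σ` lists the chosen columns first. In
particular it forces `r ≤ t`. -/
lemma exists_isUnit_det_submatrix (hK : IsField K) (M : Matrix (Fin r) (Fin t) K)
    (h : Function.Injective fun y => Matrix.vecMul y M) :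
    ∃ σ : Fin r ⊕ Fin (t - r) ≃ Fin t, IsUnit (M.submatrix id fun i => σ (Sum.inl i)).det := by
  let := hK.toField
  have h1 : M.rank = r := by
    have h0 := linearIndependent_iff_card_eq_finrank_span.mp (Matrix.vecMul_injective_iff.mp h)
    rw [Set.finrank, ← Matrix.rank_eq_finrank_span_row, Fintype.card_fin] at h0
    exact h0.symm
  obtain ⟨κ, a, ha, hs, hl⟩ := exists_linearIndependent' K M.col
  have h2 : Submodule.span K (Set.range M.col) = ⊤ := by
    apply Submodule.eq_top_of_finrank_eq
    rw [← Matrix.rank_eq_finrank_span_cols, h1, Module.finrank_fin_fun]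
  rw [h2] at hs
  let b := Module.Basis.mk hl hs.ge
  have : Finite κ := Finite.of_injective a ha
  have : Fintype κ := Fintype.ofFinite κ
  have h3 : Fintype.card κ = r := by
    rw [← Module.finrank_eq_card_basis b, Module.finrank_fin_fun]
  let e : Fin r ≃ κ := (Fintype.equivFinOfCardEq h3).symm
  let f : Fin r → Fin t := a ∘ e
  have hf : Function.Injective f := ha.comp e.injective
  have h4 : Fintype.card {k // k ∉ Set.range f} = t - r := by
    classical
    have : Fintype.card {k // k ∈ Set.range f} = r := by
      rw [← Fintype.card_congr (Equiv.ofInjective f hf), Fintype.card_fin]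
    rw [Fintype.card_subtype_compl, this, Fintype.card_fin]
  classical
  let σ : Fin r ⊕ Fin (t - r) ≃ Fin t :=
    (Equiv.sumCongr (Equiv.ofInjective f hf) (Fintype.equivFinOfCardEq h4).symm).trans
      (Equiv.sumCompl (· ∈ Set.range f))
  refine ⟨σ, ?_⟩
  have h5 : LinearIndependent K (M.submatrix id fun i => σ (Sum.inl i)).col :=
    hl.comp e e.injective
  rw [Matrix.linearIndependent_cols_iff_isUnit] at h5
  exact (Matrix.isUnit_iff_isUnit_det _).mp h5

/-- Independent vectors are nonzero, so the scalars are nonzero and can be divided out. This is how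
unknown powers of `s` are disposed of. -/
lemma vecMul_injective_of_smul_rows (hK : IsField K) {M M' : Matrix (Fin r) (Fin t) K}
    (c : Fin r → K) (hM : ∀ i, M' i = c i • M i) (h : Function.Injective fun y => Matrix.vecMul y M') :
    Function.Injective fun y => Matrix.vecMul y M := by
  let := hK.toField
  have h1 : LinearIndependent K M'.row := Matrix.vecMul_injective_iff.mp h
  refine Matrix.vecMul_injective_iff.mpr ?_
  have hc (i : Fin r) : c i ≠ 0 := fun hc => h1.ne_zero i (by
    change M' i = 0
    rw [hM, hc, zero_smul])
  have h2 : (M'.row : Fin r → Fin t → K) = fun i => Units.mk0 (c i) (hc i) • M.row i :=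
    funext fun i => hM i
  rw [h2] at h1
  exact (LinearIndependent.units_smul_iff (v := M.row) (w := fun i => Units.mk0 (c i) (hc i))).mp h1

end LinearAlgebra

/-! ### Values of functions at a point -/

section ResidueField

variable {X : Scheme.{u}} (ξ : X)

lemma isField_residueField : IsField Γ(Spec (X.residueField ξ), ⊤) :=
  MulEquiv.isField (Field.toIsField (X.residueField ξ))
    (Scheme.ΓSpecIso (X.residueField ξ)).commRingCatIsoToRingEquiv.toMulEquiv

variable {ξ}

lemma top_le_fromSpecResidueField {U : X.Opens} (hU : ξ ∈ U) :
    ⊤ ≤ X.fromSpecResidueField ξ ⁻¹ᵁ U := by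
  intro x _
  change X.fromSpecResidueField ξ x ∈ U
  rwa [Scheme.fromSpecResidueField_apply]

/-- The value of a function at a point. -/
def evalAt {U : X.Opens} (hU : ξ ∈ U) : Γ(X, U) →+* Γ(Spec (X.residueField ξ), ⊤) :=
  ((X.fromSpecResidueField ξ).appLE U ⊤ (top_le_fromSpecResidueField hU)).hom

lemma evalAt_funRes {U U' : X.Opens} (hU : ξ ∈ U') (h : U' ≤ U) (a : Γ(X, U)) :
    evalAt hU (funRes h a) = evalAt (h hU) a := appLE_funRes _ _ _ _

lemma evalAt_eq {U : X.Opens} (hU : ξ ∈ U) :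
    evalAt hU = (Scheme.ΓSpecIso (X.residueField ξ)).inv.hom.comp (X.evaluation U ξ hU).hom := by
  have h1 : (X.fromSpecResidueField ξ).appLE U ⊤ (top_le_fromSpecResidueField hU) =
      X.evaluation U ξ hU ≫ (Scheme.ΓSpecIso (X.residueField ξ)).inv := by
    have h2 : ⊤ ≤ X.fromSpecStalk ξ ⁻¹ᵁ U := by
      rintro x -
      have := (X.range_fromSpecStalk (x := ξ)).le ⟨x, rfl⟩
      exact this.mem_open U.2 hU
    have h3 : (X.fromSpecStalk ξ).appLE U ⊤ h2 = X.presheaf.germ U ξ hU ≫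
        (Scheme.ΓSpecIso (X.presheaf.stalk ξ)).inv := by
      rw [Scheme.Hom.appLE, Scheme.fromSpecStalk_app hU, Category.assoc, Category.assoc,
        ← Functor.map_comp]
      exact congrArg _ ((congrArg _ ((Spec (X.presheaf.stalk ξ)).presheaf.map_id _)).trans
        (Category.comp_id _))
    have h4 := Scheme.Hom.appLE_comp_appLE (U := U) (V := ⊤) (W := ⊤) (Spec.map (X.residue ξ))
      (X.fromSpecStalk ξ) h2 le_top
    refine h4.symm.trans ?_
    rw [h3, Scheme.evaluation, Category.assoc, Category.assoc, Scheme.ΓSpecIso_inv_naturality]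
    congr 2
  exact congrArg CommRingCat.Hom.hom h1

lemma mem_basicOpen_iff_isUnit_evalAt {U : X.Opens} (hU : ξ ∈ U) (a : Γ(X, U)) :
    ξ ∈ X.basicOpen a ↔ IsUnit (evalAt hU a) := by
  rw [← X.evaluation_ne_zero_iff_mem_basicOpen ξ hU, evalAt_eq, RingHom.comp_apply,
    ← isUnit_iff_ne_zero]
  exact (isUnit_map_iff (Scheme.ΓSpecIso (X.residueField ξ)).commRingCatIsoToRingEquiv.symm _).symm

lemma exists_evalAt_eq (c : Γ(Spec (X.residueField ξ), ⊤)) :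
    ∃ (U : X.Opens) (hU : ξ ∈ U) (a : Γ(X, U)), evalAt hU a = c := by
  obtain ⟨g, hg⟩ := X.residue_surjective ξ ((Scheme.ΓSpecIso (X.residueField ξ)).hom.hom c)
  obtain ⟨U, hU, a, rfl⟩ := X.presheaf.exists_germ_eq g
  refine ⟨U, hU, a, ?_⟩
  rw [evalAt_eq, RingHom.comp_apply]
  refine (congrArg _ hg).trans ?_
  exact ConcreteCategory.congr_hom (Scheme.ΓSpecIso (X.residueField ξ)).hom_inv_id c

lemma exists_evalAt_eq_of_finite {ι : Type*} [Finite ι]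
    (c : ι → Γ(Spec (X.residueField ξ), ⊤)) {U : X.Opens} (hU : ξ ∈ U) :
    ∃ (U' : X.Opens) (_ : U' ≤ U) (hU' : ξ ∈ U') (a : ι → Γ(X, U')),
      ∀ i, evalAt hU' (a i) = c i := by
  choose U₁ h₁ a ha using fun i => exists_evalAt_eq (c i)
  have hopen : ξ ∈ U ⊓ ⨅ i, U₁ i := ⟨hU, by
    rw [TopologicalSpace.Opens.coe_iInf]
    exact Set.mem_iInter.mpr h₁⟩
  refine ⟨U ⊓ ⨅ i, U₁ i, inf_le_left, hopen,
    fun i => funRes (inf_le_right.trans (iInf_le U₁ i)) (a i), fun i => ?_⟩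
  rw [evalAt_funRes]
  exact ha i

end ResidueField

end

/-! ### Generating sections near a simple point -/

section

lemma secMap_sum_smul {X : Scheme.{u}} {M N : X.Modules} {κ ν : Type*} [Fintype κ]
    [Fintype ν] {φ : M ⟶ N} {U : X.Opens} {b : κ → Γ(M, U)} {b' : ν → Γ(N, U)}
    {C : Matrix κ ν Γ(X, U)} (h : ∀ k, secMap φ U (b k) = ∑ l, C k l • b' l) (c : κ → Γ(X, U)) :
    secMap φ U (∑ k, c k • b k) = ∑ l, Matrix.vecMul c C l • b' l := by
  simp only [map_sum, map_smul, h, Finset.smul_sum, smul_smul, Matrix.vecMul,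
    dotProduct, Finset.sum_smul]
  exact Finset.sum_comm

lemma secMap_pullback_map_sum {X T : Scheme.{u}} {M N : X.Modules} {κ ν : Type*} [Fintype κ]
    [Fintype ν] {φ : M ⟶ N} {U : X.Opens} {b : κ → Γ(M, U)} {b' : ν → Γ(N, U)}
    {C : Matrix κ ν Γ(X, U)} (h : ∀ k, secMap φ U (b k) = ∑ l, C k l • b' l) (g : T ⟶ X)
    {V : T.Opens} (hV : V ≤ g ⁻¹ᵁ U) (c : κ → Γ(T, V)) :
    secMap ((Scheme.Modules.pullback g).map φ) V (∑ k, c k • pullSec g hV (b k)) =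
      ∑ l, Matrix.vecMul c (C.map (g.appLE U V hV).hom) l • pullSec g hV (b' l) := by
  refine secMap_sum_smul (fun k => ?_) c
  rw [secMap_pullback_map, h, pullSec_sum]
  exact Finset.sum_congr rfl fun l _ => pullSec_smul _ _ _ _

lemma secMap_pullback_map_comm {X T : Scheme.{u}} (f : T ⟶ X) {F F' M M' : X.Modules}
    {α : F ⟶ F'} {a : F ⟶ M} {a' : F' ⟶ M'} {β : M ⟶ M'} (h : α ≫ a' = a ≫ β) (V : T.Opens)
    (x : Γ((Scheme.Modules.pullback f).obj F, V)) :
    secMap ((Scheme.Modules.pullback f).map a') V (secMap ((Scheme.Modules.pullback f).map α) V x) =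
      secMap ((Scheme.Modules.pullback f).map β) V
        (secMap ((Scheme.Modules.pullback f).map a) V x) := by
  rw [← secMap_comp, ← secMap_comp, ← Functor.map_comp, ← Functor.map_comp, h]

lemma IsFrame.eq_of_sum_eq {X : Scheme.{u}} {M : X.Modules} {ι : Type*} [Fintype ι]
    {b : ι → Γ(M, ⊤)} (hb : IsFrame b) {c c' : ι → Γ(X, ⊤)}
    (h : ∑ i, c i • b i = ∑ i, c' i • b i) : c = c' :=
  (hb ⊤ le_rfl).1 (by simpa using h)

lemma IsFrame.exists_sum_eq {X : Scheme.{u}} {M : X.Modules} {ι : Type*} [Fintype ι]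
    {U : X.Opens} {b : ι → Γ(M, U)} (hb : IsFrame b) (x : Γ(M, U)) :
    ∃ c : ι → Γ(X, U), ∑ i, c i • b i = x := by
  obtain ⟨c, hc⟩ := (hb U le_rfl).2 x
  exact ⟨c, by simpa using hc⟩

lemma IsFrame.vecMul_injective_of_linearIndependent {X : Scheme.{u}} {M : X.Modules}
    {ι κ : Type*} [Fintype ι] [Fintype κ] {b : ι → Γ(M, ⊤)} {x : κ → Γ(M, ⊤)}
    (hx : LinearIndependent Γ(X, ⊤) x) {C : Matrix κ ι Γ(X, ⊤)}
    (h : ∀ k, ∑ i, C k i • b i = x k) : Function.Injective fun y => Matrix.vecMul y C := by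
  intro y y' hy
  have h1 (y : κ → Γ(X, ⊤)) : ∑ i, Matrix.vecMul y C i • b i = ∑ k, y k • x k := by
    simp only [← h, Matrix.vecMul, dotProduct, Finset.sum_smul, Finset.smul_sum, smul_smul]
    exact Finset.sum_comm
  have h2 : ∑ k, y k • x k = ∑ k, y' k • x k := by
    rw [← h1, ← h1]
    exact congrArg (fun c : ι → Γ(X, ⊤) => ∑ i, c i • b i) hy
  exact hx.fintypeLinearCombination_injective h2

variable {V : Type v} [Fintype V] {A : TreeData V} {S : Scheme.{u}}

namespace FramedChart

variable {E : LinkedData A S} {r t : ℕ} (D : FramedChart E r t) {s : Γ(S, ⊤)}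
  {X : Scheme.{u}} {p : X ⟶ S} {F : LinkedSubbundle (E.pullback p) r t}

lemma secMap_pathMap_pullSec {W : X.Opens} (hW : W ≤ p ⁻¹ᵁ D.base) {u u' : A.Vert}
    (P : Quiver.Path u u') (k : Fin t) :
    secMap ((Scheme.Modules.pullback p).map (E.pathMap P)) W (pullSec p hW (D.frame u k)) =
      ∑ l, (D.pathMatrix P).map (p.appLE D.base W hW).hom k l • pullSec p hW (D.frame u' l) := by
  rw [secMap_pullback_map, secMap_pathMap_frame, pullSec_sum]
  exact Finset.sum_congr rfl fun l _ => pullSec_smul _ _ _ _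

/-- Simplicity gives paths along which the images of the `y i` are independent in the fibre of `F`,
and this fibre injects into that of `E_u`. Each image is a multiple of the row for the shortest
path, so these rows are independent as well. -/
lemma vecMul_rows_injective (hrt : r < t) (hE : IsPrelinked E s t) {ξ : X}
    {y : ∀ i, Γ((F.toLinkedData.pullback (X.fromSpecResidueField ξ)).obj (D.w i), ⊤)}
    (hy : (F.toLinkedData.pullback (X.fromSpecResidueField ξ)).Generates D.w y)
    {W : X.Opens} (hξ : ξ ∈ W) (hW : W ≤ p ⁻¹ᵁ D.base)
    {a : ∀ u, Fin r → Γ((F.sub u : X.Modules), W)} (ha : ∀ u, IsFrame (a u))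
    {q : ∀ u, Fin (t - r) → Γ(cokernel (F.sub u).arrow, W)} (hq : ∀ u, IsFrame (q u))
    (N : A.Vert → Matrix (Fin r) (Fin t) Γ(X, W))
    (hN : ∀ u i, secMap (F.sub u).arrow W (a u i) = (∑ l, N u i l • pullSec p hW (D.frame u l) :
      Γ((Scheme.Modules.pullback p).obj (E.obj u), W)))
    (Y : Matrix (Fin r) (Fin r) Γ(Spec (X.residueField ξ), ⊤))
    (hY : ∀ i, (∑ k, Y i k • pullSec (X.fromSpecResidueField ξ) (top_le_fromSpecResidueField hξ)
      (a (D.w i) k) : Γ((Scheme.Modules.pullback (X.fromSpecResidueField ξ)).obj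
        (F.sub (D.w i) : X.Modules), ⊤)) = y i) (u : A.Vert) :
    Function.Injective fun c => Matrix.vecMul c (D.rows ((evalAt hξ).comp (p.appLE D.base W hW).hom)
      (fun ik => Matrix.vecMul (Y ik.1) ((N (D.w ik.1)).map (evalAt hξ)) ik.2) u) := by
  have hf := top_le_fromSpecResidueField hξ
  let f := X.fromSpecResidueField ξ
  have hK := isField_residueField ξ
  -- The fibre of the inclusion is injective by a dimension count: the cokernel has a frame of `t -
  -- r` sections and pull-back is right exact.
  have hNu : Function.Injective fun c => Matrix.vecMul c ((N u).map (evalAt hξ)) := by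
    obtain ⟨P, hP⟩ := exists_matrix_of_isFrame_quotient
      (f := (Scheme.Modules.pullback f).map (F.sub u).arrow)
      (π := (Scheme.Modules.pullback f).map (cokernel.π (F.sub u).arrow))
      (fun φ hφ => exists_desc_pullback f _ φ hφ)
      (((D.isFrame u).pullSec p hW).pullSec f hf) ((ha u).pullSec f hf)
      ((N u).map (evalAt hξ)) (fun i => by
        rw [secMap_pullback_map, hN]
        refine (pullSec_sum _ _ _ _).trans ?_
        exact Finset.sum_congr rfl fun l _ => pullSec_smul _ _ _ _) ((hq u).pullSec f hf)
    exact vecMul_injective_of_ker_le hK hrt.le _ P hP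
  obtain ⟨P, hP, -⟩ := hy u
  let z (i : Fin r) : Γ((Scheme.Modules.pullback f).obj (F.sub u : X.Modules), ⊤) :=
    secMap ((F.toLinkedData.pullback f).pathMap (P i)) ⊤ (y i)
  replace hP : LinearIndependent Γ(Spec (X.residueField ξ), ⊤) z := hP
  choose Z hZ using fun i => ((ha u).pullSec f hf).exists_sum_eq (z i)
  have hZi := IsFrame.vecMul_injective_of_linearIndependent (C := Matrix.of Z) hP hZ
  choose c hc using fun i => D.exists_vecMul_path_cons hE
    ((evalAt hξ).comp (p.appLE D.base W hW).hom)
    (fun ik => Matrix.vecMul (Y ik.1) ((N (D.w ik.1)).map (evalAt hξ)) ik.2) i (P i)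
  refine vecMul_injective_of_smul_rows hK (M' := Matrix.of Z * (N u).map (evalAt hξ)) c
    (fun i => ?_) (by
      have := hNu.comp hZi
      convert this using 2 with b
      simp [Matrix.vecMul_vecMul])
  rw [← hc i]
  refine (((D.isFrame u).pullSec p hW).pullSec f hf).eq_of_sum_eq ?_
  have h1 : secMap ((Scheme.Modules.pullback f).map (F.sub u).arrow) ⊤ (z i) =
      ∑ l, (Matrix.of Z * (N u).map (evalAt hξ)) i l •
        pullSec f hf (pullSec p hW (D.frame u l)) := by
    rw [← hZ i]
    exact secMap_pullback_map_sum (hN u) f hf (Z i)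
  have h2 : (F.toLinkedData.pathMap (P i) : (F.sub (D.w i) : X.Modules) ⟶ F.sub u) ≫
      (F.sub u).arrow = (F.sub (D.w i)).arrow ≫ (Scheme.Modules.pullback p).map (E.pathMap (P i)) :=
    (F.pathMap_arrow (P i)).trans
      (congrArg (fun g => (F.sub (D.w i)).arrow ≫ g) (E.pullback_pathMap p (P i)))
  have h3 : z i = secMap ((Scheme.Modules.pullback f).map
        (F.toLinkedData.pathMap (P i) : (F.sub (D.w i) : X.Modules) ⟶ F.sub u)) ⊤ (y i) := by
    simp only [z, LinkedData.pullback_pathMap]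
    rfl
  refine h1.symm.trans ((congrArg _ h3).trans
    ((secMap_pullback_map_comm f h2 ⊤ (y i)).trans ?_))
  rw [← hY i]
  refine (congrArg _ (secMap_pullback_map_sum (hN (D.w i)) f hf (Y i))).trans ?_
  refine (secMap_pullback_map_sum (C := (D.pathMatrix (P i)).map (p.appLE D.base W hW).hom)
    (b' := fun l => pullSec p hW (D.frame u l)) (fun k => D.secMap_pathMap_pullSec hW (P i) k)
    f hf _).trans ?_
  rw [Matrix.map_map]
  rfl

variable (F) in
/-- The inclusion of a linked subbundle of the pull-back of `E`. -/
def incl (u : A.Vert) : (F.sub u : X.Modules) ⟶ (Scheme.Modules.pullback p).obj (E.obj u) :=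
  (F.sub u).arrow

variable (F) in
lemma exists_pathMap_incl {u u' : A.Vert} (P : Quiver.Path u u') :
    ∃ f : (F.sub u : X.Modules) ⟶ F.sub u',
      f ≫ incl F u' = incl F u ≫ (Scheme.Modules.pullback p).map (E.pathMap P) :=
  ⟨F.toLinkedData.pathMap P, (F.pathMap_arrow P).trans
    (congrArg (fun g => (F.sub u).arrow ≫ g) (E.pullback_pathMap p P))⟩

/-- The rows are images of sections of `F`, hence combinations of the frame of `F_u`, with a matrix
`B`. A minor of the rows is `det B` times a minor of `N u`; as it is invertible, so is `det B`, and
the rows give a frame of `F_u`. -/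
lemma represents_of_isFrame {W : X.Opens} (hWS : W ≤ p ⁻¹ᵁ D.base)
    {a : ∀ u, Fin r → Γ((F.sub u : X.Modules), W)} (ha : ∀ u, IsFrame (a u))
    {N : A.Vert → Matrix (Fin r) (Fin t) Γ(X, W)}
    (hN : ∀ u k, secMap (incl F u) W (a u k) = ∑ l, N u k l • pullSec p hWS (D.frame u l))
    (Y : Matrix (Fin r) (Fin r) Γ(X, W)) (x : Fin r × Fin t → Γ(X, W))
    (hx : ∀ i k, x (i, k) = Matrix.vecMul (Y i) (N (D.w i)) k)
    (h : IsUnit (D.minor (p.appLE D.base W hWS).hom x)) : D.Represents F hWS x := by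
  intro u
  choose f hf using fun i => exists_pathMap_incl F (D.path i u)
  let g (i : Fin r) : Γ((F.sub u : X.Modules), W) := secMap (f i) W (∑ k, Y i k • a (D.w i) k)
  have hg (i : Fin r) : secMap (incl F u) W (g i) =
      D.combination hWS u (D.rows (p.appLE D.base W hWS).hom x u i) := by
    have h3 : secMap (incl F (D.w i)) W (∑ k, Y i k • a (D.w i) k) =
        D.combination hWS (D.w i) fun k => x (i, k) := by
      rw [secMap_sum_smul (hN (D.w i)), combination]
      simp only [hx]
    have h4 := congrArg (fun f => secMap f W (∑ k, Y i k • a (D.w i) k)) (hf i)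
    simp only [secMap_comp] at h4
    rw [h3, secMap_pathMap_combination] at h4
    exact h4
  choose B hB using fun i => (ha u).exists_sum_eq (g i)
  have hBN : D.rows (p.appLE D.base W hWS).hom x u = Matrix.of B * N u := by
    ext i l
    refine congrFun ((((D.isFrame u).pullSec p hWS) W le_rfl).1 ?_) l
    simp only [secRes_self]
    refine (hg i).symm.trans ?_
    rw [← hB i, secMap_sum_smul (hN u)]
    rfl
  refine ⟨g, (ha u).of_isUnit_det (Matrix.of B) ?_ fun i => (hB i).symm, hg⟩
  have h1 : IsUnit ((D.rows (p.appLE D.base W hWS).hom x u).submatrix id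
      fun i => D.split u (Sum.inl i)).det :=
    isUnit_of_dvd_unit (Finset.dvd_prod_of_mem (fun u => ((D.rows (p.appLE D.base W hWS).hom
      x u).submatrix id fun i => D.split u (Sum.inl i)).det) (Finset.mem_univ u)) h
  have h2 : ((D.rows (p.appLE D.base W hWS).hom x u).submatrix id
      fun i => D.split u (Sum.inl i)) =
      Matrix.of B * (N u).submatrix id fun i => D.split u (Sum.inl i) := by
    rw [hBN]
    rfl
  rw [h2, Matrix.det_mul] at h1
  exact isUnit_of_mul_isUnit_left h1

variable (F) in
/-- The chart may be chosen in such a way that near a point the linked subbundle is generated by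
sections with values at this point which generate it. -/
lemma exists_represents_near (hrt : r < t) (hE : IsPrelinked E s t) {ξ : X} (hξ : p ξ ∈ D.base)
    {y : ∀ i, Γ((F.toLinkedData.pullback (X.fromSpecResidueField ξ)).obj (D.w i), ⊤)}
    (hy : (F.toLinkedData.pullback (X.fromSpecResidueField ξ)).Generates D.w y) :
    ∃ (σ : A.Vert → (Fin r ⊕ Fin (t - r) ≃ Fin t)) (W : X.Opens) (hWS : W ≤ p ⁻¹ᵁ D.base)
      (x : Fin r × Fin t → Γ(X, W)), IsAffineOpen W ∧ ξ ∈ W ∧ D.Represents F hWS x ∧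
      IsUnit (FramedChart.minor { D with split := σ } (p.appLE D.base W hWS).hom x) := by
  choose U₁ b₁ hξ₁ hb₁ using fun u => (F.isVectorBundle_sub u).exists_isFrame ξ
  choose U₂ b₂ hξ₂ hb₂ using fun u => (F.isVectorBundle_quot u).exists_isFrame ξ
  let W₁ : X.Opens := p ⁻¹ᵁ D.base ⊓ ((⨅ u, U₁ u) ⊓ ⨅ u, U₂ u)
  have hξW₁ : ξ ∈ W₁ := by
    refine ⟨hξ, ?_, ?_⟩
    all_goals rw [TopologicalSpace.Opens.coe_iInf]
    exacts [Set.mem_iInter.mpr hξ₁, Set.mem_iInter.mpr hξ₂]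
  have hb₁' (u : A.Vert) := (hb₁ u).secRes ((inf_le_right.trans inf_le_left).trans (iInf_le U₁ u) :
    W₁ ≤ U₁ u)
  choose Y hY using fun i => ((hb₁' (D.w i)).pullSec (X.fromSpecResidueField ξ)
    (top_le_fromSpecResidueField hξW₁)).exists_sum_eq (y i)
  -- The coordinates of the vectors `y i` in the frames of `F` are lifted from the residue field to
  -- functions; this extends the vectors to sections near `ξ`.
  obtain ⟨W, hW, hξW, Y', hY'⟩ := exists_evalAt_eq_of_finite
    (fun ik : Fin r × Fin r => Y ik.1 ik.2) hξW₁
  have hWS : W ≤ p ⁻¹ᵁ D.base := hW.trans inf_le_left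
  let a (u : A.Vert) (i : Fin r) : Γ((F.sub u : X.Modules), W) :=
    secRes (hW.trans ((inf_le_right.trans inf_le_left).trans (iInf_le U₁ u))) (b₁ u i)
  have ha (u : A.Vert) : IsFrame (a u) := (hb₁ u).secRes _
  have hq (u : A.Vert) := (hb₂ u).secRes
    (hW.trans ((inf_le_right.trans inf_le_right).trans (iInf_le U₂ u)) : W ≤ U₂ u)
  choose N hN using fun u i => ((D.isFrame u).pullSec p hWS).exists_sum_eq
    (secMap (F.sub u).arrow W (a u i))
  let x : Fin r × Fin t → Γ(X, W) := fun ik =>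
    Matrix.vecMul (fun j => Y' (ik.1, j)) (N (D.w ik.1)) ik.2
  let φ := (p.appLE D.base W hWS).hom
  have hrows (u : A.Vert) : Function.Injective fun c =>
      Matrix.vecMul c (D.rows ((evalAt hξW).comp φ) (evalAt hξW ∘ x) u) := by
    have := D.vecMul_rows_injective hrt hE hy hξW hWS ha hq N (fun u i => (hN u i).symm)
      Y (fun i => ?_) u
    · convert this using 5 with c ik
      simp [x, Matrix.vecMul, dotProduct, hY']
      rfl
    · rw [← hY i]
      refine Finset.sum_congr rfl fun k _ => ?_
      congr 1
      exact (pullSec_secRes _ _ _ _).trans (pullSec_secRes _ _ _ _).symm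
  -- The columns of the minors are chosen only now, according to the ranks at `ξ`; the minors then
  -- stay invertible near `ξ`.
  choose σ hσ using fun u => exists_isUnit_det_submatrix (isField_residueField ξ) _ (hrows u)
  let D' : FramedChart E r t := { D with split := σ }
  have hres (c : Γ(X, W)) {W' : X.Opens} (hW' : W' ≤ X.basicOpen c) :
      IsUnit (funRes (hW'.trans (X.basicOpen_le c)) c) := by
    have := (RingedSpace.isUnit_res_basicOpen _ c).map (funRes hW')
    exact (congrArg IsUnit (funRes_funRes (X.basicOpen_le c) hW' c)).mp this
  have hmin : IsUnit (evalAt hξW (D'.minor φ x)) := by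
    rw [← D'.minor_map]
    exact IsUnit.prod_univ_iff.mpr hσ
  have hmem := (mem_basicOpen_iff_isUnit_evalAt hξW (D'.minor φ x)).mpr hmin
  obtain ⟨W', hW'a, hξW', hW'⟩ := exists_isAffineOpen_mem_and_subset hmem
  replace hW' : W' ≤ X.basicOpen (D'.minor φ x) := hW'
  have hW'W : W' ≤ W := hW'.trans (X.basicOpen_le _)
  have hφ : (p.appLE D.base W' (hW'W.trans hWS)).hom = (funRes hW'W).comp φ :=
    RingHom.ext fun c => (funRes_appLE p hWS hW'W c).symm
  have hunit : IsUnit (D'.minor (p.appLE D.base W' (hW'W.trans hWS)).hom (funRes hW'W ∘ x)) := by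
    rw [hφ, D'.minor_map]
    exact hres _ hW'
  refine ⟨σ, W', hW'W.trans hWS, funRes hW'W ∘ x, hW'a, hξW', ?_, hunit⟩
  refine represents_of_isFrame D' (hW'W.trans hWS) (a := fun u i => secRes hW'W (a u i))
    (fun u => (ha u).secRes hW'W) (N := fun u => Matrix.of fun k l => funRes hW'W (N u k l))
    (fun u k => ?_) (Matrix.of fun i k => funRes hW'W (Y' (i, k))) _ (fun i k => ?_) hunit
  · rw [secMap_secRes]
    refine (congrArg (secRes hW'W) (hN u k).symm).trans ?_
    refine (secRes_sum _ _ _).trans (Finset.sum_congr rfl fun l _ => ?_)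
    refine (secRes_smul _ _ _).trans ?_
    exact congrArg (fun x => _ • x) (secRes_pullSec _ _ _ _)
  · simp only [Function.comp_apply, x, Matrix.vecMul, dotProduct, map_sum, map_mul]
    rfl

end FramedChart

end

/-! ### The ideal of the alternating Grassmannian -/

section

/-- The pairs `i < j` of elements of `Fin r`. -/
abbrev OrderedPair (r : ℕ) : Type := {ij : Fin r × Fin r // ij.1 < ij.2}

lemma card_orderedPair (r : ℕ) : Fintype.card (OrderedPair r) = r.choose 2 := by
  let e : OrderedPair r ≃ Σ j : Fin r, Fin j :=
    { toFun := fun ij => ⟨ij.1.2, ⟨ij.1.1, ij.2⟩⟩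
      invFun := fun ji => ⟨(⟨ji.2, ji.2.2.trans ji.1.2⟩, ji.1), ji.2.2⟩
      left_inv := fun _ => rfl
      right_inv := fun _ => rfl }
  rw [Fintype.card_congr e, Fintype.card_sigma]
  simp only [Fintype.card_fin]
  rw [Fin.sum_univ_eq_sum_range (fun j => j), Finset.sum_range_id, Nat.choose_two_right]

variable {V : Type v} [Fintype V] {A : TreeData V} {S : Scheme.{u}}
  {E : LinkedData A S} {r t : ℕ} {s : Γ(S, ⊤)}

lemma exists_framedChart (hrt : r < t) (hE : IsPrelinked E s t) {X : Scheme.{u}} {p : X ⟶ S}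
    (F : LinkedSubbundle (E.pullback p) r t) {ξ : X} {w : Fin r → A.Vert}
    {y : ∀ i, Γ((F.toLinkedData.pullback (X.fromSpecResidueField ξ)).obj (w i), ⊤)}
    (hy : (F.toLinkedData.pullback (X.fromSpecResidueField ξ)).Generates w y) :
    ∃ D : FramedChart E r t, IsAffineOpen D.base ∧ D.w = w ∧
      ∃ (W : X.Opens) (hWS : W ≤ p ⁻¹ᵁ D.base) (x : Fin r × Fin t → Γ(X, W)),
        IsAffineOpen W ∧ ξ ∈ W ∧ D.Represents F hWS x ∧
          IsUnit (D.minor (p.appLE D.base W hWS).hom x) := by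
  choose U b hξ hb using fun u => (hE.isVectorBundle u).exists_isFrame (p ξ)
  have hU : p ξ ∈ ⨅ u, U u := by
    change p ξ ∈ ((⨅ u, U u : S.Opens) : Set S)
    rw [TopologicalSpace.Opens.coe_iInf]
    exact Set.mem_iInter.mpr hξ
  obtain ⟨S₀, hS₀, hξS₀, hS₀U⟩ := exists_isAffineOpen_mem_and_subset hU
  replace hS₀U (u : A.Vert) : S₀ ≤ U u := le_trans hS₀U (iInf_le U u)
  have hpath (i : Fin r) (u : A.Vert) : ∃ P : Quiver.Path (w i) u,
      ∀ P' : Quiver.Path (w i) u, P.length ≤ P'.length := by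
    obtain ⟨P, -⟩ := hy u
    have : Nonempty (Quiver.Path (w i) u) := ⟨P i⟩
    obtain ⟨Q, hQ⟩ := exists_minimal_of_wellFoundedLT (α := ℕ)
      (fun n => ∃ Q : Quiver.Path (w i) u, Q.length = n) ⟨_, P i, rfl⟩
    obtain ⟨P₀, hP₀⟩ := hQ.prop
    exact ⟨P₀, fun P' => hP₀ ▸ (not_lt.mp fun h => hQ.not_lt ⟨P', rfl⟩ h)⟩
  choose Q hQ using hpath
  let D : FramedChart E r t :=
    { base := S₀
      frame := fun u i => secRes (hS₀U u) (b u i)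
      isFrame := fun u => (hb u).secRes _
      w := w
      path := Q
      length_path_le := hQ
      -- A provisional splitting, replaced below by one adapted to the point.
      split := fun _ => finSumFinEquiv.trans (finCongr (by omega)) }
  obtain ⟨σ, W, hWS, x, hW, hξW, hx, hx'⟩ := D.exists_represents_near F hrt hE hξS₀ hy
  exact ⟨{ D with split := σ }, hS₀, rfl, W, hWS, x, hW, hξW, hx, hx'⟩

namespace FramedChart

variable {D : FramedChart E r t} {LG : PrelinkedGrassmannian E r t} {m : V → ℤ}
  {ω : LinkedAlternatingForm E s m}

/-- The ideal of the alternating Grassmannian in an affine open subset on which the universal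
linked subbundle is generated by sections with coordinates `x`. -/
lemma ker_app_eq_span (hE : IsPrelinked E s t) (LAG : PrelinkedAlternatingGrassmannian LG ω)
    (hS : IsAffineOpen D.base)
    {W : LG.X.Opens} (hW : IsAffineOpen W) (hWS : W ≤ LG.p ⁻¹ᵁ D.base)
    {x : Fin r × Fin t → Γ(LG.X, W)} (hx : D.Represents LG.univ hWS x)
    (hx' : IsUnit (D.minor (LG.p.appLE D.base W hWS).hom x)) :
    RingHom.ker (LAG.i.app W).hom = Ideal.span (Set.range fun ij : OrderedPair r =>
      D.formValue ω (LG.p.appLE D.base W hWS).hom x ij.1.1 ij.1.2) := by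
  have := LAG.isClosedImmersion
  -- Both conditions say that the `C`-valued point given by `ψ` lies in LAG. Taking for `C` the
  -- quotients by the two ideals yields the two inclusions.
  have key {C : CommRingCat.{u}} (ψ : Γ(LG.X, W) →+* C) :
      RingHom.ker (LAG.i.app W).hom ≤ RingHom.ker ψ ↔ ∀ i j, i < j →
        ψ (D.formValue ω (LG.p.appLE D.base W hWS).hom x i j) = 0 := by
    rw [← exists_comp_eq_specMap_iff hW LAG.i ψ,
      (isClassifying_specMap hE (LG := LG) (hS := hS) hW hWS hx hx' ψ).exists_comp_eq_iff LAG]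
    simp only [D.formValue_map]
  apply le_antisymm
  · have h1 := (key (C := CommRingCat.of (Γ(LG.X, W) ⧸ Ideal.span (Set.range
      fun ij : OrderedPair r => D.formValue ω (LG.p.appLE D.base W hWS).hom x ij.1.1 ij.1.2)))
      (Ideal.Quotient.mk _)).mpr fun i j hij => Ideal.Quotient.eq_zero_iff_mem.mpr
        (Ideal.subset_span ⟨⟨(i, j), hij⟩, rfl⟩)
    exact h1.trans Ideal.mk_ker.le
  · rw [Ideal.span_le]
    rintro - ⟨ij, rfl⟩
    have h1 := (key (C := CommRingCat.of (Γ(LG.X, W) ⧸ RingHom.ker (LAG.i.app W).hom))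
      (Ideal.Quotient.mk _)).mp Ideal.mk_ker.ge _ _ ij.2
    exact Ideal.Quotient.eq_zero_iff_mem.mp h1

end FramedChart

lemma isLocallyCutOutBy (hrt : r < t) (hE : IsPrelinked E s t) {m : V → ℤ}
    {ω : LinkedAlternatingForm E s m} {LG : PrelinkedGrassmannian E r t}
    (LAG : PrelinkedAlternatingGrassmannian LG ω) (z : LAG.Y)
    (hz : LG.univ.toLinkedData.IsSimpleAt r (LAG.i z)) :
    IsLocallyCutOutBy LAG.i z (r.choose 2) := by
  obtain ⟨w, y, hy⟩ := hz
  obtain ⟨D, hS, -, W, hWS, x, hW, hzW, hx, hx'⟩ := exists_framedChart hrt hE LG.univ hy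
  refine ⟨W, hW, hzW, fun k => D.formValue ω (LG.p.appLE D.base W hWS).hom x
    ((Fintype.equivFinOfCardEq (card_orderedPair r)).symm k).1.1
    ((Fintype.equivFinOfCardEq (card_orderedPair r)).symm k).1.2, ?_⟩
  rw [FramedChart.ker_app_eq_span hE LAG hS hW hWS hx hx']
  exact congrArg _ ((Fintype.equivFinOfCardEq (card_orderedPair r)).symm.surjective.range_comp _).symm

end

section

/-! ### Coordinates on smooth algebras -/

section Algebra

open Algebra KaehlerDifferential TensorProduct

/-- The variables with no relations form a submersive presentation, the Jacobian being an empty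
determinant. -/
lemma isStandardSmoothOfRelativeDimension_mvPolynomial (A ι : Type*) [CommRing A] [Finite ι] :
    IsStandardSmoothOfRelativeDimension (Nat.card ι) A (MvPolynomial ι A) := by
  have h : Function.Surjective (MvPolynomial.aeval (R := A) (MvPolynomial.X : ι → MvPolynomial ι A)) :=
    fun x => ⟨x, by simp⟩
  let P : PreSubmersivePresentation A (MvPolynomial ι A) ι PEmpty.{1} :=
    { toGenerators := .ofSurjective MvPolynomial.X h
      relation := PEmpty.elim
      span_range_relation_eq_ker := by
        rw [Set.range_eq_empty, Ideal.span_empty]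
        refine ((RingHom.injective_iff_ker_eq_bot _).mp ?_).symm
        change Function.Injective (MvPolynomial.aeval MvPolynomial.X)
        rw [MvPolynomial.aeval_X_left]
        exact Function.injective_id
      map := PEmpty.elim
      map_inj := fun x => x.elim }
  let P' : SubmersivePresentation A (MvPolynomial ι A) ι PEmpty.{1} :=
    { __ := P
      jacobian_isUnit := by
        classical
        rw [PreSubmersivePresentation.jacobian_eq_jacobiMatrix_det, Matrix.det_isEmpty, map_one]
        exact isUnit_one }
  exact P'.isStandardSmoothOfRelativeDimension (by simp [Presentation.dimension])

variable {A S : Type*} [CommRing A] [CommRing S] [Algebra A S]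

/-- Functions whose differentials form a basis define an étale morphism to affine space. -/
lemma etale_of_basis_kaehlerDifferential [FinitePresentation A S] [Subsingleton (H1Cotangent A S)]
    {ι : Type*} [Finite ι] [Algebra (MvPolynomial ι A) S] [IsScalarTower A (MvPolynomial ι A) S]
    (b : Module.Basis ι S Ω[S⁄A])
    (hb : ∀ i, b i = D A S (algebraMap (MvPolynomial ι A) S (MvPolynomial.X i))) :
    Etale (MvPolynomial ι A) S := by
  let b' : Module.Basis ι S (S ⊗[MvPolynomial ι A] Ω[MvPolynomial ι A⁄A]) :=
    (mvPolynomialBasis A ι).baseChange S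
  -- The map carries the basis of differentials of the variables to the basis `b`.
  have hbij : Function.Bijective (mapBaseChange A (MvPolynomial ι A) S) := by
    have h : mapBaseChange A (MvPolynomial ι A) S = (b'.equiv b (Equiv.refl ι)).toLinearMap := by
      refine b'.ext fun i => ?_
      rw [LinearEquiv.coe_coe, b'.equiv_apply, Equiv.refl_apply, hb]
      simp [b', Module.Basis.baseChange_apply]
    rw [h]
    exact (b'.equiv b (Equiv.refl ι)).bijective
  -- In the Jacobi–Zariski sequence, surjectivity of this map kills the relative differentials.
  -- Injectivity makes the connecting map from the relative `H1Cotangent` zero, so the latter comes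
  -- from `H1Cotangent A S`, which vanishes.
  have : FormallyEtale (MvPolynomial ι A) S :=
    { subsingleton_kaehlerDifferential := by
        refine subsingleton_of_forall_eq 0 fun x => ?_
        obtain ⟨y, rfl⟩ := map_surjective A (MvPolynomial ι A) S x
        exact (exact_mapBaseChange_map A (MvPolynomial ι A) S y).mpr (hbij.2 y)
      subsingleton_h1Cotangent := by
        refine subsingleton_of_forall_eq 0 fun x => ?_
        have h : H1Cotangent.δ A (MvPolynomial ι A) S x = 0 := by
          apply hbij.1
          rw [map_zero]
          exact (H1Cotangent.exact_δ_mapBaseChange A (MvPolynomial ι A) S _).mpr ⟨x, rfl⟩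
        obtain ⟨y, rfl⟩ := (H1Cotangent.exact_map_δ A (MvPolynomial ι A) S x).mp h
        rw [Subsingleton.elim y 0, map_zero] }
  exact { finitePresentation := .of_restrict_scalars_finitePresentation A _ _ }

/-- The vanishing locus of some of the coordinates of an affine space. -/
def quotientSpanEquiv (A κ ν : Type*) [CommRing A] :
    (MvPolynomial (κ ⊕ ν) A ⧸ Ideal.span (Set.range fun k : κ =>
      (MvPolynomial.X (Sum.inl k) : MvPolynomial (κ ⊕ ν) A))) ≃ₐ[A] MvPolynomial ν A :=
  AlgEquiv.ofAlgHom
    (Ideal.Quotient.liftₐ _ (MvPolynomial.aeval (Sum.elim 0 MvPolynomial.X)) fun x hx => by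
      have h : Ideal.span (Set.range fun k : κ =>
          (MvPolynomial.X (Sum.inl k) : MvPolynomial (κ ⊕ ν) A)) ≤ RingHom.ker
          (MvPolynomial.aeval (R := A) (Sum.elim (0 : κ → MvPolynomial ν A) MvPolynomial.X)) := by
        rw [Ideal.span_le]
        rintro - ⟨k, rfl⟩
        simp
      exact h hx)
    (MvPolynomial.aeval fun j => Ideal.Quotient.mk _ (MvPolynomial.X (Sum.inr j)))
    (MvPolynomial.algHom_ext fun j => by
      rw [AlgHom.comp_apply, MvPolynomial.aeval_X]
      exact MvPolynomial.aeval_X _ (Sum.inr j))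
    (Ideal.Quotient.algHom_ext _ (MvPolynomial.algHom_ext fun i => by
      rcases i with k | j
      · have := Ideal.Quotient.eq_zero_iff_mem.mpr (Ideal.subset_span (α := MvPolynomial (κ ⊕ ν) A)
          (Set.mem_range_self (f := fun k : κ => MvPolynomial.X (Sum.inl k)) k))
        refine Eq.trans ?_ this.symm
        refine (congrArg (MvPolynomial.aeval (R := A) fun j => Ideal.Quotient.mk _
          (MvPolynomial.X (Sum.inr j))) (MvPolynomial.aeval_X _ (Sum.inl k))).trans ?_
        exact map_zero _
      · refine (congrArg (MvPolynomial.aeval (R := A) fun j => Ideal.Quotient.mk _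
          (MvPolynomial.X (Sum.inr j))) (MvPolynomial.aeval_X _ (Sum.inr j))).trans ?_
        exact MvPolynomial.aeval_X _ j))

/-- If `S` is étale over an affine space over `A`, then the vanishing locus in `S` of some of the
coordinates is étale over the affine space with the remaining coordinates. -/
lemma isStandardSmoothOfRelativeDimension_quotient {κ ν : Type*} [Finite κ] [Finite ν]
    [Algebra (MvPolynomial (κ ⊕ ν) A) S] [IsScalarTower A (MvPolynomial (κ ⊕ ν) A) S]
    [Etale (MvPolynomial (κ ⊕ ν) A) S] :
    IsStandardSmoothOfRelativeDimension (Nat.card ν) A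
      (S ⧸ Ideal.span (Set.range fun k : κ =>
        algebraMap (MvPolynomial (κ ⊕ ν) A) S (MvPolynomial.X (Sum.inl k)))) := by
  let P := MvPolynomial (κ ⊕ ν) A
  let J : Ideal P := Ideal.span (Set.range fun k : κ => MvPolynomial.X (Sum.inl k))
  have hJ : J.map (algebraMap P S) = Ideal.span (Set.range fun k : κ =>
      algebraMap P S (MvPolynomial.X (Sum.inl k))) := by
    rw [Ideal.map_span, ← Set.range_comp]
    rfl
  rw [← hJ]
  have h0 : IsStandardSmoothOfRelativeDimension 0 P S :=
    Etale.iff_isStandardSmoothOfRelativeDimension_zero.mp ‹_›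
  -- Étaleness is preserved by base change from `P` to `P ⧸ J`, which is again a polynomial ring.
  have h1 : IsStandardSmoothOfRelativeDimension 0 (P ⧸ J) (S ⧸ J.map (algebraMap P S)) :=
    .of_algEquiv (S := (P ⧸ J) ⊗[P] S) _ (Algebra.TensorProduct.quotIdealMapEquivQuotTensor S J).symm
  have h2 := isStandardSmoothOfRelativeDimension_mvPolynomial A ν
  have h3 : IsStandardSmoothOfRelativeDimension (Nat.card ν) A (P ⧸ J) :=
    .of_algEquiv _ (quotientSpanEquiv A κ ν).symm
  have : IsScalarTower A (P ⧸ J) (S ⧸ J.map (algebraMap P S)) := by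
    refine ⟨fun a x y => ?_⟩
    rw [Algebra.smul_def, Algebra.smul_def, Algebra.smul_def, Algebra.smul_def a x,
      map_mul, mul_assoc]
    exact congrArg (fun z => z * _) (congrArg (Ideal.Quotient.mk _)
      (IsScalarTower.algebraMap_apply A P S a).symm)
  have h4 : IsStandardSmoothOfRelativeDimension (0 + Nat.card ν) A (S ⧸ J.map (algebraMap P S)) :=
    IsStandardSmoothOfRelativeDimension.trans (R := A) (S := P ⧸ J) ..
  rwa [zero_add] at h4

lemma isStandardSmoothOfRelativeDimension_of_basis [FinitePresentation A S]
    [Subsingleton (H1Cotangent A S)] {κ ν : Type*} [Finite κ] [Finite ν]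
    (b : Module.Basis (κ ⊕ ν) S Ω[S⁄A]) (f : κ ⊕ ν → S) (hb : ∀ i, b i = D A S (f i)) :
    IsStandardSmoothOfRelativeDimension (Nat.card ν + Nat.card κ) A S ∧
    IsStandardSmoothOfRelativeDimension (Nat.card ν) A
      (S ⧸ Ideal.span (Set.range fun k => f (Sum.inl k))) := by
  let := (MvPolynomial.aeval (R := A) f).toRingHom.toAlgebra
  have hf (i) : algebraMap (MvPolynomial (κ ⊕ ν) A) S (MvPolynomial.X i) = f i :=
    MvPolynomial.aeval_X f i
  have : IsScalarTower A (MvPolynomial (κ ⊕ ν) A) S :=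
    .of_algebraMap_eq' (MvPolynomial.aeval (R := A) f).comp_algebraMap.symm
  have := etale_of_basis_kaehlerDifferential b fun i => (hb i).trans (congrArg _ (hf i).symm)
  refine ⟨?_, ?_⟩
  · have h0 : IsStandardSmoothOfRelativeDimension 0 (MvPolynomial (κ ⊕ ν) A) S :=
      Etale.iff_isStandardSmoothOfRelativeDimension_zero.mp ‹_›
    have h2 := isStandardSmoothOfRelativeDimension_mvPolynomial A (κ ⊕ ν)
    have h3 : IsStandardSmoothOfRelativeDimension (0 + Nat.card (κ ⊕ ν)) A S :=
      IsStandardSmoothOfRelativeDimension.trans (R := A) (S := MvPolynomial (κ ⊕ ν) A) ..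
    rwa [zero_add, Nat.card_sum, add_comm] at h3
  · have h := isStandardSmoothOfRelativeDimension_quotient (A := A) (S := S) (κ := κ) (ν := ν)
    rwa [funext fun k => hf (Sum.inl k)] at h

/-- If some functions on a standard smooth algebra have linearly independent differentials at a
point, then these functions are part of a system of coordinates near this point. -/
theorem exists_isStandardSmoothOfRelativeDimension_quotient {A R K M : Type*} [CommRing A]
    [CommRing R] [Algebra A R] [IsStandardSmooth A R] [Field K] [Algebra R K] [AddCommGroup M]
    [Module K M] [Module R M] [IsScalarTower R K M] [Module A M] [IsScalarTower A R M]
    (δ : Derivation A R M) {c : ℕ} (a : Fin c → R) (ha : LinearIndependent K fun k => δ (a k)) :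
    ∃ h : R, algebraMap R K h ≠ 0 ∧ ∃ n : ℕ, ∀ (S : Type _) [CommRing S] [Algebra R S] [Algebra A S]
      [IsScalarTower A R S] [IsLocalization.Away h S],
      IsStandardSmoothOfRelativeDimension (n + c) A S ∧
      IsStandardSmoothOfRelativeDimension n A
        (S ⧸ Ideal.span (Set.range fun k => algebraMap R S (a k))) := by
  obtain ⟨ι, τ, _, _, ⟨P⟩⟩ := IsStandardSmooth.out (R := A) (S := R)
  -- In a submersive presentation the differentials of the generators not matched with a relation
  -- form a basis.
  obtain ⟨N, ⟨e⟩⟩ := Finite.exists_equiv_fin ((Set.range P.map)ᶜ : Set _)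
  let b : Module.Basis (Fin N) R Ω[R⁄A] := P.basisKaehler.reindex e
  let g (j : Fin N) : R := P.val (e.symm j)
  have hb (j : Fin N) : b j = D A R (g j) := by simp [b, g]
  let m : Matrix (Fin c) (Fin N) R := fun k j => b.repr (D A R (a k)) j
  have hm (k : Fin c) : D A R (a k) = ∑ j, m k j • D A R (g j) := by
    conv_lhs => rw [← b.sum_repr (D A R (a k))]
    simp only [hb, m]
  have hδ (k : Fin c) : δ (a k) = ∑ j, algebraMap R K (m k j) • δ (g j) := by
    have := congrArg δ.liftKaehlerDifferential (hm k)
    simpa only [map_sum, map_smul, Derivation.liftKaehlerDifferential_comp_D,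
      algebraMap_smul] using this
  -- A relation between the rows of `m` at the point would give one between the vectors `δ (a k)`.
  have hinj : Function.Injective fun y => Matrix.vecMul y (m.map (algebraMap R K)) := by
    refine Matrix.vecMul_injective_iff.mpr (Fintype.linearIndependent_iff.mpr fun y hy => ?_)
    refine Fintype.linearIndependent_iff.mp ha y ?_
    simp only [hδ, Finset.smul_sum, smul_smul]
    rw [Finset.sum_comm]
    refine Finset.sum_eq_zero fun j _ => ?_
    rw [← Finset.sum_smul]
    have := congrFun hy j
    simp only [Finset.sum_apply, Pi.smul_apply, smul_eq_mul, Matrix.row_apply, Matrix.map_apply,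
      Pi.zero_apply] at this
    rw [this, zero_smul]
  obtain ⟨σ, hσ⟩ := exists_isUnit_det_submatrix (Field.toIsField K) _ hinj
  -- Inverting a minor of `m` which is nonzero at the point allows the `a k` to replace `c` of the
  -- `N` coordinates. The subtraction `N - c` is exact, because `σ` exists.
  refine ⟨(m.submatrix id fun k => σ (Sum.inl k)).det, ?_, N - c, ?_⟩
  · rw [RingHom.map_det]
    exact hσ.ne_zero
  intro S _ _ _ _ hS
  have := IsStandardSmooth.localization_away (S := S)
    (m.submatrix id fun k => σ (Sum.inl k)).det
  have : IsStandardSmooth A S := .trans A R S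
  have : FormallyEtale R S := .of_isLocalization
    (Submonoid.powers (m.submatrix id fun k => σ (Sum.inl k)).det)
  let bS : Module.Basis (Fin c ⊕ Fin (N - c)) S Ω[S⁄A] :=
    ((b.baseChange S).map (tensorKaehlerEquivOfFormallyEtale A R S)).reindex σ.symm
  have hbS (i) : bS i = D A S (algebraMap R S (g (σ i))) := by
    simp [bS, hb]
  let f : Fin c ⊕ Fin (N - c) → S :=
    Sum.elim (fun k => algebraMap R S (a k)) fun j => algebraMap R S (g (σ (Sum.inr j)))
  have hf : IsUnit (bS.det fun i => D A S (f i)) := by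
    -- The coordinates outside the minor are kept, so the change of basis is block triangular and
    -- its determinant is the inverted minor.
    have hM : bS.toMatrix (fun i => D A S (f i)) = Matrix.fromBlocks
        ((m.submatrix id fun k => σ (Sum.inl k)).map (algebraMap R S)).transpose 0
        ((m.submatrix id fun k => σ (Sum.inr k)).map (algebraMap R S)).transpose 1 := by
      have h1 (k : Fin c) : D A S (algebraMap R S (a k)) =
          ∑ i, algebraMap R S (m k (σ i)) • bS i := by
        have := congrArg (map A A R S) (hm k)
        rw [map_D, map_sum] at this
        rw [this, ← σ.sum_comp]
        refine Finset.sum_congr rfl fun i _ => ?_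
        rw [map_smul, map_D, hbS, algebraMap_smul]
      ext i j
      rcases j with k | j
      · rw [Module.Basis.toMatrix_apply]
        simp only [f, Sum.elim_inl, h1, bS.repr_sum_self]
        rcases i with i | i <;> rfl
      · rw [Module.Basis.toMatrix_apply]
        simp only [f, Sum.elim_inr, ← hbS, bS.repr_self]
        rcases i with i | i <;> simp [Matrix.one_apply, Finsupp.single_apply, eq_comm]
    rw [Module.Basis.det_apply, hM, Matrix.det_fromBlocks_zero₁₂, Matrix.det_one, mul_one,
      Matrix.det_transpose, ← RingHom.mapMatrix_apply, ← RingHom.map_det]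
    exact IsLocalization.Away.algebraMap_isUnit _
  obtain ⟨h1, h2⟩ := bS.is_basis_iff_det.mpr hf
  have := isStandardSmoothOfRelativeDimension_of_basis (.mk h1 h2.ge) f fun i => by simp
  rwa [Nat.card_fin, Nat.card_fin] at this

end Algebra

end

section

/-! ### Smoothness of the prelinked Grassmannian at simple points -/

section Retract

/-- A retract of a smooth algebra is smooth. -/
lemma smooth_of_retract {A B R : Type*} [CommRing A] [CommRing B] [CommRing R] [Algebra A B]
    [Algebra A R] [Algebra.Smooth A B] (i : R →ₐ[A] B) (p : B →ₐ[A] R)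
    (h : p.comp i = AlgHom.id A R) : Algebra.Smooth A R := by
  have hpi (x : R) : p (i x) = x := congr($h x)
  constructor
  · refine Algebra.FormallySmooth.of_comp_surjective fun C _ _ I hI f => ?_
    -- To lift `f` modulo `I`, lift `f ∘ p` using smoothness of `B` and restrict the lift along `i`.
    obtain ⟨g, hg⟩ := Algebra.FormallySmooth.comp_surjective A B I hI (f.comp p)
    refine ⟨g.comp i, ?_⟩
    rw [← AlgHom.comp_assoc, hg, AlgHom.comp_assoc, h, AlgHom.comp_id]
  · refine Algebra.FinitePresentation.of_surjective (f := p) (fun x => ⟨i x, hpi x⟩) ?_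
    obtain ⟨t, ht⟩ := (inferInstance : Algebra.FiniteType A B).out
    refine (Submodule.fg_def).mpr ⟨(fun b => b - i (p b)) '' t, t.finite_toSet.image _, ?_⟩
    apply le_antisymm
    · rw [Submodule.span_le]
      rintro - ⟨b, -, rfl⟩
      simp [RingHom.mem_ker, hpi]
    -- The elements with this property form a subalgebra containing the generators in `t`, hence are
    -- all of `B`; for `b` in the kernel of `p` the element in question is `b` itself.
    · have key (b : B) : b - i (p b) ∈ Ideal.span ((fun b => b - i (p b)) '' (t : Set B)) := by
        have hb : b ∈ Algebra.adjoin A (t : Set B) := ht ▸ Algebra.mem_top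
        induction hb using Algebra.adjoin_induction with
        | mem x hx => exact Ideal.subset_span ⟨x, hx, rfl⟩
        | algebraMap a => simp
        | add x y _ _ hx hy =>
          have := add_mem hx hy
          rwa [← add_sub_add_comm, ← map_add, ← map_add] at this
        | mul x y _ _ hx hy =>
          have := add_mem (Ideal.mul_mem_right y _ hx) (Ideal.mul_mem_left _ (i (p x)) hy)
          have e : (x - i (p x)) * y + i (p x) * (y - i (p y)) = x * y - i (p (x * y)) := by
            rw [map_mul, map_mul]
            ring
          rwa [e] at this
      intro b hb
      have := key b
      have hb : p b = 0 := hb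
      rwa [hb, map_zero, sub_zero] at this

/-- Geometrically, `σ` is a section from the chart to a smooth parameter space, and `π` the map back
to the chart, defined only where `g` is invertible. Inverting `π (σ g)` as well makes the two
composable, and `R` localized at `σ g` is a retract of the resulting smooth algebra. -/
lemma smooth_localizationAway_of_retraction {A B R : Type*} [CommRing A] [CommRing B] [CommRing R]
    {φ : A →+* R} {φ' : A →+* B} (hφ' : φ'.Smooth) (σ : B →+* R) (g : B)
    (π : R →+* Localization.Away g) (hπ : π.comp φ = (algebraMap B (Localization.Away g)).comp φ')
    (h : (IsLocalization.Away.map (Localization.Away g) (Localization.Away (σ g)) σ g).comp π =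
      algebraMap R (Localization.Away (σ g))) :
    ((algebraMap R (Localization.Away (σ g))).comp φ).Smooth := by
  let L := Localization.Away (π (σ g))
  let i : Localization.Away (σ g) →+* L := IsLocalization.Away.map _ L π (σ g)
  let p : L →+* Localization.Away (σ g) := IsLocalization.Away.lift (π (σ g))
    (g := IsLocalization.Away.map (Localization.Away g) (Localization.Away (σ g)) σ g) (by
      rw [← RingHom.comp_apply, h]
      exact IsLocalization.Away.algebraMap_isUnit _)
  have hi : i.comp (algebraMap R _) = (algebraMap _ L).comp π := IsLocalization.map_comp _
  have hp : p.comp (algebraMap _ L) = IsLocalization.Away.map _ _ σ g :=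
    IsLocalization.Away.lift_comp _ _
  have hpi : p.comp i = RingHom.id _ := by
    refine IsLocalization.ringHom_ext (Submonoid.powers (σ g)) ?_
    rw [RingHom.comp_assoc, hi, ← RingHom.comp_assoc, hp, h, RingHom.id_comp]
  let f : A →+* L := (algebraMap _ L).comp ((algebraMap B (Localization.Away g)).comp φ')
  have hf : f.Smooth := by
    refine RingHom.Smooth.comp (hφ'.comp (RingHom.Smooth.holdsForLocalizationAway _ g)) ?_
    exact RingHom.Smooth.holdsForLocalizationAway _ (π (σ g))
  have hif : i.comp ((algebraMap R _).comp φ) = f := by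
    rw [← RingHom.comp_assoc, hi, RingHom.comp_assoc, hπ]
  have hpf : p.comp f = (algebraMap R _).comp φ := by
    rw [← hif, ← RingHom.comp_assoc, hpi, RingHom.id_comp]
  algebraize [f, (algebraMap R (Localization.Away (σ g))).comp φ]
  have : Algebra.Smooth A L := hf
  exact smooth_of_retract
    { i with commutes' := fun a => congr($hif a) } { p with commutes' := fun a => congr($hpf a) }
    (AlgHom.ext fun x => congr($hpi x))

end Retract

variable {V : Type v} [Fintype V] {A : TreeData V} {S : Scheme.{u}}
  {E : LinkedData A S} {r t : ℕ} {s : Γ(S, ⊤)}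

namespace FramedChart

variable {D : FramedChart E r t} {LG : PrelinkedGrassmannian E r t}

lemma Represents.restrict {X : Scheme.{u}} {p : X ⟶ S} {F : LinkedSubbundle (E.pullback p) r t}
    {W W' : X.Opens} {hWS : W ≤ p ⁻¹ᵁ D.base} {x : Fin r × Fin t → Γ(X, W)}
    (hx : D.Represents F hWS x) (h : W' ≤ W) :
    D.Represents F (h.trans hWS) (funRes h ∘ x) := by
  intro u
  obtain ⟨a, ha, hax⟩ := hx u
  refine ⟨fun i => secRes h (a i), ha.secRes h, fun i => ?_⟩
  refine (secMap_secRes _ h _).trans ((congrArg (secRes h) (hax i)).trans ?_)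
  refine (secRes_sum h _ _).trans (Finset.sum_congr rfl fun l _ => ?_)
  refine (secRes_smul h _ _).trans ?_
  have h1 : (p.appLE D.base W' (h.trans hWS)).hom = (funRes h).comp (p.appLE D.base W hWS).hom :=
    RingHom.ext fun a => (funRes_appLE p hWS h a).symm
  rw [h1, D.rows_map]
  exact congrArg₂ (· • ·) rfl (secRes_pullSec p hWS h _)

/-- The parameter space is the open part of the affine space of `r × t` matrices on which the
product of minors is invertible. Its classifying map to LG has near `ξ` a section given by the
coordinates `x`. -/
lemma exists_smooth_localizationAway (hE : IsPrelinked E s t) (hS : IsAffineOpen D.base)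
    {W : LG.X.Opens} (hW : IsAffineOpen W) (hWS : W ≤ LG.p ⁻¹ᵁ D.base)
    {x : Fin r × Fin t → Γ(LG.X, W)} (hx : D.Represents LG.univ hWS x)
    (hx' : IsUnit (D.minor (LG.p.appLE D.base W hWS).hom x)) {ξ : LG.X} (hξ : ξ ∈ W) :
    ∃ h : Γ(LG.X, W), ξ ∈ LG.X.basicOpen h ∧
      ((algebraMap Γ(LG.X, W) (Localization.Away h)).comp
        (LG.p.appLE D.base W hWS).hom).Smooth := by
  let φ := (LG.p.appLE D.base W hWS).hom
  let P : Type u := MvPolynomial (Fin r × Fin t) Γ(S, D.base)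
  let G : P := D.minor MvPolynomial.C MvPolynomial.X
  let B := CommRingCat.of (Localization.Away G)
  let φB : Γ(S, D.base) →+* B := (algebraMap P (Localization.Away G)).comp MvPolynomial.C
  let xB : Fin r × Fin t → B := algebraMap P (Localization.Away G) ∘ MvPolynomial.X
  have hxB : IsUnit (D.minor φB xB) := by
    rw [D.minor_map]
    exact IsLocalization.Away.algebraMap_isUnit G
  have hφB : φB.Smooth := by
    refine RingHom.Smooth.comp ?_ (RingHom.Smooth.holdsForLocalizationAway _ G)
    have := isStandardSmoothOfRelativeDimension_mvPolynomial Γ(S, D.base) (Fin r × Fin t)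
    have : Algebra.IsStandardSmooth Γ(S, D.base) P := this.isStandardSmooth
    exact RingHom.smooth_algebraMap.mpr inferInstance
  obtain ⟨β, hβ⟩ := exists_isClassifying hE (LG := LG) (hS := hS) hxB
  have hG : MvPolynomial.eval₂Hom φ x G = D.minor φ x := by
    rw [← D.minor_map]
    congr 1
    · ext; simp
    · ext; simp
  let σ : B →+* Γ(LG.X, W) :=
    IsLocalization.Away.lift G (g := MvPolynomial.eval₂Hom φ x) (hG ▸ hx')
  have hσ : σ.comp (algebraMap P (Localization.Away G)) = MvPolynomial.eval₂Hom φ x :=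
    IsLocalization.Away.lift_comp _ _
  have hσφ : σ.comp φB = φ := by
    rw [← RingHom.comp_assoc, hσ]
    exact RingHom.ext fun a => MvPolynomial.eval₂_C _ _ a
  have hσx : σ ∘ xB = x := by
    ext ij
    exact (congr($hσ (MvPolynomial.X ij))).trans (by simp)
  -- Both morphisms classify the subbundle with coordinates `x`, so the section followed by the
  -- classifying map is the inclusion of `W`.
  have hσβ : Spec.map (CommRingCat.ofHom σ) ≫ β = hW.specMap (RingHom.id _) := by
    have h1 := hβ.comp hE σ hxB
    rw [hσφ, hσx] at h1
    exact h1.unique (isClassifying_specMap hE (LG := LG) (hS := hS) hW hWS hx hx' (RingHom.id _))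
  let q : Spec Γ(LG.X, W) := hW.primeIdealOf ⟨ξ, hξ⟩
  have hq : hW.fromSpec q = ξ := hW.fromSpec_primeIdealOf ⟨ξ, hξ⟩
  have hβq : β (Spec.map (CommRingCat.ofHom σ) q) = ξ := by
    rw [← Scheme.Hom.comp_apply, hσβ]
    have h1 : hW.specMap (RingHom.id Γ(LG.X, W)) = hW.fromSpec :=
      (congrArg (· ≫ hW.fromSpec) (Spec.map_id Γ(LG.X, W))).trans (Category.id_comp _)
    exact (congrArg (fun f : Spec Γ(LG.X, W) ⟶ LG.X => f q) h1).trans hq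
  -- The classifying map need not land in `W`; the parameter space is cut down to a principal open
  -- subset which does, around the image of `ξ` under the section.
  obtain ⟨_, ⟨_, ⟨g, rfl⟩, rfl⟩, hqg, hgW⟩ :=
    PrimeSpectrum.isBasis_basic_opens.exists_subset_of_mem_open
      (a := Spec.map (CommRingCat.ofHom σ) q) (u := (β ⁻¹ᵁ W : Set (Spec B)))
      (show β (Spec.map (CommRingCat.ofHom σ) q) ∈ W from hβq.symm ▸ hξ) (β ⁻¹ᵁ W).2
  let L := CommRingCat.of (Localization.Away g)
  let M := CommRingCat.of (Localization.Away (σ g))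
  let ι : B →+* L := algebraMap B (Localization.Away g)
  have hι : ⊤ ≤ (Spec.map (CommRingCat.ofHom ι) ≫ β) ⁻¹ᵁ W := by
    rintro y -
    apply hgW
    change ι g ∉ y.asIdeal
    exact fun hy => y.isPrime.ne_top (Ideal.eq_top_of_isUnit_mem _ hy
      (IsLocalization.Away.algebraMap_isUnit g))
  obtain ⟨π, hπ⟩ : ∃ π : Γ(LG.X, W) →+* L, Spec.map (CommRingCat.ofHom ι) ≫ β = hW.specMap π :=
    ⟨_, hW.eq_specMap _ hι⟩
  refine ⟨σ g, ?_, smooth_localizationAway_of_retraction hφB σ g π ?_ ?_⟩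
  · have h1 : q ∈ hW.fromSpec ⁻¹ᵁ LG.X.basicOpen (σ g) := by
      rw [hW.fromSpec_preimage_basicOpen]
      exact hqg
    exact hq ▸ h1
  · apply hS.specMap_injective (C := L)
    have h1 := congrArg (· ≫ LG.p) hπ
    simp only [Category.assoc, hβ.comp_p, hS.specMap_comp, hW.specMap_comp_right hS LG.p hWS] at h1
    exact h1.symm
  · let σg : L →+* M :=
      IsLocalization.Away.map (Localization.Away g) (Localization.Away (σ g)) σ g
    have hσg : σg.comp ι = (algebraMap Γ(LG.X, W) M).comp σ := IsLocalization.map_comp _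
    apply hW.specMap_injective (C := M)
    have h1 := congrArg (Spec.map (CommRingCat.ofHom σg) ≫ ·) hπ
    simp only [hW.specMap_comp] at h1
    refine h1.symm.trans ?_
    rw [← Category.assoc, ← Spec.map_comp, ← CommRingCat.ofHom_comp, hσg, CommRingCat.ofHom_comp,
      Spec.map_comp, Category.assoc, hσβ, hW.specMap_comp, RingHom.comp_id]

end FramedChart

end

section

/-! ### The differentials of the equations of the alternating Grassmannian -/

section LinearAlgebra

variable {K : Type*} [Field K] {r t : ℕ}

/-- The derivative at `y` of the value at the `i`-th and `j`-th vector of a bilinear form with Gram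
matrix `g`. -/
def valueDeriv (g : Matrix (Fin t) (Fin t) K) (y : Fin r × Fin t → K) (i j : Fin r) :
    Fin r × Fin t → K :=
  ∑ k, ∑ l, g k l • (y (i, k) • Pi.single (j, l) (1 : K) + y (j, l) • Pi.single (i, k) (1 : K))

lemma valueDeriv_apply {g g' : Matrix (Fin t) (Fin t) K} (h : ∀ k l, g k l = -g' l k)
    (y : Fin r × Fin t → K) (i j p : Fin r) (k : Fin t) :
    valueDeriv g y i j (p, k) = (if i = p then g.mulVec (fun l => y (j, l)) k else 0) -
      if j = p then g'.mulVec (fun l => y (i, l)) k else 0 := by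
  have h1 (j : Fin r) (l : Fin t) :
      (Pi.single (j, l) (1 : K) : Fin r × Fin t → K) (p, k) =
        if j = p then (if l = k then 1 else 0) else 0 := by
    rw [Pi.single_apply]
    simp only [Prod.mk.injEq, ← ite_and, eq_comm]
  simp only [valueDeriv, Finset.sum_apply, Pi.smul_apply, Pi.add_apply, smul_eq_mul, h1,
    mul_add, Finset.sum_add_distrib]
  rw [add_comm, sub_eq_add_neg]
  congr 1
  · by_cases hi : i = p
    · simp [hi, Matrix.mulVec, dotProduct]
    · simp [hi]
  · by_cases hj : j = p
    · simp [hj, Matrix.mulVec, dotProduct, h]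
    · simp [hj]

/-- Only the partial derivatives in the coordinates of one vector `y_i` are needed to isolate the
coefficients of the pairs containing `i`. -/
lemma linearIndependent_valueDeriv (g : Fin r → Fin r → Matrix (Fin t) (Fin t) K)
    (hg : ∀ i j k l, g i j k l = -g j i l k) (y : Fin r × Fin t → K)
    (h : ∀ i, LinearIndependent K fun j => (g i j).mulVec fun l => y (j, l)) :
    LinearIndependent K fun ij : OrderedPair r => valueDeriv (g ij.1.1 ij.1.2) y ij.1.1 ij.1.2 := by
  refine Fintype.linearIndependent_iff.mpr fun c hc ij => ?_
  -- With `i = ij.1.1`, this is the coefficient of the pair `(i, q)` if `i < q`, minus that of `(q,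
  -- i)` if `q < i`, and `0` if `q = i`. The block of the relation at `i` is then a relation between
  -- the vectors in `h i`.
  let e (q : Fin r) : K := ∑ ab : OrderedPair r, c ab *
    ((if ab.1.1 = ij.1.1 ∧ ab.1.2 = q then 1 else 0) -
      if ab.1.2 = ij.1.1 ∧ ab.1.1 = q then 1 else 0)
  have he : ∑ q, e q • (g ij.1.1 q).mulVec (fun l => y (q, l)) = 0 := by
    ext k
    have h1 := congrFun hc (ij.1.1, k)
    simp only [Finset.sum_apply, Pi.smul_apply, smul_eq_mul, Pi.zero_apply] at h1
    simp only [Finset.sum_apply, Pi.smul_apply, smul_eq_mul, Pi.zero_apply]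
    rw [← h1]
    simp only [e, Finset.sum_mul]
    rw [Finset.sum_comm]
    refine Finset.sum_congr rfl fun ab _ => ?_
    simp only [mul_assoc, ← Finset.mul_sum, sub_mul, Finset.sum_sub_distrib]
    rw [valueDeriv_apply (hg ab.1.1 ab.1.2)]
    congr 2
    · by_cases h : ab.1.1 = ij.1.1 <;> simp [h]
    · by_cases h : ab.1.2 = ij.1.1 <;> simp [h]
  have h2 := Fintype.linearIndependent_iff.mp (h ij.1.1) e he ij.1.2
  rw [← h2]
  simp only [e]
  rw [Finset.sum_eq_single ij]
  · have : ¬ (ij.1.2 = ij.1.1 ∧ ij.1.1 = ij.1.2) := fun h => ij.2.ne h.2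
    simp [this]
  · intro ab _ hab
    have h3 : ¬ (ab.1.1 = ij.1.1 ∧ ab.1.2 = ij.1.2) := fun h => hab (Subtype.ext (Prod.ext h.1 h.2))
    have h4 : ¬ (ab.1.2 = ij.1.1 ∧ ab.1.1 = ij.1.2) := fun h => by
      have := ab.2
      rw [h.1, h.2] at this
      exact this.asymm ij.2
    simp [h3, h4]
  · simp

end LinearAlgebra

variable {V : Type v} [Fintype V] {A : TreeData V} {S : Scheme.{u}}
  {E : LinkedData A S} {r t : ℕ} {s : Γ(S, ⊤)}

namespace FramedChart

variable {D : FramedChart E r t} {m : V → ℤ}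

/-- A kernel vector of the Gram matrix at `y` would be a vector of the fibre orthogonal to
everything. -/
lemma isUnit_evalAt_det_gram (ω : LinkedAlternatingForm E s m) {u u' : A.Vert}
    (h : (ω.form u u').IsPerfect) {y : S} (hy : y ∈ D.base) :
    IsUnit (evalAt hy (D.gram ω u u').det) := by
  obtain ⟨C, hC, -, hC'⟩ := h y
  have hg := top_le_fromSpecResidueField hy
  let := (isField_residueField y).toField
  rw [RingHom.map_det, isUnit_iff_ne_zero]
  intro h0
  obtain ⟨v, hv, hv0⟩ := Matrix.exists_mulVec_eq_zero_iff.mpr h0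
  have hu := (D.isFrame u).pullSec (S.fromSpecResidueField y) hg
  have hu' := (D.isFrame u').pullSec (S.fromSpecResidueField y) hg
  have h1 : D.combination hg u' v = 0 := by
    apply hC'
    intro a
    obtain ⟨b, rfl⟩ := hu.exists_sum_eq a
    refine (D.toFun_combination ω hC hg b v).trans ?_
    have h2 : ∑ k, ∑ l, b k * v l * evalAt hy (D.gram ω u u' k l) =
        dotProduct b (((evalAt hy).mapMatrix (D.gram ω u u')).mulVec v) := by
      simp only [dotProduct, Matrix.mulVec, Finset.mul_sum, RingHom.mapMatrix_apply,
        Matrix.map_apply]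
      exact Finset.sum_congr rfl fun k _ => Finset.sum_congr rfl fun l _ => by ring
    exact h2.trans (by rw [hv0, dotProduct_zero])
  exact hv (hu'.eq_of_sum_eq (h1.trans (by simp)))

lemma isUnit_det_of_isUnit_minor {R : Type*} [CommRing R] {φ : Γ(S, D.base) →+* R}
    {x : Fin r × Fin t → R} (h : IsUnit (D.minor φ x)) (u : A.Vert) :
    IsUnit ((D.rows φ x u).submatrix id fun i => D.split u (Sum.inl i)).det :=
  isUnit_of_dvd_unit (Finset.dvd_prod_of_mem (fun u => ((D.rows φ x u).submatrix id
    fun i => D.split u (Sum.inl i)).det) (Finset.mem_univ u)) h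

/-- At `u` the rows are independent and the Gram matrix with `w_i` is invertible, so pairing with
the rows gives independent functionals. Moving the second argument from `w_j` to `u` only rescales
the functional. -/
lemma linearIndependent_mulVec_gram {K : Type*} [Field K] (ω : LinkedAlternatingForm E s m)
    (φ : Γ(S, D.base) →+* K) (y : Fin r × Fin t → K) {i : Fin r} {u : A.Vert}
    (hu : IsUnit (φ (D.gram ω (D.w i) u).det))
    (hy : IsUnit ((D.rows φ y u).submatrix id fun i => D.split u (Sum.inl i)).det) :
    LinearIndependent K fun j =>
      ((D.gram ω (D.w i) (D.w j)).map φ).mulVec fun l => y (j, l) := by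
  let M : Matrix (Fin r) (Fin t) K := Matrix.of fun j =>
    ((D.gram ω (D.w i) (D.w j)).map φ).mulVec fun l => y (j, l)
  let M' : Matrix (Fin r) (Fin t) K := Matrix.of fun j =>
    ((D.gram ω (D.w i) u).map φ).mulVec (D.rows φ y u j)
  have hM (j : Fin r) : ∃ c : K, M' j = c • M j := by
    obtain ⟨c, hc⟩ := D.exists_gram_eq ω (Quiver.Path.nil : Quiver.Path (D.w i) (D.w i))
      (D.path j u)
    rw [pathMatrix_nil, Matrix.one_mul] at hc
    refine ⟨φ c, ?_⟩
    have h := congrArg (fun M : Matrix (Fin t) (Fin t) Γ(S, D.base) => M.map φ) hc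
    simp only [Matrix.map_mul, Matrix.transpose_map] at h
    have h' : (c • D.gram ω (D.w i) (D.w j)).map φ = φ c • (D.gram ω (D.w i) (D.w j)).map φ := by
      ext
      simp
    have h1 : D.rows φ y u j =
      Matrix.vecMul (fun k => y (j, k)) ((D.pathMatrix (D.path j u)).map φ) := rfl
    change ((D.gram ω (D.w i) u).map φ).mulVec (D.rows φ y u j) =
      φ c • ((D.gram ω (D.w i) (D.w j)).map φ).mulVec fun l => y (j, l)
    refine (congrArg _ h1).trans ?_
    rw [ ← Matrix.mulVec_transpose, Matrix.mulVec_mulVec, h, h', Matrix.smul_mulVec]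
  choose c hc using hM
  refine Matrix.vecMul_injective_iff.mp (vecMul_injective_of_smul_rows (M := M)
    (Field.toIsField K) c hc ?_)
  have hM' : M' = D.rows φ y u * ((D.gram ω (D.w i) u).map φ).transpose := by
    ext j k
    simp [M', Matrix.mul_apply, Matrix.mulVec, dotProduct, mul_comm]
  intro a b hab
  simp only [hM', ← Matrix.vecMul_vecMul] at hab
  have h1 : IsUnit ((D.gram ω (D.w i) u).map φ).transpose := by
    rw [Matrix.isUnit_iff_isUnit_det, Matrix.det_transpose]
    rw [RingHom.map_det] at hu
    exact hu
  have h2 := Matrix.vecMul_injective_of_isUnit h1 hab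
  refine Matrix.vecMul_injective_of_isUnit ((Matrix.isUnit_iff_isUnit_det _).mpr hy) ?_
  ext k
  exact congrFun h2 (D.split u (Sum.inl k))

section DualNumbers

variable {K : Type*} [Field K]

/-- Each coordinate gets its own infinitesimal, so the square-zero part is the whole gradient. -/
lemma snd_formValue (ω : LinkedAlternatingForm E s m) (φ : Γ(S, D.base) →+* K)
    (y : Fin r × Fin t → K) (i j : Fin r) :
    (D.formValue ω ((TrivSqZeroExt.inlHom K (Fin r × Fin t → K)).comp φ)
      (fun a => TrivSqZeroExt.inl (y a) + TrivSqZeroExt.inr (Pi.single a 1)) i j).snd =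
      valueDeriv ((D.gram ω (D.w i) (D.w j)).map φ) y i j := by
  simp only [formValue, valueDeriv, TrivSqZeroExt.snd_sum]
  refine Finset.sum_congr rfl fun k _ => Finset.sum_congr rfl fun l _ => ?_
  simp [TrivSqZeroExt.snd_mul, TrivSqZeroExt.fst_mul, op_smul_eq_smul, smul_smul]

end DualNumbers

variable {LG : PrelinkedGrassmannian E r t}

/-- Infinitesimal deformations of the universal linked subbundle with prescribed coordinates. -/
lemma exists_deformation (hE : IsPrelinked E s t) (hS : IsAffineOpen D.base)
    {ω : LinkedAlternatingForm E s m} (LAG : PrelinkedAlternatingGrassmannian LG ω)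
    {W : LG.X.Opens} (hW : IsAffineOpen W) (hWS : W ≤ LG.p ⁻¹ᵁ D.base)
    {x : Fin r × Fin t → Γ(LG.X, W)} (hx : D.Represents LG.univ hWS x)
    (hx' : IsUnit (D.minor (LG.p.appLE D.base W hWS).hom x))
    {C C₀ : CommRingCat.{u}} (ρ : C →+* C₀) (hρ : Function.Surjective ρ)
    (hn : ∀ c, ρ c = 0 → IsNilpotent c) (ψ : Γ(LG.X, W) →+* C₀) {φC : Γ(S, D.base) →+* C}
    {xC : Fin r × Fin t → C} (hφ : ρ.comp φC = ψ.comp (LG.p.appLE D.base W hWS).hom)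
    (hρx : ρ ∘ xC = ψ ∘ x) :
    ∃ f : Γ(LG.X, W) →+* C, ρ.comp f = ψ ∧ f.comp (LG.p.appLE D.base W hWS).hom = φC ∧
      ∀ J : Ideal C,
        (∀ i j, i < j → f (D.formValue ω (LG.p.appLE D.base W hWS).hom x i j) ∈ J) →
          ∀ i j, i < j → D.formValue ω φC xC i j ∈ J := by
  have := LAG.isClosedImmersion
  -- The product of minors is a unit modulo a nil ideal, hence a unit.
  have hxC : IsUnit (D.minor φC xC) := by
    have h1 := D.minor_map φC xC ρ
    rw [hφ, hρx, D.minor_map] at h1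
    obtain ⟨c, hc⟩ := (h1 ▸ hx'.map ψ).exists_right_inv
    obtain ⟨c, rfl⟩ := hρ c
    have h2 : IsNilpotent (D.minor φC xC * c - 1) := hn _ (by
      rw [map_sub, map_mul, hc, map_one, sub_self])
    refine isUnit_of_mul_isUnit_left (y := c) ?_
    have := h2.isUnit_one_add
    rwa [add_sub_cancel] at this
  obtain ⟨h, hh⟩ := exists_isClassifying hE (LG := LG) (hS := hS) hxC
  have h1 : Spec.map (CommRingCat.ofHom ρ) ≫ h = hW.specMap ψ := by
    have h2 := hh.comp hE ρ hxC
    rw [hφ, hρx] at h2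
    exact h2.unique (isClassifying_specMap hE (LG := LG) (hS := hS) hW hWS hx hx' ψ)
  -- Since the kernel of `ρ` is nil, all points of `Spec C` come from `Spec C₀`, where the morphism
  -- lands in `W`.
  have hhW : ⊤ ≤ h ⁻¹ᵁ W := by
    rintro y -
    have hy : y ∈ Set.range (PrimeSpectrum.comap ρ) := by
      rw [range_comap_of_surjective _ _ hρ]
      exact fun c hc => y.isPrime.mem_of_pow_mem _ ((hn c hc).choose_spec ▸ zero_mem _)
    obtain ⟨y, rfl⟩ := hy
    have h2 : y ∈ (Spec.map (CommRingCat.ofHom ρ) ≫ h) ⁻¹ᵁ W := by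
      rw [h1]
      exact hW.top_le_specMap ψ (Set.mem_univ y)
    exact h2
  obtain ⟨f, hf⟩ : ∃ f : Γ(LG.X, W) →+* C, h = hW.specMap f := ⟨_, hW.eq_specMap _ hhW⟩
  refine ⟨f, ?_, ?_, fun J hJ i j hij => ?_⟩
  · apply hW.specMap_injective
    rw [← h1, hf, hW.specMap_comp]
  · apply hS.specMap_injective
    rw [← hW.specMap_comp_right hS LG.p hWS, ← hf]
    exact hh.comp_p
  -- The homomorphism `f` need not send `x` to `xC`: different tuples may span the same subbundle.
  -- Modulo `J`, however, the equations for either tuple express that this subbundle is isotropic.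
  · let q : C →+* CommRingCat.of (C ⧸ J) := Ideal.Quotient.mk J
    have h2 : ∃ k, k ≫ LAG.i = Spec.map (CommRingCat.ofHom q) ≫ h := by
      rw [hf, hW.specMap_comp, exists_comp_eq_specMap_iff hW LAG.i,
        ker_app_eq_span hE LAG hS hW hWS hx hx', Ideal.span_le]
      rintro - ⟨ab, rfl⟩
      exact Ideal.Quotient.eq_zero_iff_mem.mpr (hJ _ _ ab.2)
    have h3 := ((hh.comp hE q hxC).exists_comp_eq_iff LAG).mp h2 i j hij
    rw [D.formValue_map] at h3
    exact Ideal.Quotient.eq_zero_iff_mem.mp h3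

/-- The differentials of the equations of the alternating Grassmannian are linearly independent at
points at which the form is internally nondegenerate. -/
lemma exists_linearIndependent_snd (hE : IsPrelinked E s t) (hS : IsAffineOpen D.base)
    {ω : LinkedAlternatingForm E s m} (LAG : PrelinkedAlternatingGrassmannian LG ω)
    {W : LG.X.Opens} (hW : IsAffineOpen W) (hWS : W ≤ LG.p ⁻¹ᵁ D.base)
    {x : Fin r × Fin t → Γ(LG.X, W)} (hx : D.Represents LG.univ hWS x)
    (hx' : IsUnit (D.minor (LG.p.appLE D.base W hWS).hom x))
    {K : Type u} [Field K] (ψ : Γ(LG.X, W) →+* K)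
    (hψ : ∀ i j, ψ (D.formValue ω (LG.p.appLE D.base W hWS).hom x i j) = 0)
    (hω : ∀ i, ∃ u, IsUnit (ψ ((LG.p.appLE D.base W hWS).hom (D.gram ω (D.w i) u).det))) :
    ∃ f : Γ(LG.X, W) →+* TrivSqZeroExt K (Fin r × Fin t → K), (∀ a, (f a).fst = ψ a) ∧
      (∀ a, (f ((LG.p.appLE D.base W hWS).hom a)).snd = 0) ∧
      LinearIndependent K fun ab : OrderedPair r =>
        (f (D.formValue ω (LG.p.appLE D.base W hWS).hom x ab.1.1 ab.1.2)).snd := by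
  obtain ⟨f, hf, hfφ, hJ⟩ := exists_deformation hE hS LAG hW hWS hx hx'
    (C := CommRingCat.of (TrivSqZeroExt K (Fin r × Fin t → K))) (C₀ := CommRingCat.of K)
    (TrivSqZeroExt.fstHom K K (Fin r × Fin t → K)).toRingHom
    (fun c => ⟨TrivSqZeroExt.inl c, rfl⟩)
    (fun c hc => TrivSqZeroExt.isNilpotent_iff_isNilpotent_fst.mpr (by
      have hc : c.fst = 0 := hc
      rw [hc]
      exact IsNilpotent.zero)) ψ
    (φC := (TrivSqZeroExt.inlHom K (Fin r × Fin t → K)).comp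
      (ψ.comp (LG.p.appLE D.base W hWS).hom))
    (xC := fun a => TrivSqZeroExt.inl (ψ (x a)) + TrivSqZeroExt.inr (Pi.single a 1))
    (RingHom.ext fun a => rfl) (funext fun a => by
      change (TrivSqZeroExt.inl (ψ (x a)) + TrivSqZeroExt.inr (Pi.single a 1) :
        TrivSqZeroExt K (Fin r × Fin t → K)).fst = ψ (x a)
      simp)
  have hf1 (a) : (f a).fst = ψ a := congr($hf a)
  refine ⟨f, hf1, fun a => ?_, ?_⟩
  · have h1 : f ((LG.p.appLE D.base W hWS).hom a) = TrivSqZeroExt.inl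
        (ψ ((LG.p.appLE D.base W hWS).hom a)) := congr($hfφ a)
    rw [h1, TrivSqZeroExt.snd_inl]
  · let g (i j : Fin r) : Matrix (Fin t) (Fin t) K :=
      (D.gram ω (D.w i) (D.w j)).map (ψ.comp (LG.p.appLE D.base W hWS).hom)
    -- The value at the deformed tuple is a combination of the images under `f` of the equations.
    -- These have zero constant term by `hψ`, so only the constant terms of the coefficients
    -- contribute to the gradient.
    have hspan (ij : OrderedPair r) : valueDeriv (g ij.1.1 ij.1.2) (ψ ∘ x) ij.1.1 ij.1.2 ∈
        Submodule.span K (Set.range fun ab : OrderedPair r =>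
          (f (D.formValue ω (LG.p.appLE D.base W hWS).hom x ab.1.1 ab.1.2)).snd) := by
      have h1 := hJ (Ideal.span (Set.range fun ab : OrderedPair r =>
        f (D.formValue ω (LG.p.appLE D.base W hWS).hom x ab.1.1 ab.1.2)))
        (fun i j hij => Ideal.subset_span ⟨⟨(i, j), hij⟩, rfl⟩) _ _ ij.2
      obtain ⟨c, hc⟩ := Ideal.mem_span_range_iff_exists_fun.mp h1
      have h2 := D.snd_formValue ω (ψ.comp (LG.p.appLE D.base W hWS).hom) (ψ ∘ x) ij.1.1 ij.1.2
      have h3 := (congrArg TrivSqZeroExt.snd hc).trans h2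
      refine h3 ▸ ?_
      rw [TrivSqZeroExt.snd_sum]
      refine Submodule.sum_mem _ fun ab _ => ?_
      have h4 := TrivSqZeroExt.snd_mul (c ab)
        (f (D.formValue ω (LG.p.appLE D.base W hWS).hom x ab.1.1 ab.1.2))
      rw [hf1, hψ, MulOpposite.op_zero, zero_smul, add_zero] at h4
      exact h4 ▸ Submodule.smul_mem _ _ (Submodule.subset_span ⟨ab, rfl⟩)
    have hind : LinearIndependent K fun ij : OrderedPair r =>
        valueDeriv (g ij.1.1 ij.1.2) (ψ ∘ x) ij.1.1 ij.1.2 := by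
      apply linearIndependent_valueDeriv
      · intro i j k l
        simp only [g, Matrix.map_apply]
        rw [D.gram_swap, map_neg]
      · intro i
        obtain ⟨u, hu⟩ := hω i
        have h1 := D.isUnit_det_of_isUnit_minor (φ := (LG.p.appLE D.base W hWS).hom) hx' u
        exact linearIndependent_mulVec_gram ω (ψ.comp (LG.p.appLE D.base W hWS).hom) (ψ ∘ x)
          (by rwa [RingHom.comp_apply]) (by
            have h2 := h1.map ψ
            rw [RingHom.map_det] at h2
            rw [D.rows_map]
            exact h2)
    -- The span contains as many independent vectors as there are equations.
    rw [linearIndependent_iff_card_le_finrank_span]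
    refine (linearIndependent_iff_card_eq_finrank_span.mp hind).le.trans ?_
    exact Submodule.finrank_mono (Submodule.span_le.mpr (Set.range_subset_iff.mpr hspan))

end FramedChart

end

section

section Algebra

/-- The Jacobian criterion, for functions whose differentials are given by a ring homomorphism to the
dual numbers. -/
lemma exists_isStandardSmooth_of_trivSqZeroExt {A R K : Type u} {ι : Type*} [CommRing A] [CommRing R] [Field K] {φ : A →+* R}
    (hφ : φ.IsStandardSmooth) (ψ : R →+* K) (f : R →+* TrivSqZeroExt K (ι → K))
    (hf : ∀ a, (f a).fst = ψ a) (hfφ : ∀ a, (f (φ a)).snd = 0) {c : ℕ} (a : Fin c → R)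
    (ha : LinearIndependent K fun k => (f (a k)).snd) :
    ∃ h : R, ψ h ≠ 0 ∧ ∃ n, ∀ (S : Type u) [CommRing S] [Algebra R S] [IsLocalization.Away h S],
      ((algebraMap R S).comp φ).IsStandardSmoothOfRelativeDimension (n + c) ∧
      ((Ideal.Quotient.mk (Ideal.span (Set.range fun k => algebraMap R S (a k)))).comp
        ((algebraMap R S).comp φ)).IsStandardSmoothOfRelativeDimension n := by
  algebraize [φ]
  let := ψ.toAlgebra
  let := (ψ.comp φ).toAlgebra
  have : IsScalarTower A R K := .of_algebraMap_eq' rfl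
  have : IsScalarTower A R (ι → K) := Pi.isScalarTower
  have hfs (b : A) : (f (algebraMap A R b)).snd = 0 := hfφ b
  -- The square-zero part of a homomorphism to the dual numbers is a derivation, where `R` acts on
  -- the values through `ψ`; it is `A`-linear since `f` is constant on `A`.
  let δ : Derivation A R (ι → K) := Derivation.mk'
    { toFun := fun a => (f a).snd
      map_add' := by simp
      map_smul' := fun b a => by
        rw [Algebra.smul_def, map_mul, TrivSqZeroExt.snd_mul, hfs, hf]
        ext l
        simp [Algebra.smul_def]
        exact Or.inl rfl }
    fun a b => by
      change (f (a * b)).snd = _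
      rw [map_mul, TrivSqZeroExt.snd_mul, hf, hf]
      ext l
      simp [Algebra.smul_def]
      rfl
  obtain ⟨h, hh, n, hn⟩ := exists_isStandardSmoothOfRelativeDimension_quotient (K := K) δ a ha
  refine ⟨h, hh, n, fun S _ _ _ => ?_⟩
  let := ((algebraMap R S).comp φ).toAlgebra
  have : IsScalarTower A R S := .of_algebraMap_eq' rfl
  exact ⟨(RingHom.isStandardSmoothOfRelativeDimension_algebraMap _).mpr (hn S).1,
    (RingHom.isStandardSmoothOfRelativeDimension_algebraMap _).mpr (hn S).2⟩

end Algebra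

/-! ### Smoothness of the alternating Grassmannian at internally simple points -/

section Smooth

variable {X S : Scheme.{u}} {p : X ⟶ S} {V : S.Opens} {U : X.Opens}

lemma smoothOfRelativeDimension_ι_comp (hV : IsAffineOpen V) (hU : IsAffineOpen U)
    (e : U ≤ p ⁻¹ᵁ V) {n : ℕ} (h : (p.appLE V U e).hom.IsStandardSmoothOfRelativeDimension n) :
    SmoothOfRelativeDimension n (U.ι ≫ p) := by
  have h1 : ⊤ ≤ U.ι ⁻¹ᵁ U := by simp
  have h2 : ⊤ ≤ (U.ι ≫ p) ⁻¹ᵁ V := h1.trans (U.ι.preimage_mono e)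
  have : IsAffine U.toScheme := hU
  refine ⟨fun x => ⟨V, hV, ⊤, isAffineOpen_top _, trivial, h2, ?_⟩⟩
  have h3 : IsIso (U.ι.appLE U ⊤ h1) := by
    have h5 : U.ι ''ᵁ ⊤ = U := U.ι_image_top
    have h6 : homOfLE (x := U.ι ''ᵁ ⊤) (Set.image_subset_iff.mpr h1) = (eqToIso h5).hom := rfl
    refine (Scheme.Opens.ι_appLE U U ⊤ h1).symm ▸ ?_
    rw [h6]
    exact (X.presheaf.mapIso (eqToIso h5).op).isIso_hom
  have h4 : (U.ι ≫ p).appLE V ⊤ h2 = p.appLE V U e ≫ U.ι.appLE U ⊤ h1 :=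
    (Scheme.Hom.appLE_comp_appLE U.ι p V U ⊤ e h1).symm
  rw [h4]
  exact RingHom.isStandardSmoothOfRelativeDimension_respectsIso.1 _
      (asIso (U.ι.appLE U ⊤ h1)).commRingCatIsoToRingEquiv h

lemma smoothOfRelativeDimension_ι_comp_of_isClosedImmersion {Y : Scheme.{u}} (i : Y ⟶ X)
    [IsClosedImmersion i] (hV : IsAffineOpen V) (hU : IsAffineOpen U) (e : U ≤ p ⁻¹ᵁ V) {n : ℕ}
    (h : ((Ideal.Quotient.mk (RingHom.ker (i.app U).hom)).comp
      (p.appLE V U e).hom).IsStandardSmoothOfRelativeDimension n) :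
    SmoothOfRelativeDimension n ((i ⁻¹ᵁ U).ι ≫ i ≫ p) := by
  refine smoothOfRelativeDimension_ι_comp hV (hU.preimage i) (i.preimage_mono e) ?_
  have h1 : (i ≫ p).appLE V (i ⁻¹ᵁ U) (i.preimage_mono e) = p.appLE V U e ≫ i.app U :=
    (Scheme.Hom.appLE_comp_appLE i p V U (i ⁻¹ᵁ U) e le_rfl).symm.trans
      (congrArg (p.appLE V U e ≫ ·) i.appLE_eq_app)
  refine (congrArg (fun g => g.hom.IsStandardSmoothOfRelativeDimension n) h1).mpr ?_
  exact RingHom.isStandardSmoothOfRelativeDimension_respectsIso.1 _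
    (RingHom.quotientKerEquivOfSurjective (i.app_surjective U hU)) h

lemma evaluation_eq_zero_of_app_eq_zero {Y : Scheme.{u}} (i : Y ⟶ X) (z : Y) (hz : i z ∈ U)
    (a : Γ(X, U)) (h : (i.app U).hom a = 0) : X.evaluation U (i z) hz a = 0 := by
  by_contra h0
  have h1 : z ∈ i ⁻¹ᵁ X.basicOpen a := (X.evaluation_ne_zero_iff_mem_basicOpen _ hz a).mp h0
  rw [Scheme.preimage_basicOpen] at h1
  have h2 : Y.basicOpen ((i.app U).hom a) = ⊥ := by rw [h, Scheme.basicOpen_zero]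
  exact (h2.le h1).elim

lemma of_localizationAway {P : ∀ {R R' : Type u} [CommRing R] [CommRing R'], (R →+* R') → Prop}
    (hP : RingHom.RespectsIso P) (hU : IsAffineOpen U) (e : U ≤ p ⁻¹ᵁ V) (f : Γ(X, U))
    (h : P ((algebraMap Γ(X, U) (Localization.Away f)).comp (p.appLE V U e).hom)) :
    P (p.appLE V (X.basicOpen f) ((X.basicOpen_le f).trans e)).hom := by
  have := hU.isLocalization_basicOpen f
  let i := IsLocalization.algEquiv (Submonoid.powers f) (Localization.Away f) Γ(X, X.basicOpen f)
  have h1 := hP.1 _ i.toRingEquiv h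
  have h2 : (p.appLE V (X.basicOpen f) ((X.basicOpen_le f).trans e)).hom =
      i.toRingEquiv.toRingHom.comp
        ((algebraMap Γ(X, U) (Localization.Away f)).comp (p.appLE V U e).hom) := by
    ext a
    refine (funRes_appLE p e (X.basicOpen_le f) a).symm.trans ?_
    exact (i.commutes ((p.appLE V U e).hom a)).symm
  rwa [h2]

/-- A smooth morphism is standard smooth near any given point. -/
lemma exists_isStandardSmooth (hU : IsAffineOpen U) (e : U ≤ p ⁻¹ᵁ V)
    (h : (p.appLE V U e).hom.Smooth) {ξ : X} (hξ : ξ ∈ U) :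
    ∃ f : Γ(X, U), ξ ∈ X.basicOpen f ∧
      (p.appLE V (X.basicOpen f) ((X.basicOpen_le f).trans e)).hom.IsStandardSmooth := by
  algebraize [(p.appLE V U e).hom]
  have : Algebra.Smooth Γ(S, V) Γ(X, U) := h
  obtain ⟨s, hs, hs'⟩ := Algebra.Smooth.exists_span_eq_top_isStandardSmooth Γ(S, V) Γ(X, U)
  obtain ⟨f, hf, hfξ⟩ : ∃ f ∈ s, X.evaluation U ξ hξ f ≠ 0 := by
    by_contra! H
    have h1 : Ideal.span s ≤ RingHom.ker (X.evaluation U ξ hξ).hom := Ideal.span_le.mpr H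
    rw [hs, top_le_iff] at h1
    exact RingHom.ker_ne_top _ h1
  refine ⟨f, (X.evaluation_ne_zero_iff_mem_basicOpen ξ hξ f).mp hfξ, ?_⟩
  refine of_localizationAway RingHom.isStandardSmooth_respectsIso hU e f ?_
  exact RingHom.isStandardSmooth_algebraMap.mpr (hs' f hf)

end Smooth

variable {V : Type v} [Fintype V] {A : TreeData V} {S : Scheme.{u}}
  {E : LinkedData A S} {r t : ℕ} {s : Γ(S, ⊤)}

lemma isSmoothOfCodimAt (hrt : r < t) (hE : IsPrelinked E s t) {m : V → ℤ}
    {ω : LinkedAlternatingForm E s m} {LG : PrelinkedGrassmannian E r t}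
    (LAG : PrelinkedAlternatingGrassmannian LG ω) (z : LAG.Y) (hω : ω.IsInternallySymplectic)
    (hz : LG.univ.toLinkedData.IsInternallySimpleAt r m (LAG.i z)) :
    IsSmoothOfCodimAt LAG.i LG.p z (r.choose 2) := by
  have := LAG.isClosedImmersion
  obtain ⟨w, y, hy, hw⟩ := hz
  obtain ⟨D, hS, rfl, W, hWS, x, hW, hzW, hx, hx'⟩ := exists_framedChart hrt hE LG.univ hy
  have hres {W W' : LG.X.Opens} (h : W' ≤ W) (hWS : W ≤ LG.p ⁻¹ᵁ D.base) :
      (LG.p.appLE D.base W' (h.trans hWS)).hom = (funRes h).comp (LG.p.appLE D.base W hWS).hom :=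
    RingHom.ext fun a => (funRes_appLE LG.p hWS h a).symm
  have hminor {W W' : LG.X.Opens} (h : W' ≤ W) (hWS : W ≤ LG.p ⁻¹ᵁ D.base)
      {x : Fin r × Fin t → Γ(LG.X, W)} (hx' : IsUnit (D.minor (LG.p.appLE D.base W hWS).hom x)) :
      IsUnit (D.minor (LG.p.appLE D.base W' (h.trans hWS)).hom (funRes h ∘ x)) := by
    rw [hres h hWS, D.minor_map]
    exact hx'.map _
  -- The chart is shrunk twice: first to where LG is smooth over the base, then to where it is
  -- standard smooth.
  obtain ⟨W, hWS, x, hW, hzW, hx, hx', hsm⟩ : ∃ (W : LG.X.Opens) (hWS : W ≤ LG.p ⁻¹ᵁ D.base)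
      (x : Fin r × Fin t → Γ(LG.X, W)), IsAffineOpen W ∧ LAG.i z ∈ W ∧
      D.Represents LG.univ hWS x ∧ IsUnit (D.minor (LG.p.appLE D.base W hWS).hom x) ∧
      (LG.p.appLE D.base W hWS).hom.IsStandardSmooth := by
    obtain ⟨f, hf, hsm⟩ := D.exists_smooth_localizationAway hE hS hW hWS hx hx' hzW
    obtain ⟨g, hg, hsm⟩ := exists_isStandardSmooth (hW.basicOpen f) _
      (of_localizationAway RingHom.Smooth.respectsIso hW hWS f hsm) hf
    exact ⟨_, _, _, (hW.basicOpen f).basicOpen g, hg,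
      (hx.restrict (LG.X.basicOpen_le f)).restrict (LG.X.basicOpen_le g),
      hminor _ _ (hminor (LG.X.basicOpen_le f) hWS hx'), hsm⟩
  let φ := (LG.p.appLE D.base W hWS).hom
  let K := LG.X.residueField (LAG.i z)
  let ψ : Γ(LG.X, W) →+* K := (LG.X.evaluation W (LAG.i z) hzW).hom
  have hker (i j : Fin r) (hij : i < j) : (LAG.i.app W).hom (D.formValue ω φ x i j) = 0 := by
    have h1 : D.formValue ω φ x i j ∈ RingHom.ker (LAG.i.app W).hom := by
      rw [FramedChart.ker_app_eq_span hE LAG hS hW hWS hx hx']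
      exact Ideal.subset_span ⟨⟨(i, j), hij⟩, rfl⟩
    exact h1
  have hψ (i j : Fin r) : ψ (D.formValue ω φ x i j) = 0 := by
    rw [← D.formValue_map]
    refine D.formValue_eq_zero ω _ _ (fun i j hij => ?_) i j
    rw [D.formValue_map]
    exact evaluation_eq_zero_of_app_eq_zero LAG.i z hzW _ (hker i j hij)
  -- Internal simplicity makes `2m - w_i` a vertex; its midpoint with `w_i` is `m`, so the pairing
  -- there is perfect.
  have hgram (i : Fin r) : ∃ u, IsUnit (ψ (φ (D.gram ω (D.w i) u).det)) := by
    refine ⟨⟨2 • m - (D.w i).1, hw i⟩, ?_⟩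
    have h1 : TreeData.mid (D.w i) ⟨2 • m - (D.w i).1, hw i⟩ = m := by
      funext c
      simp [TreeData.mid]
    have h2 := (mem_basicOpen_iff_isUnit_evalAt (X := S) (ξ := LG.p (LAG.i z)) (hWS hzW) _).mpr
      (D.isUnit_evalAt_det_gram ω (hω _ _ h1) (hWS hzW))
    refine isUnit_iff_ne_zero.mpr ((LG.X.evaluation_ne_zero_iff_mem_basicOpen _ hzW _).mpr ?_)
    exact (Scheme.basicOpen_appLE LG.p W D.base hWS _).ge ⟨hzW, h2⟩
  obtain ⟨f, hf, hfφ, hind⟩ := D.exists_linearIndependent_snd hE hS LAG hW hWS hx hx' ψ hψ hgram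
  obtain ⟨h, hh, n, hn⟩ := exists_isStandardSmooth_of_trivSqZeroExt hsm ψ f hf hfφ
    (fun k => (D.formValue ω φ x ((Fintype.equivFinOfCardEq (card_orderedPair r)).symm k).1.1
      ((Fintype.equivFinOfCardEq (card_orderedPair r)).symm k).1.2))
    (hind.comp _ (Fintype.equivFinOfCardEq (card_orderedPair r)).symm.injective)
  have hU := hW.basicOpen h
  have hle := LG.X.basicOpen_le h
  have := hW.isLocalization_basicOpen h
  obtain ⟨hn1, hn2⟩ := hn Γ(LG.X, LG.X.basicOpen h)
  refine ⟨LG.X.basicOpen h, (LG.X.evaluation_ne_zero_iff_mem_basicOpen _ hzW h).mp hh, n,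
    smoothOfRelativeDimension_ι_comp hS hU (hle.trans hWS) ?_,
    smoothOfRelativeDimension_ι_comp_of_isClosedImmersion LAG.i hS hU (hle.trans hWS) ?_⟩
  · rw [hres hle hWS]
    exact hn1
  -- The equations for the restricted coordinates are the restrictions of the equations on `W`.
  · have hI : RingHom.ker (LAG.i.app (LG.X.basicOpen h)).hom = Ideal.span (Set.range fun k =>
        algebraMap Γ(LG.X, W) Γ(LG.X, LG.X.basicOpen h) (D.formValue ω φ x
          ((Fintype.equivFinOfCardEq (card_orderedPair r)).symm k).1.1
          ((Fintype.equivFinOfCardEq (card_orderedPair r)).symm k).1.2)) := by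
      rw [FramedChart.ker_app_eq_span hE LAG hS hU (hle.trans hWS) (hx.restrict hle)
        (hminor hle hWS hx'), hres hle hWS]
      have h1 : (fun ij : OrderedPair r => D.formValue ω ((funRes hle).comp φ) (funRes hle ∘ x)
          ij.1.1 ij.1.2) = fun ij => funRes hle (D.formValue ω φ x ij.1.1 ij.1.2) :=
        funext fun ij => D.formValue_map ω φ x (funRes hle) ij.1.1 ij.1.2
      exact congrArg Ideal.span ((congrArg Set.range h1).trans
        ((Fintype.equivFinOfCardEq (card_orderedPair r)).symm.surjective.range_comp _).symm)
    rw [hI, hres hle hWS]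
    exact hn2

end

end PrelinkedAG

end

theorem theorem1p4 {V : Type v} [Fintype V] (A : TreeData V) {S : Scheme.{u}} (s : Γ(S, ⊤))
    (r t : ℕ) (hrt : r < t) (E : LinkedData A S) (hE : IsPrelinked E s t)
    (m : V → ℤ) (hm : ∑ x, m x = A.d) (ω : LinkedAlternatingForm E s m)
    (LG : PrelinkedGrassmannian E r t) (LAG : PrelinkedAlternatingGrassmannian LG ω)
    (z : LAG.Y) (hz : LG.univ.toLinkedData.IsSimpleAt r (LAG.i z)) :
    IsLocallyCutOutBy LAG.i z (r.choose 2) ∧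
    (ω.IsInternallySymplectic →
      LG.univ.toLinkedData.IsInternallySimpleAt r m (LAG.i z) →
      IsSmoothOfCodimAt LAG.i LG.p z (r.choose 2)) :=
  ⟨isLocallyCutOutBy hrt hE LAG z hz, fun hω hz' => isSmoothOfCodimAt hrt hE LAG z hω hz'⟩
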